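/- Let $X$ be a topological space with a sheaf $\mathcal R$ of (not necessarily commutative) rings, and let $\mathcal U=\{U_i\}_{i\in I}$ be a locally finite open cover of $X$; put $U_{i_0\ldots i_k}=U_{i_0}\cap\dots\cap U_{i_k}$. All modules are left modules. For an open set $V$ let $Cpx(V)$ be the dg-category of complexes of sheaves of $\mathcal R|_V$-modules: morphisms of degree $q$ are all homogeneous maps of degree $q$, with differential $f\mapsto d\circ f-(-1)^q f\circ d$. Let $Cpx(N_\bullet)$ be the cosimplicial dg-category of the Čech nerve: $Cpx(N_n)=\prod_{(i_0\ldots i_n)}Cpx(U_{i_0\ldots i_n})$ over all $(n+1)$-tuples of indices, and $\sigma:[n]\to[m]$ acts by $(\sigma_*K)_{i_0\ldots i_m}=K_{i_{\sigma(0)}\ldots i_{\sigma(n)}}|_{U_{i_0\ldots i_m}}$. *Cochains.* A cochain $\varphi$ of total degree $m$ from a family $(E_i)$ to a family $(F_i)$ consists of morphisms $\varphi^{k,m-k}_{i_0\ldots i_k}:E_{i_k}\to F_{i_0}$ of degree $m-k$, one for each $k\ge0$ and each admissible multi-index. Put $$(\varphi\cdot\eta)_{i_0\ldots i_n}=\sum_{p+r=n}(-1)^{qr}\varphi^{p,q}_{i_0\ldots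 i_p}\circ\eta^{r,s}_{i_p\ldots i_n},\qquad (\delta\varphi)_{i_0\ldots i_k}=\sum_{j=1}^{k-1}(-1)^j\varphi_{i_0\ldots\widehat{i_j}\ldots i_k},$$ $$(D\varphi)_{i_0\ldots i_k}=(-1)^k d(\varphi_{i_0\ldots i_k})+(\delta\varphi)_{i_0\ldots i_k}.$$ *Twisted complexes.* An object of $\mathrm{Tw}(X,\mathcal R,\mathcal U)$ consists of graded sheaves $E_i^\bullet$ of $\mathcal R$-modules on the $U_i$ and a cochain $a=\sum_{k\ge0}a^{k,1-k}$ of total degree $1$, where all multi-indices are admissible and $a^{k,1-k}_{i_0\ldots i_k}:E_{i_k}\to E_{i_0}$ is defined over $U_{i_0\ldots i_k}$, such that $\delta a+a\cdot a=0$ and, for every $i$, the chain map $a^{1,0}_{ii}$ of $(E_i,a^{0,1}_i)$ is invertible up to homotopy. Morphisms of degree $m$ from $(E,a)$ to $(F,b)$ are all cochains of total degree $m$, composed by $\cdot$, with $d\varphi=\delta\varphi+b\cdot\varphi-(-1)^m\varphi\cdot a$. *Totalization.* For a dg-category $\mathcal B$, let $\Delta_n(\mathcal B)$ be the dg-category whose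 objects are families $E_0,\dots,E_n$ of objects of $\mathcal B$ with morphisms $\phi^{k,1-k}_{i_0\ldots i_k}\in\mathrm{Hom}^{1-k}(E_{i_k},E_{i_0})$ for $k\ge1$ and $0\le i_0\le\dots\le i_k\le n$, such that $D\phi+\phi\cdot\phi=0$ and all $\phi^{1,0}_{ij}$ (including $i=j$) are homotopy invertible; its morphisms of degree $m$ are all cochains $\theta$ of total degree $m$ indexed by the weakly increasing multi-indices (with $k\ge0$), with $d\theta=D\theta+\psi\cdot\theta-(-1)^m\theta\cdot\phi$. For a cosimplicial dg-category $\mathcal B^\bullet$, let $\mathrm{Tot}(\mathcal B^\bullet)$ be the equalizer of the two dg-functors $$\prod_{[n]}\Delta_n(\mathcal B^n)\rightrightarrows\prod_{\sigma:[n]\to[m]}\Delta_n(\mathcal B^m)$$ with components $\Delta_n(\sigma_*)$ and $\sigma^*$, where $\sigma^*$ relabels: $(\sigma^*E)_i=E_{\sigma(i)}$, $(\sigma^*\phi)_{i_0\ldots i_k}=\phi_{\sigma(i_0)\ldots\sigma(i_k)}$. Call an object of $\Delta_n(\mathcal B)$ normalized if $\phi^{1,0}_{ii}=\mathrm{id}$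 for all $i$ and $\phi^{k,1-k}_{i_0\ldots i_k}=0$ whenever $k\ge2$ and some index is repeated. Call a twisted complex normalized if $a^{1,0}_{ii}=\mathrm{id}$ for all $i$ and $a^{k,1-k}_{i_0\ldots i_k}=0$ whenever $k\ge2$ and $i_l=i_{l+1}$ for some $l$. **Proposition.** (1) There is an isomorphism of dg-categories (bijective on objects and on the morphisms of each degree) $$F:\mathrm{Tw}(X,\mathcal R,\mathcal U)\longrightarrow\mathrm{Tot}(Cpx(N_\bullet))$$ with the following components in $\Delta_n(Cpx(N_n))$, over each $U_{\alpha_0\ldots\alpha_n}$. The $i$-th object attached to $(E,a)$ is the restriction of the complex $(E_{\alpha_i},a^{0,1}_{\alpha_i})$; for $k\ge1$ the morphism $\phi^{k,1-k}_{i_0\ldots i_k}$ attached to $(E,a)$ is the restriction of $a^{k,1-k}_{\alpha_{i_0}\ldots\alpha_{i_k}}$; and for $k\ge0$ the component $\theta^{k,m-k}_{i_0\ldots i_k}$ attached to a morphism $\theta$ of degree $m$ is the restriction of $\theta^{k,m-k}_{\alpha_{i_0}\ldots\alpha_{i_k}}$. Moreover, a twisted complex is normalized if and only if all the components in $\Delta_n(Cpx(N_n))$,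 $n\ge0$, of its image under $F$ are normalized. (2) For all graded sheaves $E_i$ on the $U_i$ and every cochain $a$ of total degree $1$ as above with $\delta a+a\cdot a=0$, the following two non-degeneracy conditions are equivalent: $a^{1,0}_{ii}$ is invertible up to homotopy for every $i$; and $a^{1,0}_{ij}$ is invertible up to homotopy over $U_{ij}$ for all $i,j$. -/

import Mathlib

open CategoryTheory TopologicalSpace Opposite

universe u v w t


namespace TwTot

/-- A dg-category (over `ℤ`, cohomological grading).  `comp h f g` is the composite `f ∘ g`. The
degrees of composites and differentials are pinned by equations, so that no transport along
equalities of degrees is needed. -/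
structure DGCat : Type (max (u + 1) (v + 1)) where
  Ob : Type u
  Hom : Ob → Ob → ℤ → Type v
  [grp : ∀ X Y p, AddCommGroup (Hom X Y p)]
  one : ∀ X : Ob, Hom X X 0
  comp : ∀ {X Y Z : Ob} {p q r : ℤ}, p + q = r → Hom Y Z p → Hom X Y q → Hom X Z r
  d : ∀ {X Y : Ob} {p q : ℤ}, p + 1 = q → Hom X Y p → Hom X Y q
  add_comp : ∀ {X Y Z : Ob} {p q r : ℤ} (h : p + q = r) (f f' : Hom Y Z p) (g : Hom X Y q),
    comp h (f + f') g = comp h f g + comp h f' g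
  comp_add : ∀ {X Y Z : Ob} {p q r : ℤ} (h : p + q = r) (f : Hom Y Z p) (g g' : Hom X Y q),
    comp h f (g + g') = comp h f g + comp h f g'
  comp_assoc : ∀ {X Y Z W : Ob} {p q r pq qr pqr : ℤ} (h₁ : p + q = pq) (h₂ : q + r = qr)
    (h₃ : pq + r = pqr) (h₄ : p + qr = pqr) (f : Hom Z W p) (g : Hom Y Z q) (k : Hom X Y r),
    comp h₃ (comp h₁ f g) k = comp h₄ f (comp h₂ g k)
  one_comp : ∀ {X Y : Ob} {p : ℤ} (h : 0 + p = p) (f : Hom X Y p), comp h (one Y) f = f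
  comp_one : ∀ {X Y : Ob} {p : ℤ} (h : p + 0 = p) (f : Hom X Y p), comp h f (one X) = f
  d_add : ∀ {X Y : Ob} {p q : ℤ} (h : p + 1 = q) (f f' : Hom X Y p), d h (f + f') = d h f + d h f'
  d_d : ∀ {X Y : Ob} {p q r : ℤ} (h : p + 1 = q) (h' : q + 1 = r) (f : Hom X Y p),
    d h' (d h f) = 0
  d_comp : ∀ {X Y Z : Ob} {p q r p' q' r' : ℤ} (h : p + q = r) (hp : p + 1 = p') (hq : q + 1 = q')
    (hr : r + 1 = r') (h₁ : p' + q = r') (h₂ : p + q' = r') (f : Hom Y Z p) (g : Hom X Y q),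
    d hr (comp h f g) = comp h₁ (d hp f) g + p.negOnePow • comp h₂ f (d hq g)

attribute [instance] DGCat.grp

namespace DGCat

variable (A : DGCat.{u, v})

/-- Composition as a biadditive map. -/
def compHom {X Y Z : A.Ob} {p q r : ℤ} (h : p + q = r) :
    A.Hom Y Z p →+ A.Hom X Y q →+ A.Hom X Z r :=
  AddMonoidHom.mk' (fun f => AddMonoidHom.mk' (fun g => A.comp h f g) (A.comp_add h f))
    (fun f f' => by ext g; exact A.add_comp h f f' g)

/-- The differential as an additive map. -/
def dHom {X Y : A.Ob} {p q : ℤ} (h : p + 1 = q) : A.Hom X Y p →+ A.Hom X Y q :=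
  AddMonoidHom.mk' (fun f => A.d h f) (A.d_add h)

lemma comp_zero {X Y Z : A.Ob} {p q r : ℤ} (h : p + q = r) (f : A.Hom Y Z p) :
    A.comp h f (0 : A.Hom X Y q) = 0 := map_zero (A.compHom h f)

lemma zero_comp {X Y Z : A.Ob} {p q r : ℤ} (h : p + q = r) (g : A.Hom X Y q) :
    A.comp h (0 : A.Hom Y Z p) g = 0 := by
  have := DFunLike.congr_fun (map_zero (A.compHom (X := X) (Y := Y) (Z := Z) h)) g
  exact this

lemma comp_neg {X Y Z : A.Ob} {p q r : ℤ} (h : p + q = r) (f : A.Hom Y Z p) (g : A.Hom X Y q) :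
    A.comp h f (-g) = - A.comp h f g := map_neg (A.compHom h f) g

lemma neg_comp {X Y Z : A.Ob} {p q r : ℤ} (h : p + q = r) (f : A.Hom Y Z p) (g : A.Hom X Y q) :
    A.comp h (-f) g = - A.comp h f g := DFunLike.congr_fun (map_neg (A.compHom h) f) g

lemma comp_sub {X Y Z : A.Ob} {p q r : ℤ} (h : p + q = r) (f : A.Hom Y Z p)
    (g g' : A.Hom X Y q) : A.comp h f (g - g') = A.comp h f g - A.comp h f g' :=
  map_sub (A.compHom h f) g g'

lemma sub_comp {X Y Z : A.Ob} {p q r : ℤ} (h : p + q = r) (f f' : A.Hom Y Z p)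
    (g : A.Hom X Y q) : A.comp h (f - f') g = A.comp h f g - A.comp h f' g :=
  DFunLike.congr_fun (map_sub (A.compHom h) f f') g

lemma comp_smul {X Y Z : A.Ob} {p q r : ℤ} (h : p + q = r) (e : ℤˣ) (f : A.Hom Y Z p)
    (g : A.Hom X Y q) : A.comp h f (e • g) = e • A.comp h f g := by
  rw [Units.smul_def, Units.smul_def]
  exact map_zsmul (A.compHom h f) _ g

lemma smul_comp {X Y Z : A.Ob} {p q r : ℤ} (h : p + q = r) (e : ℤˣ) (f : A.Hom Y Z p)
    (g : A.Hom X Y q) : A.comp h (e • f) g = e • A.comp h f g := by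
  rw [Units.smul_def, Units.smul_def]
  exact DFunLike.congr_fun (map_zsmul (A.compHom h) _ f) g

lemma comp_sum {X Y Z : A.Ob} {p q r : ℤ} (h : p + q = r) {κ : Type*} (s : Finset κ)
    (f : A.Hom Y Z p) (g : κ → A.Hom X Y q) :
    A.comp h f (∑ i ∈ s, g i) = ∑ i ∈ s, A.comp h f (g i) :=
  map_sum (A.compHom h f) g s

lemma sum_comp {X Y Z : A.Ob} {p q r : ℤ} (h : p + q = r) {κ : Type*} (s : Finset κ)
    (f : κ → A.Hom Y Z p) (g : A.Hom X Y q) :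
    A.comp h (∑ i ∈ s, f i) g = ∑ i ∈ s, A.comp h (f i) g := by
  have := DFunLike.congr_fun (map_sum (A.compHom (X := X) (Y := Y) (Z := Z) h) f s) g
  rw [AddMonoidHom.finsetSum_apply] at this
  exact this

lemma d_zero {X Y : A.Ob} {p q : ℤ} (h : p + 1 = q) : A.d h (0 : A.Hom X Y p) = 0 :=
  map_zero (A.dHom h)

lemma d_sub {X Y : A.Ob} {p q : ℤ} (h : p + 1 = q) (f f' : A.Hom X Y p) :
    A.d h (f - f') = A.d h f - A.d h f' := map_sub (A.dHom h) f f'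

lemma d_smul {X Y : A.Ob} {p q : ℤ} (h : p + 1 = q) (e : ℤˣ) (f : A.Hom X Y p) :
    A.d h (e • f) = e • A.d h f := by
  rw [Units.smul_def, Units.smul_def]
  exact map_zsmul (A.dHom h) _ f

lemma d_sum {X Y : A.Ob} {p q : ℤ} (h : p + 1 = q) {κ : Type*} (s : Finset κ)
    (f : κ → A.Hom X Y p) : A.d h (∑ i ∈ s, f i) = ∑ i ∈ s, A.d h (f i) :=
  map_sum (A.dHom h) f s

/-- The identity of `X`, in a degree `p` that is known to be `0`. -/
def unit (X : A.Ob) {p : ℤ} (h : p = 0) : A.Hom X X p := h ▸ A.one X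

/-- Transport of morphisms along equalities of objects. -/
def castHom {X X' Y Y' : A.Ob} {p : ℤ} (hX : X = X') (hY : Y = Y') (f : A.Hom X Y p) :
    A.Hom X' Y' p := hX ▸ hY ▸ f

/-- A degree `0` morphism is homotopy invertible if it is closed and becomes invertible in the
homotopy category `H⁰(A)`. -/
def IsHtpyInvertible {X Y : A.Ob} {p : ℤ} (hp : p = 0) (f : A.Hom X Y p) : Prop :=
  A.d (q := 1) (by omega) f = 0 ∧
  ∃ g : A.Hom Y X 0, A.d (q := 1) (by omega) g = 0 ∧
    (∃ h : A.Hom Y Y (-1), A.comp (r := 0) (by omega) f g - A.one Y = A.d (by omega) h) ∧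
    (∃ h : A.Hom X X (-1), A.comp (r := 0) (by omega) g f - A.one X = A.d (by omega) h)

end DGCat

/-- A dg-functor. -/
structure DGFunctor (A : DGCat.{u, v}) (B : DGCat.{w, t}) where
  obj : A.Ob → B.Ob
  map : ∀ {X Y : A.Ob} {p : ℤ}, A.Hom X Y p → B.Hom (obj X) (obj Y) p
  map_add : ∀ {X Y : A.Ob} {p : ℤ} (f g : A.Hom X Y p), map (f + g) = map f + map g
  map_one : ∀ X : A.Ob, map (A.one X) = B.one (obj X)
  map_comp : ∀ {X Y Z : A.Ob} {p q r : ℤ} (h : p + q = r) (f : A.Hom Y Z p) (g : A.Hom X Y q),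
    map (A.comp h f g) = B.comp h (map f) (map g)
  map_d : ∀ {X Y : A.Ob} {p q : ℤ} (h : p + 1 = q) (f : A.Hom X Y p),
    map (A.d h f) = B.d h (map f)

namespace DGFunctor

/-- A dg-functor is an isomorphism of dg-categories if it is bijective on objects and on all
graded pieces of the morphism complexes. -/
def IsIso {A : DGCat.{u, v}} {B : DGCat.{w, t}} (F : DGFunctor A B) : Prop :=
  Function.Bijective F.obj ∧
    ∀ (X Y : A.Ob) (p : ℤ), Function.Bijective (fun f : A.Hom X Y p => F.map f)

lemma map_zero {A : DGCat.{u, v}} {B : DGCat.{w, t}} (F : DGFunctor A B) {X Y : A.Ob} {p : ℤ} :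
    F.map (0 : A.Hom X Y p) = 0 :=
  _root_.map_zero (AddMonoidHom.mk' (fun f : A.Hom X Y p => F.map f) F.map_add)

lemma map_sub {A : DGCat.{u, v}} {B : DGCat.{w, t}} (F : DGFunctor A B) {X Y : A.Ob} {p : ℤ}
    (f g : A.Hom X Y p) : F.map (f - g) = F.map f - F.map g :=
  _root_.map_sub (AddMonoidHom.mk' (fun f : A.Hom X Y p => F.map f) F.map_add) f g

lemma map_neg {A : DGCat.{u, v}} {B : DGCat.{w, t}} (F : DGFunctor A B) {X Y : A.Ob} {p : ℤ}
    (f : A.Hom X Y p) : F.map (-f) = - F.map f :=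
  _root_.map_neg (AddMonoidHom.mk' (fun f : A.Hom X Y p => F.map f) F.map_add) f

lemma map_smul {A : DGCat.{u, v}} {B : DGCat.{w, t}} (F : DGFunctor A B) {X Y : A.Ob} {p : ℤ}
    (e : ℤˣ) (f : A.Hom X Y p) : F.map (e • f) = e • F.map f := by
  rw [Units.smul_def, Units.smul_def]
  exact map_zsmul (AddMonoidHom.mk' (fun f : A.Hom X Y p => F.map f) F.map_add) _ f

lemma map_sum {A : DGCat.{u, v}} {B : DGCat.{w, t}} (F : DGFunctor A B) {X Y : A.Ob} {p : ℤ}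
    {κ : Type*} (s : Finset κ) (f : κ → A.Hom X Y p) :
    F.map (∑ i ∈ s, f i) = ∑ i ∈ s, F.map (f i) :=
  _root_.map_sum (AddMonoidHom.mk' (fun f : A.Hom X Y p => F.map f) F.map_add) f s

lemma map_unit {A : DGCat.{u, v}} {B : DGCat.{w, t}} (F : DGFunctor A B) (X : A.Ob) {p : ℤ}
    (h : p = 0) : F.map (A.unit X h) = B.unit (F.obj X) h := by
  subst h; exact F.map_one X

lemma map_isHtpyInvertible {A : DGCat.{u, v}} {B : DGCat.{w, t}} (F : DGFunctor A B)
    {X Y : A.Ob} {p : ℤ} (hp : p = 0) (f : A.Hom X Y p) (hf : A.IsHtpyInvertible hp f) :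
    B.IsHtpyInvertible hp (F.map f) := by
  obtain ⟨h0, g, hg, ⟨a, ha⟩, ⟨b, hb⟩⟩ := hf
  refine ⟨by rw [← F.map_d, h0, F.map_zero], F.map g, by rw [← F.map_d, hg, F.map_zero],
    ⟨F.map a, ?_⟩, ⟨F.map b, ?_⟩⟩
  · rw [← F.map_d, ← ha, F.map_sub, F.map_comp, F.map_one]
  · rw [← F.map_d, ← hb, F.map_sub, F.map_comp, F.map_one]

lemma ext {A : DGCat.{u, v}} {B : DGCat.{w, t}} {F G : DGFunctor A B} (h : F.obj = G.obj)
    (h' : ∀ (X Y : A.Ob) (p : ℤ) (f : A.Hom X Y p),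
      B.castHom (congrFun h X) (congrFun h Y) (F.map f) = G.map f) : F = G := by
  obtain ⟨o, m, _, _, _, _⟩ := F
  obtain ⟨o', m', _, _, _, _⟩ := G
  change o = o' at h
  subst h
  obtain rfl : @m = @m' := by
    funext X Y p f
    exact h' X Y p f
  rfl

/-- The identity dg-functor. -/
def id (A : DGCat.{u, v}) : DGFunctor A A where
  obj X := X
  map f := f
  map_add _ _ := rfl
  map_one _ := rfl
  map_comp _ _ _ := rfl
  map_d _ _ := rfl

/-- The composite `G ∘ F` of dg-functors. -/
def comp {A B C : DGCat} (F : DGFunctor A B) (G : DGFunctor B C) : DGFunctor A C where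
  obj X := G.obj (F.obj X)
  map f := G.map (F.map f)
  map_add f g := by rw [F.map_add, G.map_add]
  map_one X := by rw [F.map_one, G.map_one]
  map_comp h f g := by rw [F.map_comp, G.map_comp]
  map_d h f := by rw [F.map_d, G.map_d]

end DGFunctor

/-- The category of dg-categories and dg-functors. -/
instance : Category DGCat.{u, v} where
  Hom A B := DGFunctor A B
  id A := DGFunctor.id A
  comp F G := DGFunctor.comp F G

namespace DGCat

/-- The product of a family of dg-categories. -/
def pi {κ : Type t} (A : κ → DGCat.{u, v}) : DGCat.{max t u, max t v} where
  Ob := ∀ i, (A i).Ob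
  Hom X Y p := ∀ i, (A i).Hom (X i) (Y i) p
  one X i := (A i).one (X i)
  comp h f g i := (A i).comp h (f i) (g i)
  d h f i := (A i).d h (f i)
  add_comp h f f' g := funext fun i => (A i).add_comp h _ _ _
  comp_add h f f' g := funext fun i => (A i).comp_add h _ _ _
  comp_assoc h₁ h₂ h₃ h₄ f g k := funext fun i => (A i).comp_assoc h₁ h₂ h₃ h₄ _ _ _
  one_comp h f := funext fun i => (A i).one_comp h _
  comp_one h f := funext fun i => (A i).comp_one h _
  d_add h f g := funext fun i => (A i).d_add h _ _
  d_d h h' f := funext fun i => (A i).d_d h h' _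
  d_comp h hp hq hr h₁ h₂ f g := funext fun i => (A i).d_comp h hp hq hr h₁ h₂ _ _

/-- The dg-functor between products that is given by a map of the index sets and dg-functors
between the factors. -/
def piMap {κ : Type w} {κ' : Type t} {A : κ → DGCat.{u, v}} {B : κ' → DGCat.{u, v}} (g : κ' → κ)
    (F : ∀ j, DGFunctor (A (g j)) (B j)) : DGFunctor (pi A) (pi B) where
  obj X j := (F j).obj (X (g j))
  map f j := (F j).map (f (g j))
  map_add f f' := funext fun j => (F j).map_add _ _
  map_one X := funext fun j => (F j).map_one _
  map_comp h f f' := funext fun j => (F j).map_comp h _ _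
  map_d h f := funext fun j => (F j).map_d h _

lemma piMap_comp {κ : Type w} {κ' : Type t} {κ'' : Type*} {A : κ → DGCat.{u, v}}
    {B : κ' → DGCat.{u, v}} {C : κ'' → DGCat.{u, v}} (g : κ' → κ) (g' : κ'' → κ')
    (F : ∀ j, DGFunctor (A (g j)) (B j)) (F' : ∀ k, DGFunctor (B (g' k)) (C k)) :
    (piMap g F).comp (piMap g' F') =
      piMap (A := A) (B := C) (g ∘ g') (fun k => (F (g' k)).comp (F' k)) :=
  DGFunctor.ext rfl fun _ _ _ _ => rfl

section castHom

variable (A : DGCat.{u, v})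

lemma castHom_add {X X' Y Y' : A.Ob} {p : ℤ} (hX : X = X') (hY : Y = Y') (f g : A.Hom X Y p) :
    A.castHom hX hY (f + g) = A.castHom hX hY f + A.castHom hX hY g := by
  subst hX hY; rfl

lemma castHom_zero {X X' Y Y' : A.Ob} {p : ℤ} (hX : X = X') (hY : Y = Y') :
    A.castHom hX hY (0 : A.Hom X Y p) = 0 := by
  subst hX hY; rfl

lemma castHom_neg {X X' Y Y' : A.Ob} {p : ℤ} (hX : X = X') (hY : Y = Y') (f : A.Hom X Y p) :
    A.castHom hX hY (-f) = - A.castHom hX hY f := by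
  subst hX hY; rfl

lemma castHom_one {X X' : A.Ob} (hX : X = X') : A.castHom hX hX (A.one X) = A.one X' := by
  subst hX; rfl

lemma castHom_comp {X X' Y Y' Z Z' : A.Ob} {p q r : ℤ} (hX : X = X') (hY : Y = Y')
    (hZ : Z = Z') (h : p + q = r) (f : A.Hom Y Z p) (g : A.Hom X Y q) :
    A.castHom hX hZ (A.comp h f g) = A.comp h (A.castHom hY hZ f) (A.castHom hX hY g) := by
  subst hX hY hZ; rfl

lemma castHom_d {X X' Y Y' : A.Ob} {p q : ℤ} (hX : X = X') (hY : Y = Y') (h : p + 1 = q)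
    (f : A.Hom X Y p) : A.castHom hX hY (A.d h f) = A.d h (A.castHom hX hY f) := by
  subst hX hY; rfl

end castHom

/-- The morphisms of degree `p` on which two dg-functors agree, between objects on which they
agree. -/
def eqHom {A : DGCat.{u, v}} {B : DGCat.{w, t}} (F G : DGFunctor A B)
    (X Y : {X : A.Ob // F.obj X = G.obj X}) (p : ℤ) : AddSubgroup (A.Hom X.1 Y.1 p) where
  carrier := {f | B.castHom X.2 Y.2 (F.map f) = G.map f}
  add_mem' {f g} hf hg := by
    simp only [Set.mem_ofPred_eq] at hf hg ⊢
    rw [F.map_add, castHom_add, hf, hg, G.map_add]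
  zero_mem' := by
    simp only [Set.mem_ofPred_eq]
    rw [F.map_zero, castHom_zero, G.map_zero]
  neg_mem' {f} hf := by
    simp only [Set.mem_ofPred_eq] at hf ⊢
    rw [F.map_neg, castHom_neg, hf, G.map_neg]

/-- The equalizer of two dg-functors: the sub-dg-category of `A` of the objects and the morphisms
on which `F` and `G` agree. -/
def equalizer {A : DGCat.{u, v}} {B : DGCat.{w, t}} (F G : DGFunctor A B) : DGCat.{u, v} where
  Ob := {X : A.Ob // F.obj X = G.obj X}
  Hom X Y p := eqHom F G X Y p
  one X := ⟨A.one X.1, show B.castHom X.2 X.2 (F.map (A.one X.1)) = G.map (A.one X.1) by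
    rw [F.map_one, castHom_one, G.map_one]⟩
  comp {X Y Z _ _ _} h f g := ⟨A.comp h f.1 g.1,
    show B.castHom X.2 Z.2 (F.map (A.comp h f.1 g.1)) = G.map (A.comp h f.1 g.1) by
      have hf : B.castHom Y.2 Z.2 (F.map f.1) = G.map f.1 := f.2
      have hg : B.castHom X.2 Y.2 (F.map g.1) = G.map g.1 := g.2
      rw [F.map_comp, castHom_comp B X.2 Y.2 Z.2, G.map_comp, hf, hg]⟩
  d {X Y _ _} h f := ⟨A.d h f.1,
    show B.castHom X.2 Y.2 (F.map (A.d h f.1)) = G.map (A.d h f.1) by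
      have hf : B.castHom X.2 Y.2 (F.map f.1) = G.map f.1 := f.2
      rw [F.map_d, castHom_d, G.map_d, hf]⟩
  add_comp h f f' g := Subtype.ext (A.add_comp h _ _ _)
  comp_add h f f' g := Subtype.ext (A.comp_add h _ _ _)
  comp_assoc h₁ h₂ h₃ h₄ f g k := Subtype.ext (A.comp_assoc h₁ h₂ h₃ h₄ _ _ _)
  one_comp h f := Subtype.ext (A.one_comp h _)
  comp_one h f := Subtype.ext (A.comp_one h _)
  d_add h f g := Subtype.ext (A.d_add h _ _)
  d_d h h' f := Subtype.ext (A.d_d h h' _)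
  d_comp h hp hq hr h₁ h₂ f g := Subtype.ext (A.d_comp h hp hq hr h₁ h₂ _ _)

/-- The twist of a dg-category by Maurer-Cartan elements: each new object `x` is an object of `A`
with an element `α` of degree `1` such that `d α + α ∘ α = 0`; the morphisms and their composition
are those of `A`, and the differential of `f : x → y` of degree `p` is
`d f + α_y ∘ f - (-1) ^ p f ∘ α_x`. -/
def twist (A : DGCat.{u, v}) {Ob' : Type w} (ob : Ob' → A.Ob) (α : ∀ x, A.Hom (ob x) (ob x) 1)
    (mc : ∀ x, A.d (q := 2) (by omega) (α x) + A.comp (by omega) (α x) (α x) = 0) :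
    DGCat.{w, v} where
  Ob := Ob'
  Hom x y p := A.Hom (ob x) (ob y) p
  one x := A.one (ob x)
  comp h f g := A.comp h f g
  d {x y p q} h f := A.d h f + A.comp (by omega) (α y) f - p.negOnePow • A.comp h f (α x)
  add_comp h f f' g := A.add_comp h f f' g
  comp_add h f f' g := A.comp_add h f f' g
  comp_assoc h₁ h₂ h₃ h₄ f g k := A.comp_assoc h₁ h₂ h₃ h₄ _ _ _
  one_comp h f := A.one_comp h _
  comp_one h f := A.comp_one h _
  d_add h f g := by
    rw [A.d_add, A.comp_add, A.add_comp, smul_add]; abel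
  d_d {x y p q r} h h' f := by
    have hx := A.comp_zero (X := ob x) (q := 2) (r := r) (by omega) f
    rw [← mc x, A.comp_add, ← A.comp_assoc (pq := q) (by omega) _ (by omega)] at hx
    have hy := A.zero_comp (p := 2) (r := r) (Z := ob y) (by omega) f
    rw [← mc y, A.add_comp, A.comp_assoc (qr := q) _ (by omega) _ (by omega)] at hy
    subst h
    rw [A.d_sub, A.d_add, A.d_d, A.d_smul,
      A.d_comp (p' := 2) (q' := p + 1) _ (by omega) (by omega) _ (by omega) (by omega),
      A.d_comp (p' := p + 1) (q' := 2) _ (by omega) (by omega) _ (by omega) (by omega),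
      A.comp_sub, A.comp_add, A.sub_comp, A.add_comp, A.comp_smul, A.smul_comp,
      A.comp_assoc (p := 1) (r := 1) (qr := p + 1) _ (by omega) _ (by omega)]
    rw [Int.negOnePow_succ, Int.negOnePow_one]
    rcases Int.even_or_odd p with hp | hp
    · simp only [Int.negOnePow_even p hp, one_smul, Units.neg_smul]
      refine Eq.trans ?_ ((congrArg₂ (· - ·) hy hx).trans (sub_zero 0))
      abel
    · simp only [Int.negOnePow_odd p hp, one_smul, Units.neg_smul, neg_neg]
      refine Eq.trans ?_ ((congrArg₂ (· - ·) hy hx).trans (sub_zero 0))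
      abel
  d_comp {x y z p q r p' q' r'} h hp hq hr h₁ h₂ f g := by
    subst hp hq hr h
    rw [A.d_comp (p' := p + 1) (q' := q + 1) _ (by omega) (by omega) _ (by omega) (by omega),
      A.sub_comp, A.add_comp, A.smul_comp, A.comp_sub, A.comp_add, A.comp_smul,
      A.comp_assoc (q := p) (qr := p + q) _ (by omega) _ (by omega),
      A.comp_assoc (q := 1) (qr := q + 1) _ (by omega) _ (by omega),
      A.comp_assoc (r := 1) (qr := q + 1) _ (by omega) _ (by omega),
      Int.negOnePow_add, mul_smul, smul_sub, smul_add]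
    abel

end DGCat

/-- A multi-index `(i_0, …, i_k)` with `i_0 = a` and `i_k = b`, all of whose entries satisfy
`rel i_l i_m` for `l ≤ m`. -/
@[ext]
structure Simplex {V : Type t} (rel : V → V → Prop) (k : ℕ) (a b : V) where
  v : Fin (k + 1) → V
  adm : ∀ l m, l ≤ m → rel (v l) (v m)
  first : v 0 = a
  last : v (Fin.last k) = b

namespace Simplex

variable {V : Type t} {rel : V → V → Prop} {k p r : ℕ} {a b : V}

/-- `(i_0, …, i_p)` for a multi-index `(i_0, …, i_{p + r})`. -/
def front (s : Simplex rel k a b) (h : p + r = k) :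
    Simplex rel p a (s.v ⟨p, by omega⟩) where
  v x := s.v ⟨x.1, by omega⟩
  adm l m hlm := s.adm _ _ hlm
  first := s.first
  last := rfl

/-- `(i_p, …, i_{p + r})` for a multi-index `(i_0, …, i_{p + r})`. -/
def back (s : Simplex rel k a b) (h : p + r = k) :
    Simplex rel r (s.v ⟨p, by omega⟩) b where
  v x := s.v ⟨p + x.1, by omega⟩
  adm l m hlm := s.adm _ _ (by simpa using hlm)
  first := rfl
  last := Eq.trans (congrArg s.v (Fin.ext (by simp [h]))) s.last

/-- `(i_0, …, i_{k + 1})` with the inner entry `i_{j + 1}` left out (`0 ≤ j < k`). -/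
def skip (s : Simplex rel (k + 1) a b) (j : Fin k) : Simplex rel k a b where
  v x := s.v ⟨if x.1 ≤ j.1 then x.1 else x.1 + 1, by split_ifs <;> omega⟩
  adm l m hlm := s.adm _ _ (by
    have : l.1 ≤ m.1 := hlm
    simp only [Fin.mk_le_mk]; split_ifs <;> omega)
  first := Eq.trans (congrArg s.v (Fin.ext (by simp))) s.first
  last := Eq.trans (congrArg s.v (Fin.ext (by
    have := j.2
    simp only [Fin.val_last]
    split_ifs <;> omega))) s.last

/-- The one-entry multi-index `(a)`. -/
def vertex (rel : V → V → Prop) (a : V) (h : rel a a) : Simplex rel 0 a a where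
  v _ := a
  adm _ _ _ := h
  first := rfl
  last := rfl

lemma first_eq_last (s : Simplex rel k a b) (hk : k = 0) : a = b := by
  subst hk
  exact s.first.symm.trans s.last

end Simplex

/-- The sum of `f p r` over all `p + r = n`. -/
def asum {G : Type*} [AddCommMonoid G] (n : ℕ) (f : ∀ p r : ℕ, p + r = n → G) : G :=
  ∑ x ∈ (Finset.HasAntidiagonal.antidiagonal n).attach, f x.1.1 x.1.2 (Finset.HasAntidiagonal.mem_antidiagonal.1 x.2)

section asum

variable {G : Type*} [AddCommMonoid G]

lemma asum_eq (n : ℕ) (f : ∀ p r : ℕ, p + r = n → G) :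
    asum n f = ∑ x ∈ Finset.HasAntidiagonal.antidiagonal n, if h : x.1 + x.2 = n then f x.1 x.2 h else 0 := by
  rw [← Finset.sum_attach]
  exact Finset.sum_congr rfl fun x _ => (dif_pos (Finset.HasAntidiagonal.mem_antidiagonal.1 x.2)).symm

lemma asum_congr {n : ℕ} {f g : ∀ p r : ℕ, p + r = n → G} (h : ∀ p r e, f p r e = g p r e) :
    asum n f = asum n g :=
  Finset.sum_congr rfl fun x _ => h _ _ _

lemma asum_add (n : ℕ) (f g : ∀ p r : ℕ, p + r = n → G) :
    asum n (fun p r e => f p r e + g p r e) = asum n f + asum n g :=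
  Finset.sum_add_distrib

lemma asum_succ (n : ℕ) (f : ∀ p r : ℕ, p + r = n + 1 → G) :
    asum (n + 1) f = f 0 (n + 1) (by omega) + asum n (fun p r e => f (p + 1) r (by omega)) := by
  rw [asum_eq, asum_eq, Finset.Nat.sum_antidiagonal_succ]
  congr 1
  · simp
  · refine Finset.sum_congr rfl fun x hx => ?_
    have hx := Finset.HasAntidiagonal.mem_antidiagonal.1 hx
    rw [dif_pos hx, dif_pos]

lemma asum_succ' (n : ℕ) (f : ∀ p r : ℕ, p + r = n + 1 → G) :
    asum (n + 1) f = f (n + 1) 0 (by omega) + asum n (fun p r e => f p (r + 1) (by omega)) := by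
  rw [asum_eq, asum_eq, Finset.Nat.sum_antidiagonal_succ']
  congr 1
  · simp
  · refine Finset.sum_congr rfl fun x hx => ?_
    have hx := Finset.HasAntidiagonal.mem_antidiagonal.1 hx
    rw [dif_pos hx, dif_pos]

lemma asum_zero (f : ∀ p r : ℕ, p + r = 0 → G) : asum 0 f = f 0 0 rfl := by
  rw [asum_eq]; simp

lemma asum_first (n : ℕ) (f : ∀ p r : ℕ, p + r = n → G) (hf : ∀ p r e, p ≠ 0 → f p r e = 0) :
    asum n f = f 0 n (by omega) := by
  rcases n with _ | n
  · exact asum_zero f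
  · rw [asum_succ, asum_congr (fun p r e => hf (p + 1) r _ (by omega))]
    simp [asum]

lemma asum_last (n : ℕ) (f : ∀ p r : ℕ, p + r = n → G) (hf : ∀ p r e, r ≠ 0 → f p r e = 0) :
    asum n f = f n 0 (by omega) := by
  rcases n with _ | n
  · exact asum_zero f
  · rw [asum_succ', asum_congr (fun p r e => hf p (r + 1) _ (by omega))]
    simp [asum]

lemma asum_assoc (n : ℕ) (g : ∀ p q r : ℕ, p + q + r = n → G) :
    asum n (fun x r h => asum x (fun p q h' => g p q r (by omega))) =
      asum n (fun p y h => asum y (fun q r h' => g p q r (by omega))) := by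
  unfold asum
  rw [Finset.sum_sigma', Finset.sum_sigma']
  refine Finset.sum_bij'
    (fun x _ => ⟨⟨(x.2.1.1, x.2.1.2 + x.1.1.2), ?_⟩, ⟨(x.2.1.2, x.1.1.2), ?_⟩⟩)
    (fun x _ => ⟨⟨(x.1.1.1 + x.2.1.1, x.2.1.2), ?_⟩, ⟨(x.1.1.1, x.2.1.1), ?_⟩⟩)
    ?_ ?_ ?_ ?_ ?_
  · have h1 := Finset.HasAntidiagonal.mem_antidiagonal.1 x.1.2
    have h2 := Finset.HasAntidiagonal.mem_antidiagonal.1 x.2.2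
    simp only [Finset.HasAntidiagonal.mem_antidiagonal]; omega
  · simp only [Finset.HasAntidiagonal.mem_antidiagonal]
  · have h1 := Finset.HasAntidiagonal.mem_antidiagonal.1 x.1.2
    have h2 := Finset.HasAntidiagonal.mem_antidiagonal.1 x.2.2
    simp only [Finset.HasAntidiagonal.mem_antidiagonal]; omega
  · simp only [Finset.HasAntidiagonal.mem_antidiagonal]
  · intros; simp
  · intros; simp
  · rintro ⟨⟨⟨x1, x2⟩, hx⟩, ⟨⟨y1, y2⟩, hy⟩⟩ -
    have hy' := Finset.HasAntidiagonal.mem_antidiagonal.1 hy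
    simp only at hy'
    subst hy'
    rfl
  · rintro ⟨⟨⟨x1, x2⟩, hx⟩, ⟨⟨y1, y2⟩, hy⟩⟩ -
    have hy' := Finset.HasAntidiagonal.mem_antidiagonal.1 hy
    simp only at hy'
    subst hy'
    rfl
  · intros; rfl

lemma map_asum {G H : Type*} [AddCommMonoid G] [AddCommMonoid H] (φ : G →+ H) (n : ℕ)
    (f : ∀ p r : ℕ, p + r = n → G) : φ (asum n f) = asum n (fun p r e => φ (f p r e)) :=
  map_sum φ _ _

lemma asum_sum_comm {κ : Type*} (t : Finset κ) (n : ℕ) (f : κ → ∀ p r : ℕ, p + r = n → G) :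
    ∑ j ∈ t, asum n (f j) = asum n (fun p r e => ∑ j ∈ t, f j p r e) :=
  Finset.sum_comm

end asum

namespace DGCat

lemma comp_asum (A : DGCat.{u, v}) {X Y Z : A.Ob} {p q r : ℤ} (h : p + q = r) (n : ℕ)
    (f : A.Hom Y Z p) (g : ∀ a b : ℕ, a + b = n → A.Hom X Y q) :
    A.comp h f (asum n g) = asum n fun a b e => A.comp h f (g a b e) := A.comp_sum h _ f _

lemma asum_comp (A : DGCat.{u, v}) {X Y Z : A.Ob} {p q r : ℤ} (h : p + q = r) (n : ℕ)
    (f : ∀ a b : ℕ, a + b = n → A.Hom Y Z p) (g : A.Hom X Y q) :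
    A.comp h (asum n f) g = asum n fun a b e => A.comp h (f a b e) g := A.sum_comp h _ _ g

lemma d_asum (A : DGCat.{u, v}) {X Y : A.Ob} {p q : ℤ} (h : p + 1 = q) (n : ℕ)
    (f : ∀ a b : ℕ, a + b = n → A.Hom X Y p) :
    A.d h (asum n f) = asum n fun a b e => A.d h (f a b e) := A.d_sum h _ _

end DGCat

lemma smul_asum {G : Type*} [AddCommGroup G] (e : ℤˣ) (n : ℕ) (f : ∀ p r : ℕ, p + r = n → G) :
    e • asum n f = asum n fun p r h => e • f p r h := Finset.smul_sum

/-- A system of dg-categories `cat W` indexed by an ordered set `L` of regions, with the objects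
`Ob a` over the region `dom a` for each vertex `a`, the intersections `inter` of finitely many of
these regions, and strictly functorial restriction of
objects and morphisms to smaller regions. -/
structure CoeffSystem (V : Type t) (L : Type w) [Preorder L] where
  dom : V → L
  inter : ∀ {k : ℕ}, (Fin (k + 1) → V) → L
  inter_le : ∀ {k : ℕ} (α : Fin (k + 1) → V) (x : Fin (k + 1)), inter α ≤ dom (α x)
  le_inter : ∀ {k : ℕ} (α : Fin (k + 1) → V) {W : L}, (∀ x, W ≤ dom (α x)) → W ≤ inter α
  cat : L → DGCat.{u, v}
  Ob : V → Type u
  obj : ∀ {a : V} {W : L}, W ≤ dom a → Ob a → (cat W).Ob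
  res : ∀ {a b : V} {W W' : L} (hW : W' ≤ W) {ha : W ≤ dom a} {hb : W ≤ dom b} {E : Ob a}
    {F : Ob b} {q : ℤ}, (cat W).Hom (obj ha E) (obj hb F) q →
    (cat W').Hom (obj (hW.trans ha) E) (obj (hW.trans hb) F) q
  res_add : ∀ {a b : V} {W W' : L} (hW : W' ≤ W) {ha : W ≤ dom a} {hb : W ≤ dom b} {E : Ob a}
    {F : Ob b} {q : ℤ} (f g : (cat W).Hom (obj ha E) (obj hb F) q),
    res hW (f + g) = res hW f + res hW g
  res_one : ∀ {a : V} {W W' : L} (hW : W' ≤ W) (ha : W ≤ dom a) (E : Ob a),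
    res hW ((cat W).one (obj ha E)) = (cat W').one (obj (hW.trans ha) E)
  res_comp : ∀ {a b c : V} {W W' : L} (hW : W' ≤ W) {ha : W ≤ dom a} {hb : W ≤ dom b}
    {hc : W ≤ dom c} {E : Ob a} {F : Ob b} {G : Ob c} {p q r : ℤ} (h : p + q = r)
    (f : (cat W).Hom (obj hb F) (obj hc G) p) (g : (cat W).Hom (obj ha E) (obj hb F) q),
    res hW ((cat W).comp h f g) = (cat W').comp h (res hW f) (res hW g)
  res_d : ∀ {a b : V} {W W' : L} (hW : W' ≤ W) {ha : W ≤ dom a} {hb : W ≤ dom b} {E : Ob a}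
    {F : Ob b} {p q : ℤ} (h : p + 1 = q) (f : (cat W).Hom (obj ha E) (obj hb F) p),
    res hW ((cat W).d h f) = (cat W').d h (res hW f)
  res_refl : ∀ {a b : V} {W : L} {ha : W ≤ dom a} {hb : W ≤ dom b} {E : Ob a}
    {F : Ob b} {q : ℤ} (f : (cat W).Hom (obj ha E) (obj hb F) q), res le_rfl f = f
  res_res : ∀ {a b : V} {W W' W'' : L} (hW : W' ≤ W) (hW' : W'' ≤ W') {ha : W ≤ dom a}
    {hb : W ≤ dom b} {E : Ob a} {F : Ob b} {q : ℤ} (f : (cat W).Hom (obj ha E) (obj hb F) q),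
    res hW' (res hW f) = res (hW'.trans hW) f

namespace CoeffSystem

variable {V : Type t} {L : Type w} [Preorder L] (S : CoeffSystem.{u, v} V L)
  {rel : V → V → Prop}

/-- The intersection of the regions of the entries of a multi-index. -/
def region {k : ℕ} {a b : V} (s : Simplex rel k a b) : L := S.inter s.v

lemma region_first {k : ℕ} {a b : V} (s : Simplex rel k a b) : S.region s ≤ S.dom a :=
  (S.inter_le s.v 0).trans (le_of_eq (congrArg S.dom s.first))

lemma region_last {k : ℕ} {a b : V} (s : Simplex rel k a b) : S.region s ≤ S.dom b :=
  (S.inter_le s.v (Fin.last k)).trans (le_of_eq (congrArg S.dom s.last))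

lemma region_front {k p r : ℕ} {a b : V} (s : Simplex rel k a b) (h : p + r = k) :
    S.region s ≤ S.region (s.front h) := S.le_inter _ fun x => S.inter_le s.v _

lemma region_back {k p r : ℕ} {a b : V} (s : Simplex rel k a b) (h : p + r = k) :
    S.region s ≤ S.region (s.back h) := S.le_inter _ fun x => S.inter_le s.v _

lemma region_skip {k : ℕ} {a b : V} (s : Simplex rel (k + 1) a b) (j : Fin k) :
    S.region s ≤ S.region (s.skip j) := S.le_inter _ fun x => S.inter_le s.v _

lemma le_region_vertex {a : V} (h : rel a a) :
    S.dom a ≤ S.region (Simplex.vertex rel a h) := S.le_inter _ fun _ => le_rfl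

/-- Restriction as an additive map. -/
def resHom {a b : V} {W W' : L} (hW : W' ≤ W) (ha : W ≤ S.dom a) (hb : W ≤ S.dom b) (E : S.Ob a)
    (F : S.Ob b) (q : ℤ) : (S.cat W).Hom (S.obj ha E) (S.obj hb F) q →+
    (S.cat W').Hom (S.obj (hW.trans ha) E) (S.obj (hW.trans hb) F) q :=
  AddMonoidHom.mk' (S.res hW) (S.res_add hW)

lemma res_zero {a b : V} {W W' : L} (hW : W' ≤ W) {ha : W ≤ S.dom a} {hb : W ≤ S.dom b}
    {E : S.Ob a} {F : S.Ob b} {q : ℤ} :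
    S.res hW (0 : (S.cat W).Hom (S.obj ha E) (S.obj hb F) q) = 0 :=
  map_zero (S.resHom hW ha hb E F q)

lemma res_smul {a b : V} {W W' : L} (hW : W' ≤ W) {ha : W ≤ S.dom a} {hb : W ≤ S.dom b}
    {E : S.Ob a} {F : S.Ob b} {q : ℤ} (e : ℤˣ) (f : (S.cat W).Hom (S.obj ha E) (S.obj hb F) q) :
    S.res hW (e • f) = e • S.res hW f := by
  rw [Units.smul_def, Units.smul_def]
  exact map_zsmul (S.resHom hW ha hb E F q) _ f

lemma res_sum {a b : V} {W W' : L} (hW : W' ≤ W) {ha : W ≤ S.dom a} {hb : W ≤ S.dom b}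
    {E : S.Ob a} {F : S.Ob b} {q : ℤ} {κ : Type*} (t : Finset κ)
    (f : κ → (S.cat W).Hom (S.obj ha E) (S.obj hb F) q) :
    S.res hW (∑ i ∈ t, f i) = ∑ i ∈ t, S.res hW (f i) :=
  map_sum (S.resHom hW ha hb E F q) f t

lemma res_asum {a b : V} {W W' : L} (hW : W' ≤ W) {ha : W ≤ S.dom a} {hb : W ≤ S.dom b}
    {E : S.Ob a} {F : S.Ob b} {q : ℤ} (n : ℕ)
    (f : ∀ p r, p + r = n → (S.cat W).Hom (S.obj ha E) (S.obj hb F) q) :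
    S.res hW (asum n f) = asum n fun p r e => S.res hW (f p r e) :=
  map_asum (S.resHom hW ha hb E F q) n f

/-- The cochains of total degree `m` from `E` to `F`: for all `k + q = m` and all multi-indices
`s = (i_0, …, i_k)`, a morphism of degree `q` from `E_{i_k}` to `F_{i_0}` over the intersection of
the regions of `i_0, …, i_k`. -/
def Cochain (rel : V → V → Prop) (E F : ∀ a, S.Ob a) (m : ℤ) : Type (max t v) :=
  ∀ (k : ℕ) (q : ℤ) (_ : k + q = m) (a b : V) (s : Simplex rel k a b),
    (S.cat (S.region s)).Hom (S.obj (S.region_last s) (E b)) (S.obj (S.region_first s) (F a)) q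

instance (E F : ∀ a, S.Ob a) (m : ℤ) : AddCommGroup (S.Cochain rel E F m) where
  add φ ψ k q h a b s := φ k q h a b s + ψ k q h a b s
  zero k q h a b s := 0
  neg φ k q h a b s := - φ k q h a b s
  add_assoc φ ψ χ := by funext k q h a b s; exact add_assoc _ _ _
  zero_add φ := by funext k q h a b s; exact zero_add _
  add_zero φ := by funext k q h a b s; exact add_zero _
  add_comm φ ψ := by funext k q h a b s; exact add_comm _ _
  neg_add_cancel φ := by funext k q h a b s; exact neg_add_cancel _
  nsmul n φ k q h a b s := n • φ k q h a b s
  nsmul_zero φ := by funext k q h a b s; exact zero_nsmul _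
  nsmul_succ n φ := by funext k q h a b s; exact succ_nsmul _ _
  zsmul n φ k q h a b s := n • φ k q h a b s
  zsmul_zero' φ := by funext k q h a b s; exact zero_zsmul _
  zsmul_succ' n φ := by funext k q h a b s; exact SubNegMonoid.zsmul_succ' _ _
  zsmul_neg' n φ := by funext k q h a b s; exact SubNegMonoid.zsmul_neg' _ _

variable {S}

/-- The component of a cochain at a multi-index `s`, restricted to a smaller region `W`. -/
def Cochain.ev {E F : ∀ a, S.Ob a} {m : ℤ} (φ : S.Cochain rel E F m) {k : ℕ} {q : ℤ}
    (h : k + q = m) {a b : V} (s : Simplex rel k a b) {W : L} (hW : W ≤ S.region s) :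
    (S.cat W).Hom (S.obj (hW.trans (S.region_last s)) (E b))
      (S.obj (hW.trans (S.region_first s)) (F a)) q :=
  S.res hW (φ k q h a b s)

variable (S)

/-- The Čech-type differential
`(δ φ)_{i_0 … i_{k+1}} = ∑_{j = 1}^{k} (-1) ^ j φ_{i_0 … î_j … i_{k+1}}`. -/
def delta {E F : ∀ a, S.Ob a} {m m' : ℤ} (hm : m + 1 = m') (φ : S.Cochain rel E F m) :
    S.Cochain rel E F m' := fun k q h a b s =>
  match k, h, s with
  | 0, _, _ => 0
  | k + 1, h, s => ∑ j : Fin k, ((j.1 : ℤ) + 1).negOnePow •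
      φ.ev (by push_cast at h; omega) (s.skip j) (S.region_skip s j)

/-- The internal differential `(-1) ^ k d (φ_{i_0 … i_k})`. -/
def inner {E F : ∀ a, S.Ob a} {m m' : ℤ} (hm : m + 1 = m') (φ : S.Cochain rel E F m) :
    S.Cochain rel E F m' := fun k q h a b s =>
  (k : ℤ).negOnePow • (S.cat (S.region s)).d (by omega) (φ k (m - k) (by omega) a b s)

/-- The shuffled multiplication
`(φ · η)_{i_0 … i_n} = ∑_{p + r = n} (-1) ^ (q r) φ^{p,q}_{i_0 … i_p} ∘ η^{r,s}_{i_p … i_n}`. -/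
def mul {E F G : ∀ a, S.Ob a} {m₁ m₂ m : ℤ} (hm : m₁ + m₂ = m) (φ : S.Cochain rel F G m₁)
    (η : S.Cochain rel E F m₂) : S.Cochain rel E G m := fun n q h a b s =>
  asum n fun p r hpr => ((m₁ - p) * r).negOnePow • (S.cat (S.region s)).comp (by omega)
    (φ.ev (q := m₁ - p) (by omega) (s.front hpr) (S.region_front s hpr))
    (η.ev (q := m₂ - r) (by omega) (s.back hpr) (S.region_back s hpr))

/-- The identity of the object `E_a = E_b` for `a = b`. -/
def idOn (E : ∀ a, S.Ob a) {a b : V} (hab : a = b) {W : L} (ha : W ≤ S.dom a) (hb : W ≤ S.dom b)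
    {q : ℤ} (hq : q = 0) : (S.cat W).Hom (S.obj hb (E b)) (S.obj ha (E a)) q := by
  cases hab
  exact (S.cat W).unit _ hq

/-- The unit cochain: the identity at each one-entry multi-index, and `0` at the longer ones. -/
def oneCochain (E : ∀ a, S.Ob a) : S.Cochain rel E E 0 := fun k q h a b s =>
  if hk : k = 0 then
    S.idOn E (s.first_eq_last hk) (S.region_first s) (S.region_last s) (by omega)
  else 0

variable {S}

section ev

variable {E F G : ∀ a, S.Ob a} {m m' : ℤ}

lemma ev_congr (φ : S.Cochain rel E F m) {k : ℕ} {q : ℤ}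
    (h : k + q = m) {a b : V} (s s' : Simplex rel k a b) (hs : s.v = s'.v) {W : L}
    (hW : W ≤ S.region s) (hW' : W ≤ S.region s') : φ.ev h s hW = φ.ev h s' hW' := by
  obtain rfl : s = s' := Simplex.ext hs
  rfl

lemma ev_self (φ : S.Cochain rel E F m) {k : ℕ} {q : ℤ} (h : k + q = m) {a b : V}
    (s : Simplex rel k a b) (hW : S.region s ≤ S.region s) :
    φ.ev h s hW = φ k q h a b s := S.res_refl _

lemma res_ev (φ : S.Cochain rel E F m) {k : ℕ} {q : ℤ} (h : k + q = m) {a b : V}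
    (s : Simplex rel k a b) {W W' : L} (hW : W ≤ S.region s) (hW' : W' ≤ W) :
    S.res hW' (φ.ev h s hW) = φ.ev h s (hW'.trans hW) := S.res_res _ _ _

lemma ev_add (φ ψ : S.Cochain rel E F m) {k : ℕ} {q : ℤ} (h : k + q = m) {a b : V}
    (s : Simplex rel k a b) {W : L} (hW : W ≤ S.region s) :
    Cochain.ev (φ + ψ) h s hW = φ.ev h s hW + ψ.ev h s hW := S.res_add _ _ _

lemma ev_delta_zero (hm : m + 1 = m') (φ : S.Cochain rel E F m) {q : ℤ} (h : (0 : ℕ) + q = m')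
    {a b : V} (s : Simplex rel 0 a b) {W : L} (hW : W ≤ S.region s) :
    (S.delta hm φ).ev h s hW = 0 := S.res_zero _

lemma ev_delta_succ (hm : m + 1 = m') (φ : S.Cochain rel E F m) {k : ℕ} {q : ℤ}
    (h : ((k + 1 : ℕ) : ℤ) + q = m') (h' : k + q = m)
    {a b : V} (s : Simplex rel (k + 1) a b) {W : L} (hW : W ≤ S.region s) :
    (S.delta hm φ).ev h s hW = ∑ j : Fin k, ((j.1 : ℤ) + 1).negOnePow •
      φ.ev h' (s.skip j) (hW.trans (S.region_skip s j)) := by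
  refine (S.res_sum _ _ _).trans (Finset.sum_congr rfl fun j _ => ?_)
  rw [S.res_smul, res_ev]

lemma ev_inner (hm : m + 1 = m') (φ : S.Cochain rel E F m) {k : ℕ} {q q' : ℤ} (h : k + q' = m')
    (h' : k + q = m) {a b : V} (s : Simplex rel k a b) {W : L} (hW : W ≤ S.region s) :
    (S.inner hm φ).ev h s hW = (k : ℤ).negOnePow • (S.cat W).d (by omega) (φ.ev h' s hW) := by
  obtain rfl : q = m - k := by omega
  refine (S.res_smul _ _ _).trans ?_
  rw [S.res_d]; rfl

lemma ev_mul {m₁ m₂ : ℤ} (hm : m₁ + m₂ = m) (φ : S.Cochain rel F G m₁)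
    (η : S.Cochain rel E F m₂) {n : ℕ} {q : ℤ} (h : n + q = m) {a b : V}
    (s : Simplex rel n a b) {W : L} (hW : W ≤ S.region s) :
    (S.mul hm φ η).ev h s hW =
      asum n fun p r hpr => ((m₁ - p) * r).negOnePow • (S.cat W).comp (by omega)
        (φ.ev (q := m₁ - p) (by omega) (s.front hpr) (hW.trans (S.region_front s hpr)))
        (η.ev (q := m₂ - r) (by omega) (s.back hpr) (hW.trans (S.region_back s hpr))) := by
  refine (S.res_asum _ _ _).trans (asum_congr fun p r e => ?_)
  rw [S.res_smul, S.res_comp, res_ev, res_ev]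

lemma comp_congr {m₁ m₂ : ℤ} (φ : S.Cochain rel F G m₁) (η : S.Cochain rel E F m₂) {p r : ℕ}
    {q₁ q₁' q₂ q₂' q : ℤ} (h₁ : p + q₁ = m₁) (h₁' : p + q₁' = m₁) (h₂ : r + q₂ = m₂)
    (h₂' : r + q₂' = m₂) (hq : q₁ + q₂ = q) (hq' : q₁' + q₂' = q) {a b c c' : V} (hc : c = c')
    (s : Simplex rel p a c) (s' : Simplex rel p a c') (hs : s.v = s'.v)
    (σ : Simplex rel r c b) (σ' : Simplex rel r c' b) (hσ : σ.v = σ'.v) {W : L}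
    (hW₁ : W ≤ S.region s) (hW₁' : W ≤ S.region s') (hW₂ : W ≤ S.region σ)
    (hW₂' : W ≤ S.region σ') :
    (S.cat W).comp hq (φ.ev h₁ s hW₁) (η.ev h₂ σ hW₂) =
      (S.cat W).comp hq' (φ.ev h₁' s' hW₁') (η.ev h₂' σ' hW₂') := by
  subst hc
  obtain rfl : s = s' := Simplex.ext hs
  obtain rfl : σ = σ' := Simplex.ext hσ
  obtain rfl : q₁ = q₁' := by omega
  obtain rfl : q₂ = q₂' := by omega
  rfl

lemma comp_comp_congr {H : ∀ a, S.Ob a} {m₁ m₂ m₃ : ℤ} (φ : S.Cochain rel G H m₁)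
    (η : S.Cochain rel F G m₂) (ζ : S.Cochain rel E F m₃) {p q r : ℕ} {q₁ q₂ q₃ q₂₃ q₂₃' d : ℤ}
    (h₁ : p + q₁ = m₁) (h₂ : q + q₂ = m₂) (h₃ : r + q₃ = m₃)
    (hq : q₁ + q₂₃ = d) (hq' : q₁ + q₂₃' = d) (hr : q₂ + q₃ = q₂₃) (hr' : q₂ + q₃ = q₂₃')
    {a b c c' e e' : V} (hc : c = c') (he : e = e')
    (s : Simplex rel p a c) (s' : Simplex rel p a c') (hs : s.v = s'.v)
    (σ : Simplex rel q c e) (σ' : Simplex rel q c' e') (hσ : σ.v = σ'.v)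
    (τ : Simplex rel r e b) (τ' : Simplex rel r e' b) (hτ : τ.v = τ'.v) {W : L}
    (hW₁ : W ≤ S.region s) (hW₁' : W ≤ S.region s') (hW₂ : W ≤ S.region σ)
    (hW₂' : W ≤ S.region σ') (hW₃ : W ≤ S.region τ) (hW₃' : W ≤ S.region τ') :
    (S.cat W).comp hq (φ.ev h₁ s hW₁) ((S.cat W).comp hr (η.ev h₂ σ hW₂) (ζ.ev h₃ τ hW₃)) =
      (S.cat W).comp hq' (φ.ev h₁ s' hW₁')
        ((S.cat W).comp hr' (η.ev h₂ σ' hW₂') (ζ.ev h₃ τ' hW₃')) := by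
  subst hc he
  obtain rfl : s = s' := Simplex.ext hs
  obtain rfl : σ = σ' := Simplex.ext hσ
  obtain rfl : τ = τ' := Simplex.ext hτ
  obtain rfl : q₂₃ = q₂₃' := by omega
  rfl

lemma res_idOn (E : ∀ a, S.Ob a) {a b : V} (hab : a = b) {W W' : L} (hW : W' ≤ W)
    (ha : W ≤ S.dom a) (hb : W ≤ S.dom b) {q : ℤ} (hq : q = 0) :
    S.res hW (S.idOn E hab ha hb hq) = S.idOn E hab (hW.trans ha) (hW.trans hb) hq := by
  subst hab hq
  exact S.res_one _ _ _

lemma ev_one_zero {q : ℤ} (h : (0 : ℕ) + q = 0) {a b : V} (s : Simplex rel 0 a b) {W : L}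
    (hW : W ≤ S.region s) : (S.oneCochain E).ev h s hW =
      S.idOn E (s.first_eq_last rfl) (hW.trans (S.region_first s)) (hW.trans (S.region_last s))
        (by omega) := by
  unfold Cochain.ev oneCochain
  rw [dif_pos rfl, res_idOn]

lemma ev_one_of_ne {k : ℕ} (hk : k ≠ 0) {q : ℤ} (h : k + q = 0) {a b : V}
    (s : Simplex rel k a b) {W : L} (hW : W ≤ S.region s) :
    (S.oneCochain E).ev h s hW = 0 := by
  unfold Cochain.ev oneCochain
  rw [dif_neg hk, S.res_zero]

lemma idOn_comp (φ : S.Cochain rel E F m) {k : ℕ} {q q' q₀ : ℤ} (h : k + q = m) (h' : k + q' = m)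
    {a b c : V} (hac : a = c) (s : Simplex rel k c b) (s' : Simplex rel k a b)
    (hs : s.v = s'.v) {W : L}
    (hW : W ≤ S.region s) (hW' : W ≤ S.region s') (ha : W ≤ S.dom a) (hc : W ≤ S.dom c)
    (hq : q₀ = 0) (hqq : q₀ + q = q') :
    (S.cat W).comp hqq (S.idOn F hac ha hc hq) (φ.ev h s hW) = φ.ev h' s' hW' := by
  subst hac hq
  obtain rfl : s = s' := Simplex.ext hs
  obtain rfl : q = q' := by omega
  exact (S.cat W).one_comp _ _

lemma comp_idOn (φ : S.Cochain rel E F m) {k : ℕ} {q q' q₀ : ℤ} (h : k + q = m) (h' : k + q' = m)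
    {a b c : V} (hcb : c = b) (s : Simplex rel k a c) (s' : Simplex rel k a b)
    (hs : s.v = s'.v) {W : L}
    (hW : W ≤ S.region s) (hW' : W ≤ S.region s') (hc : W ≤ S.dom c) (hb : W ≤ S.dom b)
    (hq : q₀ = 0) (hqq : q + q₀ = q') :
    (S.cat W).comp hqq (φ.ev h s hW) (S.idOn E hcb hc hb hq) = φ.ev h' s' hW' := by
  subst hcb hq
  obtain rfl : s = s' := Simplex.ext hs
  obtain rfl : q = q' := by omega
  exact (S.cat W).comp_one _ _

lemma cochain_ext {φ ψ : S.Cochain rel E F m}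
    (h : ∀ (k : ℕ) (q : ℤ) (hq : k + q = m) (a b : V) (s : Simplex rel k a b),
      φ.ev hq s le_rfl = ψ.ev hq s le_rfl) : φ = ψ := by
  funext k q hq a b s
  have := h k q hq a b s
  rwa [ev_self, ev_self] at this

end ev

section laws

variable {E F G H : ∀ a, S.Ob a} {m : ℤ}

lemma ev_smul (φ : S.Cochain rel E F m) (e : ℤˣ) {k : ℕ} {q : ℤ} (h : k + q = m) {a b : V}
    (s : Simplex rel k a b) {W : L} (hW : W ≤ S.region s) :
    Cochain.ev (e • φ) h s hW = e • φ.ev h s hW := S.res_smul _ _ _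

lemma ev_zero {k : ℕ} {q : ℤ} (h : k + q = m) {a b : V}
    (s : Simplex rel k a b) {W : L} (hW : W ≤ S.region s) :
    Cochain.ev (0 : S.Cochain rel E F m) h s hW = 0 := S.res_zero _

lemma sum_face_cancel {A : Type*} [AddCommGroup A] (k : ℕ) (T : Fin (k + 1) → Fin k → A)
    (h : ∀ (j j' : Fin (k + 1)) (i i' : Fin k), i.1 < j.1 → j'.1 = i.1 → i'.1 + 1 = j.1 →
      T j i + T j' i' = 0) : ∑ j, ∑ i, T j i = 0 := by
  rw [← Finset.sum_product' _ _ T]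
  refine Finset.sum_involution (fun x _ => if h : x.2.1 < x.1.1 then
      (⟨x.2.1, by omega⟩, ⟨x.1.1 - 1, by omega⟩)
    else (⟨x.2.1 + 1, by omega⟩, ⟨x.1.1, by omega⟩)) ?_ ?_ ?_ ?_
  · rintro ⟨j, i⟩ -
    by_cases h' : i.1 < j.1
    · simp only [dif_pos h']
      exact h _ _ _ _ h' rfl (by simp only; omega)
    · simp only [dif_neg h']
      rw [add_comm]
      exact h _ _ _ _ (by simp only; omega) rfl rfl
  · rintro ⟨j, i⟩ - - h
    by_cases h' : i.1 < j.1
    · simp only [dif_pos h', Prod.mk.injEq, Fin.ext_iff] at h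
      omega
    · simp only [dif_neg h', Prod.mk.injEq, Fin.ext_iff] at h
      omega
  · intros; simp
  · rintro ⟨j, i⟩ -
    by_cases h : i.1 < j.1
    · have : ¬ (j.1 - 1 < i.1) := by omega
      simp only [dif_pos h, dif_neg this]
      exact Prod.ext (Fin.ext (by simp only; omega)) (Fin.ext rfl)
    · have : j.1 < i.1 + 1 := by omega
      simp only [dif_neg h, dif_pos this]
      exact Prod.ext (Fin.ext rfl) (Fin.ext (by simp only; omega))

lemma delta_delta {m' m'' : ℤ} (hm : m + 1 = m') (hm' : m' + 1 = m'')
    (φ : S.Cochain rel E F m) : S.delta hm' (S.delta hm φ) = 0 := by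
  refine cochain_ext fun k q hq a b s => ?_
  rw [ev_zero]
  rcases k with _ | _ | k
  · rw [ev_delta_zero]
  · rw [ev_delta_succ (h' := by push_cast at hq ⊢; omega)]
    simp
  · rw [ev_delta_succ (h' := by push_cast at hq ⊢; omega)]
    have hk : (k : ℤ) + q = m := by push_cast at hq ⊢; omega
    have e : ∀ j ∈ (Finset.univ : Finset (Fin (k + 1))), ((j.1 : ℤ) + 1).negOnePow •
        (S.delta hm φ).ev (k := k + 1) (q := q) (by push_cast at hq ⊢; omega) (s.skip j)
          (le_rfl.trans (S.region_skip s j)) =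
        ∑ i : Fin k, (((j.1 : ℤ) + 1).negOnePow * ((i.1 : ℤ) + 1).negOnePow) •
          φ.ev hk ((s.skip j).skip i) ((S.region_skip s j).trans (S.region_skip _ i)) := by
      intro j _
      rw [ev_delta_succ (h' := hk), Finset.smul_sum]
      exact Finset.sum_congr rfl fun i _ => smul_smul _ _ _
    refine (Finset.sum_congr rfl e).trans ?_
    refine sum_face_cancel k _ fun j j' i i' h hj hi => ?_
    have e1 : ((j.1 : ℤ) + 1).negOnePow = - ((i'.1 : ℤ) + 1).negOnePow := by
      rw [← Int.negOnePow_succ]; congr 1; omega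
    have e2 : ((j'.1 : ℤ) + 1).negOnePow = ((i.1 : ℤ) + 1).negOnePow := by rw [hj]
    rw [ev_congr φ hk _ ((s.skip j').skip i') (by
      funext x
      refine congrArg s.v (Fin.ext ?_)
      simp only
      split_ifs <;> omega) _ ((S.region_skip s _).trans (S.region_skip _ _)), e1, e2, neg_mul,
      Units.neg_smul, mul_comm, neg_add_cancel]

lemma inner_inner {m' m'' : ℤ} (hm : m + 1 = m') (hm' : m' + 1 = m'')
    (φ : S.Cochain rel E F m) : S.inner hm' (S.inner hm φ) = 0 := by
  refine cochain_ext fun k q hq a b s => ?_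
  rw [ev_zero, ev_inner (q := m' - k) (h' := by omega), ev_inner (q := m - k) (h' := by omega),
    DGCat.d_smul, DGCat.d_d, smul_zero, smul_zero]

lemma delta_inner {m' m'' : ℤ} (hm : m + 1 = m') (hm' : m' + 1 = m'')
    (φ : S.Cochain rel E F m) : S.delta hm' (S.inner hm φ) + S.inner hm' (S.delta hm φ) = 0 := by
  refine cochain_ext fun k q hq a b s => ?_
  rw [ev_zero, ev_add, ev_inner (q := m' - k) (h' := by omega)]
  rcases k with _ | k
  · rw [ev_delta_zero, ev_delta_zero, DGCat.d_zero, smul_zero, add_zero]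
  · rw [ev_delta_succ (h' := by push_cast at hq ⊢; omega),
      ev_delta_succ (h' := by push_cast at hq ⊢; omega), DGCat.d_sum, Finset.smul_sum,
      ← Finset.sum_add_distrib]
    refine Finset.sum_eq_zero fun j _ => ?_
    rw [ev_inner (q := m' - (k + 1 : ℕ)) (h' := by push_cast; omega), DGCat.d_smul, smul_smul,
      smul_smul]
    push_cast
    rw [Int.negOnePow_succ (k : ℤ), neg_mul, mul_comm, Units.neg_smul, add_neg_cancel]

lemma mul_assoc' {m₁ m₂ m₃ m₁₂ m₂₃ : ℤ} (h₁ : m₁ + m₂ = m₁₂) (h₂ : m₂ + m₃ = m₂₃)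
    (h₃ : m₁₂ + m₃ = m) (h₄ : m₁ + m₂₃ = m) (φ : S.Cochain rel G H m₁)
    (η : S.Cochain rel F G m₂) (ζ : S.Cochain rel E F m₃) :
    S.mul h₃ (S.mul h₁ φ η) ζ = S.mul h₄ φ (S.mul h₂ η ζ) := by
  refine cochain_ext fun n d hn a b s => ?_
  rw [ev_mul, ev_mul]
  let g : ∀ p q r : ℕ, p + q + r = n → (S.cat (S.region s)).Hom
      (S.obj (S.region_last s) (E b)) (S.obj (S.region_first s) (H a)) d := fun p q r e =>
    ((m₁ - p) * q + (m₁ - p) * r + (m₂ - q) * r).negOnePow •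
      (S.cat (S.region s)).comp (q := m₂ - q + (m₃ - r)) (r := d) (by omega)
        (φ.ev (q := m₁ - p) (by omega) (s.front (show p + (q + r) = n by omega))
          (S.region_front s _))
        ((S.cat (S.region s)).comp rfl
          (η.ev (q := m₂ - q) (by omega) ((s.back (show p + (q + r) = n by omega)).front rfl)
            ((S.region_back s _).trans (S.region_front _ _)))
          (ζ.ev (q := m₃ - r) (by omega) ((s.back (show p + (q + r) = n by omega)).back rfl)
            ((S.region_back s _).trans (S.region_back _ _))))
  refine Eq.trans (asum_congr (g := fun x r h => asum x (fun p q h' => g p q r (by omega))) ?_)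
    ((asum_assoc n g).trans (asum_congr ?_))
  · intro x r h
    rw [ev_mul, DGCat.asum_comp, smul_asum]
    refine asum_congr fun p q h' => ?_
    subst h'
    rw [DGCat.smul_comp, smul_smul]
    refine Eq.trans (congrArg _ (DGCat.comp_assoc _ (qr := m₂ - q + (m₃ - r)) _ rfl _
      (by omega) _ _ _)) ?_
    refine congrArg₂ (· • ·) ?_ (comp_comp_congr φ η ζ _ _ _ _ _ _ _ rfl rfl _ _ rfl _ _ rfl
      _ _ ?_ _ _ _ _ _ _)
    · rw [← Int.negOnePow_add]; congr 1; subst h₁; push_cast; ring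
    · funext x
      exact congrArg s.v (Fin.ext (add_assoc _ _ _))
  · intro p y h
    rw [ev_mul, DGCat.comp_asum, smul_asum]
    refine asum_congr fun q r h' => ?_
    subst h'
    rw [DGCat.comp_smul, smul_smul]
    refine congrArg₂ (· • ·) ?_ (comp_comp_congr φ η ζ _ _ _ _ _ _ _ rfl rfl _ _ rfl _ _ rfl
      _ _ rfl _ _ _ _ _ _)
    rw [← Int.negOnePow_add]; congr 1; push_cast; ring

lemma add_mul' {m₁ m₂ : ℤ} (h : m₁ + m₂ = m) (φ φ' : S.Cochain rel F G m₁)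
    (η : S.Cochain rel E F m₂) : S.mul h (φ + φ') η = S.mul h φ η + S.mul h φ' η := by
  refine cochain_ext fun n d hn a b s => ?_
  rw [ev_add, ev_mul, ev_mul, ev_mul, ← asum_add]
  refine asum_congr fun p r e => ?_
  rw [ev_add, DGCat.add_comp, smul_add]

lemma mul_add' {m₁ m₂ : ℤ} (h : m₁ + m₂ = m) (φ : S.Cochain rel F G m₁)
    (η η' : S.Cochain rel E F m₂) : S.mul h φ (η + η') = S.mul h φ η + S.mul h φ η' := by
  refine cochain_ext fun n d hn a b s => ?_
  rw [ev_add, ev_mul, ev_mul, ev_mul, ← asum_add]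
  refine asum_congr fun p r e => ?_
  rw [ev_add, DGCat.comp_add, smul_add]

lemma one_mul' (h : 0 + m = m) (φ : S.Cochain rel E F m) :
    S.mul h (S.oneCochain F) φ = φ := by
  refine cochain_ext fun n d hn a b s => ?_
  rw [ev_mul, asum_first]
  · rw [ev_one_zero]
    refine Eq.trans (congrArg₂ (· • ·) ?_ (idOn_comp φ _ hn s.first.symm (s.back _) s
      (funext fun x => congrArg s.v (Fin.ext (zero_add _))) _ le_rfl _ _ _ _)) (one_smul ℤˣ _)
    simp
  · intro p r e hp
    rw [ev_one_of_ne hp, DGCat.zero_comp, smul_zero]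

lemma mul_one' (h : m + 0 = m) (φ : S.Cochain rel E F m) :
    S.mul h φ (S.oneCochain E) = φ := by
  refine cochain_ext fun n d hn a b s => ?_
  rw [ev_mul, asum_last]
  · rw [ev_one_zero]
    refine Eq.trans (congrArg₂ (· • ·) ?_ (comp_idOn φ _ hn s.last (s.front _) s rfl _ le_rfl
      _ _ _ _)) (one_smul ℤˣ _)
    simp
  · intro p r e hp
    rw [ev_one_of_ne hp, DGCat.comp_zero, smul_zero]

lemma delta_add {m' : ℤ} (hm : m + 1 = m') (φ ψ : S.Cochain rel E F m) :
    S.delta hm (φ + ψ) = S.delta hm φ + S.delta hm ψ := by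
  refine cochain_ext fun k q hq a b s => ?_
  rw [ev_add]
  rcases k with _ | k
  · simp only [ev_delta_zero, add_zero]
  · have hk : (k : ℤ) + q = m := by push_cast at hq; omega
    rw [ev_delta_succ (h' := hk), ev_delta_succ (h' := hk), ev_delta_succ (h' := hk),
      ← Finset.sum_add_distrib]
    exact Finset.sum_congr rfl fun j _ => by rw [ev_add, smul_add]

lemma inner_add {m' : ℤ} (hm : m + 1 = m') (φ ψ : S.Cochain rel E F m) :
    S.inner hm (φ + ψ) = S.inner hm φ + S.inner hm ψ := by
  refine cochain_ext fun k q hq a b s => ?_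
  have hk : (k : ℤ) + (m - k) = m := by omega
  rw [ev_add, ev_inner (h' := hk), ev_inner (h' := hk), ev_inner (h' := hk), ev_add,
    DGCat.d_add, smul_add]

lemma inner_mul {m₁ m₂ m₁' m₂' m' : ℤ} (h : m₁ + m₂ = m) (hp : m₁ + 1 = m₁') (hq : m₂ + 1 = m₂')
    (hr : m + 1 = m') (h₁ : m₁' + m₂ = m') (h₂ : m₁ + m₂' = m') (φ : S.Cochain rel F G m₁)
    (η : S.Cochain rel E F m₂) : S.inner hr (S.mul h φ η) =
      S.mul h₁ (S.inner hp φ) η + m₁.negOnePow • S.mul h₂ φ (S.inner hq η) := by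
  refine cochain_ext fun n d hn a b s => ?_
  rw [ev_inner (q := m - n) (h' := by omega), ev_mul, ev_add, ev_smul, ev_mul, ev_mul,
    DGCat.d_asum, smul_asum, smul_asum, ← asum_add]
  refine asum_congr fun p r e => ?_
  rw [ev_inner (k := p) (q := m₁ - p) (h' := by omega),
    ev_inner (k := r) (q := m₂ - r) (h' := by omega), DGCat.d_smul,
    DGCat.d_comp (p' := m₁' - p) (q' := m₂' - r) _ _ (by omega) (by omega) _ (by omega) (by omega),
    DGCat.smul_comp, DGCat.comp_smul, smul_add, smul_add]
  simp only [smul_smul, ← Int.negOnePow_add]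
  subst hp e
  refine congrArg₂ (· + ·) (congrArg₂ (· • ·) ?_ rfl) (congrArg₂ (· • ·) ?_ rfl)
  · congr 1; push_cast; ring
  · congr 1; push_cast; ring

lemma delta_mul {m₁ m₂ m₁' m₂' m' : ℤ} (h : m₁ + m₂ = m) (hp : m₁ + 1 = m₁') (hq : m₂ + 1 = m₂')
    (hr : m + 1 = m') (h₁ : m₁' + m₂ = m') (h₂ : m₁ + m₂' = m') (φ : S.Cochain rel F G m₁)
    (η : S.Cochain rel E F m₂) : S.delta hr (S.mul h φ η) =
      S.mul h₁ (S.delta hp φ) η + m₁.negOnePow • S.mul h₂ φ (S.delta hq η) := by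
  refine cochain_ext fun n d hn a b s => ?_
  rw [ev_add, ev_smul]
  rcases n with _ | n
  · rw [ev_delta_zero, ev_mul, ev_mul, asum_zero, asum_zero, ev_delta_zero, ev_delta_zero,
      DGCat.zero_comp, DGCat.comp_zero, smul_zero, smul_zero, smul_zero, add_zero]
  · have hn' : (n : ℤ) + d = m := by push_cast at hn; omega
    rw [ev_delta_succ (h' := hn'), ev_mul, ev_mul, asum_succ, asum_succ', ev_delta_zero,
      ev_delta_zero, DGCat.zero_comp, DGCat.comp_zero, smul_zero, smul_zero, zero_add, zero_add,
      smul_asum, ← asum_add]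
    rw [Finset.sum_congr rfl (fun j _ => by rw [ev_mul, smul_asum]), asum_sum_comm]
    refine asum_congr fun p r e => ?_
    subst e
    rw [Fin.sum_univ_add, ev_delta_succ (k := p)
        (h' := show (p : ℤ) + (m₁' - (p + 1 : ℕ)) = m₁ by push_cast; omega),
      ev_delta_succ (k := r)
        (h' := show (r : ℤ) + (m₂' - (r + 1 : ℕ)) = m₂ by push_cast; omega),
      DGCat.sum_comp, DGCat.comp_sum, Finset.smul_sum, Finset.smul_sum, Finset.smul_sum]
    refine congrArg₂ (· + ·) (Finset.sum_congr rfl fun j _ => ?_)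
      (Finset.sum_congr rfl fun j _ => ?_)
    · rw [DGCat.smul_comp, smul_smul, smul_smul]
      refine congrArg₂ (· • ·) ?_ (comp_congr φ η _ _ _ _ _ _ ?_ _ _ ?_ _ _ ?_ _ _ _ _)
      · rw [mul_comm]; subst hp; push_cast; congr 2; ring
      · refine congrArg s.v (Fin.ext ?_)
        have := j.2
        simp only [Fin.val_castAdd]
        split_ifs <;> omega
      · rfl
      · funext x
        refine congrArg s.v (Fin.ext ?_)
        have := j.2
        simp only [Fin.val_castAdd]
        split_ifs <;> omega
    · rw [DGCat.comp_smul, smul_smul, smul_smul, smul_smul]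
      refine congrArg₂ (· • ·) ?_ (comp_congr φ η _ _ _ _ _ _ ?_ _ _ ?_ _ _ ?_ _ _ _ _)
      · rw [← Int.negOnePow_add, ← Int.negOnePow_add, ← Int.negOnePow_add,
          Int.negOnePow_eq_iff]
        refine ⟨p - m₁, ?_⟩
        rw [Fin.val_natAdd]
        push_cast
        ring
      · refine congrArg s.v (Fin.ext ?_)
        simp only [Fin.val_natAdd]
        split_ifs <;> omega
      · funext x
        refine congrArg s.v (Fin.ext ?_)
        simp only [Fin.val_natAdd]
        split_ifs <;> omega
      · funext x
        refine congrArg s.v (Fin.ext ?_)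
        simp only [Fin.val_natAdd]
        split_ifs <;> omega

end laws

variable (S) in
/-- The dg-category of cochains: an object is a family `E` of objects `E_a`, a morphism of degree
`m` is a cochain of total degree `m`, the composition is the shuffled multiplication, and the
differential is
`(D φ)_{i_0 … i_k} = (-1) ^ k d (φ_{i_0 … i_k}) + ∑_{j = 1}^{k - 1} (-1) ^ j φ_{i_0 … î_j … i_k}`. -/
def cochains (rel : V → V → Prop) : DGCat where
  Ob := ∀ a, S.Ob a
  Hom E F m := S.Cochain rel E F m
  one E := S.oneCochain E
  comp h φ η := S.mul h φ η
  d h φ := S.inner h φ + S.delta h φ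
  add_comp h φ φ' η := add_mul' h φ φ' η
  comp_add h φ η η' := mul_add' h φ η η'
  comp_assoc h₁ h₂ h₃ h₄ φ η ζ := mul_assoc' h₁ h₂ h₃ h₄ φ η ζ
  one_comp h φ := one_mul' h φ
  comp_one h φ := mul_one' h φ
  d_add h φ ψ := by rw [inner_add, delta_add]; abel
  d_d h h' φ := by
    rw [inner_add, delta_add, inner_inner, delta_delta, zero_add, add_zero, add_comm,
      delta_inner]
  d_comp h hp hq hr h₁ h₂ φ η := by
    rw [inner_mul h hp hq hr h₁ h₂, delta_mul h hp hq hr h₁ h₂, add_mul', mul_add', smul_add]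
    abel

end CoeffSystem

/-! ### Sheaves of modules and their complexes -/

section Sheaves

variable {X : TopCat.{u}} (R : X.Sheaf RingCat.{v})

/-- A sheaf of left modules over the restriction of the sheaf of rings `R` to the open set `U`.
Open subsets of `U` are given as open subsets `V ≤ U` of `X`, which makes the restriction to
smaller open sets strictly functorial. -/
structure ModSheaf (U : Opens X) : Type (max u v (w + 1)) where
  obj : ∀ V : Opens X, V ≤ U → ModuleCat.{w} (R.presheaf.obj (op V))
  map : ∀ {V W : Opens X} (hV : V ≤ U) (h : W ≤ V), obj V hV →+ obj W (h.trans hV)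
  map_smul : ∀ {V W : Opens X} (hV : V ≤ U) (h : W ≤ V) (r : R.presheaf.obj (op V))
    (x : obj V hV), map hV h (r • x) = (R.presheaf.map (homOfLE h).op).hom r • map hV h x
  map_refl : ∀ {V : Opens X} (hV : V ≤ U) (x : obj V hV), map hV le_rfl x = x
  map_map : ∀ {V W Z : Opens X} (hV : V ≤ U) (h : W ≤ V) (h' : Z ≤ W) (x : obj V hV),
    map (h.trans hV) h' (map hV h x) = map hV (h'.trans h) x
  /-- compatible local sections glue uniquely -/
  glue : ∀ {κ : Type u} (C : κ → Opens X) (hC : ∀ i, C i ≤ U) (x : ∀ i, obj (C i) (hC i)),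
    (∀ i j, map (hC i) (inf_le_left : C i ⊓ C j ≤ C i) (x i) =
      map (hC j) (inf_le_right : C i ⊓ C j ≤ C j) (x j)) →
    ∃! y : obj (⨆ i, C i) (iSup_le hC), ∀ i, map (iSup_le hC) (le_iSup C i) y = x i

namespace ModSheaf

variable {R} {U : Opens X}

/-- A morphism of sheaves of modules. -/
@[ext]
structure Hom (M N : ModSheaf.{u, v, w} R U) where
  app : ∀ (V : Opens X) (hV : V ≤ U), M.obj V hV →ₗ[R.presheaf.obj (op V)] N.obj V hV
  naturality : ∀ {V W : Opens X} (hV : V ≤ U) (h : W ≤ V) (x : M.obj V hV),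
    app W (h.trans hV) (M.map hV h x) = N.map hV h (app V hV x)

instance : Category (ModSheaf.{u, v, w} R U) where
  Hom M N := Hom M N
  id M := { app := fun V hV => LinearMap.id, naturality := fun _ _ _ => rfl }
  comp f g :=
    { app := fun V hV => (g.app V hV).comp (f.app V hV)
      naturality := fun hV h x => by simp [f.naturality, g.naturality] }

instance (M N : ModSheaf.{u, v, w} R U) : AddCommGroup (M ⟶ N) where
  add f g := ⟨fun V hV => f.app V hV + g.app V hV, fun hV h x => by
    simp [f.naturality, g.naturality]⟩
  zero := ⟨fun V hV => 0, fun hV h x => by simp⟩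
  neg f := ⟨fun V hV => - f.app V hV, fun hV h x => by simp [f.naturality]⟩
  add_assoc f g h := Hom.ext (by funext V hV; exact add_assoc _ _ _)
  zero_add f := Hom.ext (by funext V hV; exact zero_add _)
  add_zero f := Hom.ext (by funext V hV; exact add_zero _)
  add_comm f g := Hom.ext (by funext V hV; exact add_comm _ _)
  neg_add_cancel f := Hom.ext (by funext V hV; exact neg_add_cancel _)
  nsmul n f := ⟨fun V hV => n • f.app V hV, fun hV h x => by simp [f.naturality]⟩
  nsmul_zero f := Hom.ext (by funext V hV; exact zero_nsmul _)
  nsmul_succ n f := Hom.ext (by funext V hV; exact succ_nsmul _ _)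
  zsmul n f := ⟨fun V hV => n • f.app V hV, fun hV h x => by simp [f.naturality]⟩
  zsmul_zero' f := Hom.ext (by funext V hV; exact zero_zsmul _)
  zsmul_succ' n f := Hom.ext (by funext V hV; exact SubNegMonoid.zsmul_succ' _ _)
  zsmul_neg' n f := Hom.ext (by funext V hV; exact SubNegMonoid.zsmul_neg' _ _)

instance : Preadditive (ModSheaf.{u, v, w} R U) where
  add_comp M N P f f' g := Hom.ext (by funext V hV; exact LinearMap.comp_add _ _ _)
  comp_add M N P f g g' := Hom.ext (by funext V hV; exact LinearMap.add_comp _ _ _)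

/-- The restriction of a sheaf of modules to a smaller open set. -/
def restrict (M : ModSheaf.{u, v, w} R U) {W : Opens X} (h : W ≤ U) : ModSheaf.{u, v, w} R W where
  obj V hV := M.obj V (hV.trans h)
  map hV h' := M.map (hV.trans h) h'
  map_smul hV h' := M.map_smul (hV.trans h) h'
  map_refl hV := M.map_refl (hV.trans h)
  map_map hV := M.map_map (hV.trans h)
  glue C hC x := M.glue C (fun i => (hC i).trans h) x

/-- The restriction of a morphism of sheaves of modules to a smaller open set. -/
def resHom {M N : ModSheaf.{u, v, w} R U} (f : M ⟶ N) {W : Opens X} (h : W ≤ U) :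
    M.restrict h ⟶ N.restrict h where
  app V hV := Hom.app f V (hV.trans h)
  naturality hV h' x := Hom.naturality f (hV.trans h) h' x

end ModSheaf

end Sheaves

/-- Homogeneous maps of degree `q` between `ℤ`-graded objects. -/
def GHom {C : Type u} [Category.{v} C] [Preadditive C] (E F : ℤ → C) (q : ℤ) : Type v :=
  ∀ p p' : ℤ, p + q = p' → (E p ⟶ F p')

instance {C : Type u} [Category.{v} C] [Preadditive C] (E F : ℤ → C) (q : ℤ) :
    AddCommGroup (GHom E F q) where
  add f g p p' h := f p p' h + g p p' h
  zero p p' h := 0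
  neg f p p' h := - f p p' h
  add_assoc f g k := by funext p p' h; exact add_assoc _ _ _
  zero_add f := by funext p p' h; exact zero_add _
  add_zero f := by funext p p' h; exact add_zero _
  add_comm f g := by funext p p' h; exact add_comm _ _
  neg_add_cancel f := by funext p p' h; exact neg_add_cancel _
  nsmul n f p p' h := n • f p p' h
  nsmul_zero f := by funext p p' h; exact zero_nsmul _
  nsmul_succ n f := by funext p p' h; exact succ_nsmul _ _
  zsmul n f p p' h := n • f p p' h
  zsmul_zero' f := by funext p p' h; exact zero_zsmul _
  zsmul_succ' n f := by funext p p' h; exact SubNegMonoid.zsmul_succ' _ _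
  zsmul_neg' n f := by funext p p' h; exact SubNegMonoid.zsmul_neg' _ _

/-- The identity in degree `0`. -/
def GHom.one {C : Type u} [Category.{v} C] [Preadditive C] (E : ℤ → C) : GHom E E 0 :=
  fun p p' h => eqToHom (by rw [← h, add_zero])

/-- The composite `f ∘ g` of homogeneous maps. -/
def GHom.comp {C : Type u} [Category.{v} C] [Preadditive C] {E F G : ℤ → C} {q₁ q₂ q : ℤ}
    (h : q₁ + q₂ = q) (f : GHom F G q₁) (g : GHom E F q₂) : GHom E G q :=
  fun p p' hp => g p (p + q₂) rfl ≫ f (p + q₂) p' (by omega)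

/-- The graded category of `ℤ`-graded objects of a preadditive category and homogeneous maps, as a
dg-category with zero differential. -/
def gradedCat (C : Type u) [Category.{v} C] [Preadditive C] : DGCat.{u, v} where
  Ob := ℤ → C
  Hom E F q := GHom E F q
  one E := GHom.one E
  comp h f g := GHom.comp h f g
  d h f := 0
  add_comp h f f' g := by funext p p' hp; exact Preadditive.comp_add _ _ _ _ _ _
  comp_add h f g g' := by funext p p' hp; exact Preadditive.add_comp _ _ _ _ _ _
  comp_assoc {E F G H q₁ q₂ q₃ q₁₂ q₂₃ q} h₁ h₂ h₃ h₄ f g k := by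
    funext p p' hp
    have key : ∀ x y (hx : x = y) (e : p + q₃ + q₂ = x) (e' : p + q₃ + q₂ = y) (e₁ : x + q₁ = p')
        (e₂ : y + q₁ = p'),
        k p (p + q₃) rfl ≫ g (p + q₃) x e ≫ f x p' e₁ =
          (k p (p + q₃) rfl ≫ g (p + q₃) y e') ≫ f y p' e₂ := by
      rintro x y rfl e e' e₁ e₂
      rw [Category.assoc]
    exact key _ _ (by omega) _ _ _ _
  one_comp {E F q} h f := by
    funext p p' hp
    subst hp
    exact Category.comp_id _
  comp_one {E F q} h f := by
    funext p p' hp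
    have key : ∀ x (hx : p + 0 = x) (e : x + q = p') (e' : E p = E x),
        eqToHom e' ≫ f x p' e = f p p' hp := by
      rintro x hx e e'
      obtain rfl : p = x := by omega
      simp
    exact key _ rfl _ _
  d_add h f f' := (add_zero 0).symm
  d_d h h' f := rfl
  d_comp {E F G p q r p' q' r'} h hp hq hr h₁ h₂ f g := by
    have e₁ : GHom.comp h₁ (0 : GHom F G p') g = 0 := by
      funext a b e; exact Limits.comp_zero
    have e₂ : GHom.comp h₂ f (0 : GHom E F q') = 0 := by
      funext a b e; exact Limits.zero_comp
    rw [e₁, e₂, smul_zero, add_zero]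

/-! ### The dg-category of complexes -/

section Complexes

variable {X : TopCat.{u}} (R : X.Sheaf RingCat.{v})

/-- A complex of sheaves of left `R`-modules on the open set `U`. -/
structure Cplx (U : Opens X) where
  E : ℤ → ModSheaf.{u, v, w} R U
  d : GHom E E 1
  d_comp_d : GHom.comp (q := 2) (by omega) d d = 0

/-- The dg-category `Cpx(U)` of complexes of sheaves of left `R`-modules on `U`: the morphisms of
degree `q` are all homogeneous maps of degree `q`, with the differential
`f ↦ d ∘ f - (-1) ^ q f ∘ d`. -/
def cpx (U : Opens X) : DGCat :=
  (gradedCat (ModSheaf.{u, v, w} R U)).twist (Ob' := Cplx R U) Cplx.E Cplx.d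
    (fun K => (zero_add _).trans K.d_comp_d)

variable {R}

/-- The restriction of a homogeneous map to a smaller open set. -/
def GHom.restrict {U W : Opens X} (h : W ≤ U) {E F : ℤ → ModSheaf.{u, v, w} R U} {q : ℤ}
    (f : GHom E F q) : GHom (fun n => (E n).restrict h) (fun n => (F n).restrict h) q :=
  fun p p' e => ModSheaf.resHom (f p p' e) h

lemma GHom.restrict_one {U W : Opens X} (h : W ≤ U) (E : ℤ → ModSheaf.{u, v, w} R U) :
    (GHom.one E).restrict h = GHom.one (fun n => (E n).restrict h) := by
  funext p p' e
  obtain rfl : p = p' := by omega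
  rfl

lemma GHom.restrict_add {U W : Opens X} (h : W ≤ U) {E F : ℤ → ModSheaf.{u, v, w} R U} {q : ℤ}
    (f g : GHom E F q) : (f + g).restrict h = f.restrict h + g.restrict h := rfl

lemma GHom.restrict_zero {U W : Opens X} (h : W ≤ U) {E F : ℤ → ModSheaf.{u, v, w} R U} {q : ℤ} :
    (0 : GHom E F q).restrict h = 0 := rfl

lemma GHom.restrict_sub {U W : Opens X} (h : W ≤ U) {E F : ℤ → ModSheaf.{u, v, w} R U} {q : ℤ}
    (f g : GHom E F q) : (f - g).restrict h = f.restrict h - g.restrict h :=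
  map_sub (AddMonoidHom.mk' (GHom.restrict (E := E) (F := F) (q := q) h) (restrict_add h)) f g

lemma GHom.restrict_smul {U W : Opens X} (h : W ≤ U) {E F : ℤ → ModSheaf.{u, v, w} R U} {q : ℤ}
    (e : ℤˣ) (f : GHom E F q) : (e • f).restrict h = e • f.restrict h := by
  rw [Units.smul_def, Units.smul_def]
  exact map_zsmul (AddMonoidHom.mk' (GHom.restrict (E := E) (F := F) (q := q) h)
    (restrict_add h)) _ f

lemma GHom.restrict_comp {U W : Opens X} (h : W ≤ U) {E F G : ℤ → ModSheaf.{u, v, w} R U}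
    {q₁ q₂ q : ℤ} (e : q₁ + q₂ = q) (f : GHom F G q₁) (g : GHom E F q₂) :
    (GHom.comp e f g).restrict h = GHom.comp e (f.restrict h) (g.restrict h) := rfl

/-- The restriction of a complex to a smaller open set. -/
def Cplx.restrict {U : Opens X} (K : Cplx.{u, v, w} R U) {W : Opens X} (h : W ≤ U) :
    Cplx.{u, v, w} R W where
  E n := (K.E n).restrict h
  d := K.d.restrict h
  d_comp_d := congrArg (GHom.restrict h) K.d_comp_d

/-- The restriction dg-functor `Cpx(U) → Cpx(W)` for `W ≤ U`. -/
def cpxRes {U W : Opens X} (h : W ≤ U) : DGFunctor (cpx.{u, v, w} R U) (cpx.{u, v, w} R W) where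
  obj K := K.restrict h
  map f := GHom.restrict h f
  map_add f g := GHom.restrict_add h f g
  map_one K := GHom.restrict_one h K.E
  map_comp e f g := GHom.restrict_comp h e f g
  map_d {K K' p q} e f := by
    refine (GHom.restrict_sub h _ _).trans (congrArg₂ (· - ·) ?_ ?_)
    · exact (GHom.restrict_add h _ _).trans (congrArg₂ (· + ·) rfl
        (GHom.restrict_comp h ((add_comm 1 p).trans e) _ _))
    · exact (GHom.restrict_smul h _ _).trans (congrArg _ (GHom.restrict_comp h e _ _))

lemma cpxRes_id (U : Opens X) : cpxRes (le_refl U) = DGFunctor.id (cpx.{u, v, w} R U) :=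
  DGFunctor.ext rfl fun _ _ _ _ => rfl

lemma cpxRes_comp {U V W : Opens X} (h : V ≤ U) (h' : W ≤ V) :
    (cpxRes h).comp (cpxRes h') = cpxRes.{u, v, w} (R := R) (h'.trans h) :=
  DGFunctor.ext rfl fun _ _ _ _ => rfl

end Complexes

/-! ### The Čech nerve, and twisted complexes -/

section Twisted

variable {X : TopCat.{u}} (R : X.Sheaf RingCat.{v}) {ι : Type t} (U : ι → Opens X)

/-- The intersection `U_{i_0 … i_n}` for a multi-index `(i_0, …, i_n)`. -/
def inter {n : ℕ} (α : Fin (n + 1) → ι) : Opens X :=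
  ⟨{x | ∀ l, x ∈ U (α l)}, by
    have h : {x | ∀ l, x ∈ U (α l)} = ⋂ l, (U (α l) : Set X) := by ext; simp
    rw [h]
    exact isOpen_iInter_of_finite fun l => (U (α l)).isOpen⟩

lemma inter_le {n m : ℕ} (σ : Fin (n + 1) →o Fin (m + 1)) (β : Fin (m + 1) → ι) :
    inter U β ≤ inter U (β ∘ σ) := fun _ hx l => hx (σ l)

/-- The dg-category `Cpx(N_n)`: the product of the `Cpx(U_{i_0 … i_n})` over all multi-indices
`(i_0, …, i_n)`. -/
def nerveCat (n : ℕ) : DGCat :=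
  DGCat.pi fun α : Fin (n + 1) → ι => cpx.{u, v, w} R (inter U α)

/-- The dg-functor `Cpx(N_n) → Cpx(N_m)` of a monotone map `σ : [n] → [m]`: it sends `(K_α)_α` to
the family with the entry `K_{β ∘ σ}`, restricted to `U_β`, at `β = (i_0, …, i_m)`. -/
def nerveMap {n m : ℕ} (σ : Fin (n + 1) →o Fin (m + 1)) :
    DGFunctor (nerveCat.{u, v, w} R U n) (nerveCat.{u, v, w} R U m) :=
  DGCat.piMap (fun β => β ∘ σ) fun β => cpxRes (inter_le U σ β)

lemma nerveMap_id (n : ℕ) :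
    nerveMap.{u, v, w} R U (OrderHom.id : Fin (n + 1) →o Fin (n + 1)) =
      DGFunctor.id (nerveCat.{u, v, w} R U n) :=
  DGFunctor.ext rfl fun _ _ _ _ => rfl

lemma nerveMap_comp {n m l : ℕ} (σ : Fin (n + 1) →o Fin (m + 1)) (τ : Fin (m + 1) →o Fin (l + 1)) :
    nerveMap.{u, v, w} R U (τ.comp σ) =
      (nerveMap.{u, v, w} R U σ).comp (nerveMap.{u, v, w} R U τ) :=
  ((DGCat.piMap_comp _ _ _ _).trans (congrArg (DGCat.piMap (fun β => (β ∘ τ) ∘ σ)) (funext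
    fun β => cpxRes_comp (inter_le U σ (β ∘ τ)) (inter_le U τ β)))).symm

/-- The cosimplicial dg-category `Cpx(N_•)` of the Čech nerve of the family `U`. -/
def cpxNerve : CosimplicialObject DGCat where
  obj n := nerveCat.{u, v, w} R U n.len
  map σ := nerveMap.{u, v, w} R U σ.toOrderHom
  map_id n := nerveMap_id R U n.len
  map_comp σ τ := nerveMap_comp R U σ.toOrderHom τ.toOrderHom

/-- The graded sheaves of `R`-modules on the open sets of the family `U` and on their
intersections. -/
def cechSystem : CoeffSystem ι (Opens X) where
  dom := U
  inter α := inter U α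
  inter_le α x := fun _ hy => hy x
  le_inter α _ h := fun _ hy x => h x hy
  cat W := gradedCat (ModSheaf.{u, v, w} R W)
  Ob i := ℤ → ModSheaf.{u, v, w} R (U i)
  obj h E n := (E n).restrict h
  res {_ _ _ _} hW {ha hb E F q} f := GHom.restrict (E := fun n => (E n).restrict ha)
    (F := fun n => (F n).restrict hb) hW f
  res_add := by intros; exact GHom.restrict_add _ _ _
  res_one hW ha E := GHom.restrict_one _ _
  res_comp := by
    intro _ _ _ _ _ _ _ _ _ _ _ _ _ _ _ h f g
    exact GHom.restrict_comp _ h _ _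
  res_d := by intros; rfl
  res_refl := by intros; rfl
  res_res := by intros; rfl

/-- No condition on the entries of a multi-index. -/
def anyRel : ι → ι → Prop := fun _ _ => True

/-- Graded sheaves `E_i` of `R`-modules on the `U_i`, and `a = ∑_{k ≥ 0} a^{k,1-k}` with
`a^{k,1-k}_{i_0 … i_k} : E_{i_k} → E_{i_0}` of degree `1 - k` over `U_{i_0 … i_k}`, subject to the
Maurer-Cartan equation `δ a + a · a = 0`. -/
structure PreTwisted where
  E : ∀ i, (cechSystem.{u, v, w} R U).Ob i
  a : (cechSystem R U).Cochain anyRel E E 1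
  mc : (cechSystem R U).delta (m' := 2) (by omega) a +
    (cechSystem R U).mul (m := 2) (by omega) a a = 0

variable {R U}

namespace PreTwisted

/-- The complex `(E_i, a^{0,1}_i)` on `U_i`. -/
def cplx (T : PreTwisted.{u, v, w} R U) (i : ι) : Cplx.{u, v, w} R (U i) where
  E := T.E i
  d := T.a.ev (k := 0) (q := 1) (by omega) (Simplex.vertex anyRel i trivial)
    ((cechSystem R U).le_region_vertex trivial)
  d_comp_d := by
    have h := congrArg (fun c => CoeffSystem.Cochain.ev c (k := 0) (q := 2) (by omega)
      (Simplex.vertex anyRel i trivial) ((cechSystem R U).le_region_vertex trivial)) T.mc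
    replace h : CoeffSystem.Cochain.ev (S := cechSystem.{u, v, w} R U) _ _ _ _ =
      CoeffSystem.Cochain.ev 0 _ _ _ := h
    rw [CoeffSystem.ev_add, CoeffSystem.ev_delta_zero, zero_add, CoeffSystem.ev_mul, asum_zero,
      CoeffSystem.ev_zero] at h
    have e : ((1 - ((0 : ℕ) : ℤ)) * ((0 : ℕ) : ℤ)).negOnePow = 1 := rfl
    rw [e, one_smul] at h
    exact h

/-- The map `a^{1,0}_{i_0 i_1}` over `U_{i_0 i_1}` is invertible up to homotopy, as a chain map
between the restrictions of the complexes `(E_i, a^{0,1}_i)`. -/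
def InvertibleAt (T : PreTwisted.{u, v, w} R U) {i j : ι} (s : Simplex anyRel 1 i j) : Prop :=
  (cpx.{u, v, w} R ((cechSystem.{u, v, w} R U).region s)).IsHtpyInvertible (p := 0) rfl
    (X := (T.cplx j).restrict ((cechSystem.{u, v, w} R U).region_last s))
    (Y := (T.cplx i).restrict ((cechSystem.{u, v, w} R U).region_first s)) (T.a 1 0 (by omega) i j s)

/-- The non-degeneracy condition: every `a^{1,0}_{i i}` is invertible up to homotopy. -/
def Nondegenerate (T : PreTwisted.{u, v, w} R U) : Prop :=
  ∀ (i : ι) (s : Simplex anyRel 1 i i), T.InvertibleAt s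

/-- All `a^{1,0}_{i i}` are identities, and all `a^{k,1-k}_{i_0 … i_k}` with `k ≥ 2` and two equal
neighbours among the indices vanish. -/
def IsNormalized (T : PreTwisted.{u, v, w} R U) : Prop :=
  (∀ (i : ι) (s : Simplex anyRel 1 i i), T.a 1 0 (by omega) i i s =
    GHom.one (fun n => (T.E i n).restrict ((cechSystem R U).region_first s))) ∧
  ∀ (k : ℕ) (q : ℤ) (h : k + q = 1) (i j : ι) (s : Simplex anyRel k i j), 2 ≤ k →
    (∃ l : Fin k, s.v l.castSucc = s.v l.succ) → T.a k q h i j s = 0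

end PreTwisted

variable (R U)

/-- A twisted complex. -/
structure TwistedComplex extends PreTwisted.{u, v, w} R U where
  nondeg : toPreTwisted.Nondegenerate

/-- The dg-category `Tw(X, R, U)` of twisted complexes: the morphisms are all cochains, their
composition is the shuffled multiplication, and the differential of `φ : (E, a) → (F, b)` is
`δ φ + b · φ - (-1) ^ |φ| φ · a`. -/
def Tw : DGCat :=
  ((cechSystem.{u, v, w} R U).cochains anyRel).twist (Ob' := TwistedComplex.{u, v, w} R U)
    (fun T => T.E) (fun T => T.a) (fun T => by
      have h : (cechSystem R U).inner (m' := 2) (by omega) T.a = 0 := by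
        funext k q h i j s
        exact smul_zero ((k : ℤ).negOnePow)
      exact (congrArg (· + (cechSystem R U).mul (m := 2) (by omega) T.a T.a)
        ((congrArg (· + (cechSystem R U).delta (m' := 2) (by omega) T.a) h).trans
          (zero_add _))).trans T.mc)

end Twisted

/-! ### The simplicial resolution and the totalization -/

section Totalization

/-- The constant system with value the dg-category `B`, on the vertices `0, …, n`. -/
def constSystem (B : DGCat.{u, v}) (n : ℕ) : CoeffSystem (Fin (n + 1)) PUnit.{1} where
  dom _ := PUnit.unit
  inter _ := PUnit.unit
  inter_le _ _ := le_rfl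
  le_inter _ _ _ := le_rfl
  cat _ := B
  Ob _ := B.Ob
  obj _ E := E
  res {_ _ _ _} _ {_ _ _ _ _} f := f
  res_add := by intros; rfl
  res_one := by intros; rfl
  res_comp := by intros; rfl
  res_d := by intros; rfl
  res_refl := by intros; rfl
  res_res := by intros; rfl

/-- The order relation on the vertices `0, …, n`: the multi-indices are the weakly increasing
ones. -/
def leRel (n : ℕ) : Fin (n + 1) → Fin (n + 1) → Prop := fun i j => i ≤ j

/-- The dg-category of all families `φ^{k,q}_{i_0 … i_k} : E_{i_k} → F_{i_0}` of morphisms of `B`,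
indexed by `0 ≤ i_0 ≤ … ≤ i_k ≤ n`, with the differential `D` and the shuffled multiplication. -/
def simplexCochains (B : DGCat.{u, v}) (n : ℕ) : DGCat.{u, v} :=
  (constSystem B n).cochains (leRel n)

/-- An object of `Δ_n(B)`: objects `E_0, …, E_n` of `B` and `φ^{k,1-k}_{i_0 … i_k} : E_{i_k} →
E_{i_0}` of degree `1 - k` for `k ≥ 1` and `0 ≤ i_0 ≤ … ≤ i_k ≤ n`, subject to the Maurer-Cartan
equation `D φ + φ · φ = 0`, with all `φ^{1,0}_{i j}` (including `i = j`) homotopy invertible. The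
components with `k = 0` are not part of the data and are set to `0`. -/
structure SimplexObj (B : DGCat.{u, v}) (n : ℕ) where
  E : ∀ i, (constSystem B n).Ob i
  φ : (constSystem B n).Cochain (leRel n) E E 1
  φ_zero : ∀ (q : ℤ) (h : (0 : ℕ) + q = 1) (i j : Fin (n + 1)) (s : Simplex (leRel n) 0 i j),
    φ 0 q h i j s = 0
  mc : (constSystem B n).inner (m' := 2) (by omega) φ +
    (constSystem B n).delta (m' := 2) (by omega) φ +
    (constSystem B n).mul (m := 2) (by omega) φ φ = 0
  inv : ∀ (i j : Fin (n + 1)) (s : Simplex (leRel n) 1 i j),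
    B.IsHtpyInvertible (p := 0) rfl (X := E j) (Y := E i) (φ 1 0 (by omega) i j s)

/-- All `φ^{1,0}_{i i}` are identities, and all `φ^{k,1-k}_{i_0 … i_k}` with `k ≥ 2` and a repeated
index vanish. -/
def SimplexObj.IsNormalized {B : DGCat.{u, v}} {n : ℕ} (x : SimplexObj B n) : Prop :=
  (∀ (i : Fin (n + 1)) (s : Simplex (leRel n) 1 i i), x.φ 1 0 (by omega) i i s = B.one (x.E i)) ∧
  ∀ (k : ℕ) (q : ℤ) (h : k + q = 1) (i j : Fin (n + 1)) (s : Simplex (leRel n) k i j), 2 ≤ k →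
    ¬ Function.Injective s.v → x.φ k q h i j s = 0

/-- The dg-category `Δ_n(B)`: the differential of `θ : (E, φ) → (F, ψ)` of degree `m` is
`D θ + ψ · θ - (-1) ^ m θ · φ`. -/
def simplexCat (B : DGCat.{u, v}) (n : ℕ) : DGCat.{max u v, v} :=
  (simplexCochains B n).twist (Ob' := SimplexObj B n) SimplexObj.E SimplexObj.φ SimplexObj.mc

/-- A dg-functor induces a dg-functor between the dg-categories of cochains. -/
def cochainsMap {B C : DGCat.{u, v}} (F : DGFunctor B C) (n : ℕ) :
    DGFunctor (simplexCochains B n) (simplexCochains C n) where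
  obj E i := F.obj (E i)
  map φ k q h i j s := F.map (φ k q h i j s)
  map_add φ ψ := by
    funext k q h i j s
    exact F.map_add _ _
  map_one E := by
    funext k q h i j s
    by_cases hk : k = 0
    · subst hk
      obtain rfl := s.first_eq_last rfl
      obtain rfl : q = 0 := by omega
      exact F.map_one _
    · change F.map ((constSystem B n).oneCochain E k q h i j s) =
        (constSystem C n).oneCochain (fun i => F.obj (E i)) k q h i j s
      unfold CoeffSystem.oneCochain
      rw [dif_neg hk, dif_neg hk]
      exact F.map_zero
  map_comp {E E' E'' _ _ _} e φ η := by
    funext k q h i j s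
    change F.map ((constSystem B n).mul e φ η k q h i j s) = (constSystem C n).mul
      (E := fun i => F.obj (E i)) (F := fun i => F.obj (E' i)) (G := fun i => F.obj (E'' i)) e
      (fun k q h i j s => F.map (φ k q h i j s)) (fun k q h i j s => F.map (η k q h i j s))
      k q h i j s
    unfold CoeffSystem.mul asum
    refine (F.map_sum _ _).trans (Finset.sum_congr rfl fun x _ => ?_)
    exact (F.map_smul _ _).trans (congrArg _ (F.map_comp _ _ _))
  map_d e φ := by
    funext k q h i j s
    refine (F.map_add _ _).trans (congrArg₂ (· + ·) ?_ ?_)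
    · exact (F.map_smul _ _).trans (congrArg _ (F.map_d _ _))
    · rcases k with _ | k
      · exact F.map_zero
      · exact (F.map_sum _ _).trans (Finset.sum_congr rfl fun x _ => F.map_smul _ _)

/-- The multi-index `(σ(i_0), …, σ(i_k))`. -/
def Simplex.mapOrder {n m k : ℕ} (σ : Fin (n + 1) →o Fin (m + 1)) {i j : Fin (n + 1)}
    (s : Simplex (leRel n) k i j) : Simplex (leRel m) k (σ i) (σ j) where
  v x := σ (s.v x)
  adm l l' h := σ.monotone (s.adm l l' h)
  first := congrArg σ s.first
  last := congrArg σ s.last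

/-- A monotone map `σ : [n] → [m]` induces a dg-functor between the dg-categories of cochains. -/
def cochainsPull (B : DGCat.{u, v}) {n m : ℕ} (σ : Fin (n + 1) →o Fin (m + 1)) :
    DGFunctor (simplexCochains B m) (simplexCochains B n) where
  obj E i := E (σ i)
  map φ k q h i j s := φ k q h (σ i) (σ j) (s.mapOrder σ)
  map_add φ ψ := rfl
  map_one E := by
    funext k q h i j s
    by_cases hk : k = 0
    · subst hk
      obtain rfl := s.first_eq_last rfl
      rfl
    · change (constSystem B m).oneCochain E k q h _ _ (s.mapOrder σ) =
        (constSystem B n).oneCochain (fun i => E (σ i)) k q h i j s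
      unfold CoeffSystem.oneCochain
      rw [dif_neg hk, dif_neg hk]
      rfl
  map_comp e φ η := rfl
  map_d e φ := by
    funext k q h i j s
    rcases k with _ | k <;> rfl

lemma DGFunctor.map_mc {A : DGCat.{u, v}} {B : DGCat.{w, t}} (F : DGFunctor A B) {X : A.Ob}
    (α : A.Hom X X 1)
    (h : A.d (q := 2) (by omega) α + A.comp (by omega) α α = 0) :
    B.d (q := 2) (by omega) (F.map α) + B.comp (by omega) (F.map α) (F.map α) = 0 := by
  rw [← F.map_d, ← F.map_comp, ← F.map_add, h, F.map_zero]

/-- The dg-functor `Δ_n(F) : Δ_n(B) → Δ_n(C)` of a dg-functor `F : B → C`. -/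
def simplexMap {B C : DGCat.{u, v}} (F : DGFunctor B C) (n : ℕ) :
    DGFunctor (simplexCat B n) (simplexCat C n) where
  obj (x : SimplexObj _ _) := show SimplexObj _ _ from
    { E := fun i => F.obj (x.E i)
      φ := fun k q h i j s => F.map (x.φ k q h i j s)
      φ_zero := fun q h i j s => (congrArg F.map (x.φ_zero q h i j s)).trans F.map_zero
      mc := (cochainsMap F n).map_mc (X := x.E) x.φ x.mc
      inv := fun i j s => F.map_isHtpyInvertible rfl _ (x.inv i j s) }
  map {x y p} θ := (cochainsMap F n).map (X := SimplexObj.E x) (Y := SimplexObj.E y) θ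
  map_add θ θ' := (cochainsMap F n).map_add _ _
  map_one x := (cochainsMap F n).map_one _
  map_comp e θ θ' := (cochainsMap F n).map_comp e _ _
  map_d {x y p q} e θ := by
    refine ((cochainsMap F n).map_sub _ _).trans (congrArg₂ (· - ·) ?_ ?_)
    · exact ((cochainsMap F n).map_add _ _).trans (congrArg₂ (· + ·)
        ((cochainsMap F n).map_d _ _) ((cochainsMap F n).map_comp _ _ _))
    · exact ((cochainsMap F n).map_smul _ _).trans (congrArg _ ((cochainsMap F n).map_comp _ _ _))

/-- The dg-functor `σ^* : Δ_m(B) → Δ_n(B)` of a monotone map `σ : [n] → [m]`. -/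
def simplexPull (B : DGCat.{u, v}) {n m : ℕ} (σ : Fin (n + 1) →o Fin (m + 1)) :
    DGFunctor (simplexCat B m) (simplexCat B n) where
  obj (x : SimplexObj _ _) := show SimplexObj _ _ from
    { E := fun i => x.E (σ i)
      φ := fun k q h i j s => x.φ k q h (σ i) (σ j) (s.mapOrder σ)
      φ_zero := fun q h i j s => x.φ_zero q h _ _ _
      mc := (cochainsPull B σ).map_mc (X := x.E) x.φ x.mc
      inv := fun i j s => x.inv _ _ (s.mapOrder σ) }
  map {x y p} θ := (cochainsPull B σ).map (X := SimplexObj.E x) (Y := SimplexObj.E y) θ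
  map_add θ θ' := (cochainsPull B σ).map_add _ _
  map_one x := (cochainsPull B σ).map_one _
  map_comp e θ θ' := (cochainsPull B σ).map_comp e _ _
  map_d {x y p q} e θ := by
    refine ((cochainsPull B σ).map_sub _ _).trans (congrArg₂ (· - ·) ?_ ?_)
    · exact ((cochainsPull B σ).map_add _ _).trans (congrArg₂ (· + ·)
        ((cochainsPull B σ).map_d _ _) ((cochainsPull B σ).map_comp _ _ _))
    · exact ((cochainsPull B σ).map_smul _ _).trans
        (congrArg _ ((cochainsPull B σ).map_comp _ _ _))

variable (B : CosimplicialObject DGCat.{u, v})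

/-- `∏_{[n]} Δ_n(B^n)`. -/
def totSource : DGCat.{max u v, v} := DGCat.pi fun n : SimplexCategory => simplexCat (B.obj n) n.len

/-- `∏_{σ : [n] → [m]} Δ_n(B^m)`. -/
def totTarget : DGCat.{max u v, v} :=
  DGCat.pi fun σ : (Σ n m : SimplexCategory, n ⟶ m) => simplexCat (B.obj σ.2.1) σ.1.len

/-- The dg-functor with the components `Δ_n(σ_*) : Δ_n(B^n) → Δ_n(B^m)`. -/
def totLeft : DGFunctor (totSource B) (totTarget B) :=
  DGCat.piMap (fun σ => σ.1) fun σ => simplexMap (B.map σ.2.2) σ.1.len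

/-- The dg-functor with the components `σ^* : Δ_m(B^m) → Δ_n(B^m)`. -/
def totRight : DGFunctor (totSource B) (totTarget B) :=
  DGCat.piMap (fun σ => σ.2.1) fun σ => simplexPull (B.obj σ.2.1) σ.2.2.toOrderHom

/-- The totalization of a cosimplicial dg-category. -/
def Tot : DGCat.{max u v, v} := DGCat.equalizer (totLeft B) (totRight B)

namespace Tot

variable {B}

/-- The component in `Δ_n(B^n)` of an object of the totalization. -/
def simplexObj (x : (Tot B).Ob) (n : SimplexCategory) : SimplexObj (B.obj n) n.len := x.1 n

/-- The object `E_i` of `B^n` that belongs to an object of the totalization. -/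
def vertex (x : (Tot B).Ob) (n : SimplexCategory) (i : Fin (n.len + 1)) : (B.obj n).Ob :=
  (simplexObj x n).E i

/-- The morphism `φ^{k,q}_{i_0 … i_k}` of `B^n` that belongs to an object of the totalization. -/
def phi (x : (Tot B).Ob) (n : SimplexCategory) (k : ℕ) (q : ℤ) (h : k + q = 1)
    {i j : Fin (n.len + 1)} (s : Simplex (leRel n.len) k i j) :
    (B.obj n).Hom (vertex x n j) (vertex x n i) q :=
  (simplexObj x n).φ k q h i j s

/-- The morphism `θ^{k,q}_{i_0 … i_k}` of `B^n` that belongs to a morphism `θ` of degree `m` of the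
totalization. -/
def theta {x y : (Tot B).Ob} {m : ℤ} (θ : (Tot B).Hom x y m) (n : SimplexCategory) (k : ℕ) (q : ℤ)
    (h : k + q = m) {i j : Fin (n.len + 1)} (s : Simplex (leRel n.len) k i j) :
    (B.obj n).Hom (vertex x n j) (vertex y n i) q :=
  (show (constSystem (B.obj n) n.len).Cochain (leRel n.len) _ _ m from θ.1 n) k q h i j s

end Tot

end Totalization

/-! ### Comparison of the data -/

section Comparison

variable {X : TopCat.{u}} {R : X.Sheaf RingCat.{v}} {ι : Type t} {U : ι → Opens X}

/-- The multi-index `(α(i_0), …, α(i_k))`. -/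
def Simplex.relabel {n k : ℕ} (α : Fin (n + 1) → ι) {i j : Fin (n + 1)}
    (s : Simplex (leRel n) k i j) : Simplex (anyRel (ι := ι)) k (α i) (α j) where
  v x := α (s.v x)
  adm _ _ _ := trivial
  first := congrArg α s.first
  last := congrArg α s.last

/-- The objects of `Cpx(N_n)` attached to `T`: the `i`-th one is, over `U_{α_0 … α_n}`, the
restriction of the complex `(E_{α_i}, a^{0,1}_{α_i})`. -/
def PreTwisted.vertices (T : PreTwisted.{u, v, w} R U) (n : ℕ) (i : Fin (n + 1)) :
    (nerveCat.{u, v, w} R U n).Ob :=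
  fun α => (T.cplx (α i)).restrict fun _ hx => hx i

/-- The morphisms of `Cpx(N_n)` attached to a Čech cochain `c`: the one at `(i_0, …, i_k)` is, over
`U_{α_0 … α_n}`, the restriction of `c_{α_{i_0} … α_{i_k}}`. -/
def spread {T T' : PreTwisted.{u, v, w} R U} {m : ℤ}
    (c : (cechSystem.{u, v, w} R U).Cochain anyRel T.E T'.E m) (n k : ℕ) (q : ℤ) (h : k + q = m)
    {i j : Fin (n + 1)} (s : Simplex (leRel n) k i j) :
    (nerveCat.{u, v, w} R U n).Hom (T.vertices n j) (T'.vertices n i) q :=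
  fun α => c.ev h (s.relabel α) (W := inter U α) fun _ hx l => hx (s.v l)

end Comparison

end TwTot

/-!
Splitting off `a^{0,1}` turns each `(E_i, a_i^{0,1})` into a complex, and makes commutation with
`a^{0,1}` the inner differential of the cochains. The equation `δ a + a · a = 0` thereby becomes
the equation `D φ + φ · φ = 0` for the remaining components, and the differential of `Tw` becomes
the one of `Δ_n`. A Čech cochain is then the same as a family of simplicial cochains compatible
with all monotone maps `[n] → [n']`, since such a family is determined by its components at the
multi-indices `(0, …, k)`.

The degree-two part of the Maurer-Cartan equation says that `a_{ij} a_{jk}` and `a_{ik}` are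
homotopic, so that `a_{ij} a_{ji}` and `a_{ji} a_{ij}` are homotopic to `a_{ii}` and `a_{jj}`;
hence `a_{ij}` is invertible up to homotopy as soon as all `a_{ii}` are.
-/

namespace TwTot

namespace DGCat

section Homotopy

variable {B : DGCat.{u, v}} {X Y Z : B.Ob}

/-- Two morphisms of degree `0` are homotopic if their difference is a coboundary. -/
def Homotopic (f g : B.Hom X Y 0) : Prop :=
  ∃ h : B.Hom X Y (-1), f - g = B.d (by omega) h

lemma Homotopic.symm {f g : B.Hom X Y 0} (h : Homotopic f g) : Homotopic g f := by
  obtain ⟨h, e⟩ := h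
  refine ⟨-h, ?_⟩
  rw [← neg_sub, e]
  exact (map_neg (B.dHom _) h).symm

lemma Homotopic.trans {f g k : B.Hom X Y 0} (h : Homotopic f g) (h' : Homotopic g k) :
    Homotopic f k := by
  obtain ⟨h, e⟩ := h
  obtain ⟨h', e'⟩ := h'
  exact ⟨h + h', by rw [B.d_add, ← e, ← e', sub_add_sub_cancel]⟩

lemma Homotopic.comp_left {f g : B.Hom X Y 0} (h : Homotopic f g) {k : B.Hom Y Z 0}
    (hk : B.d (q := 1) (by omega) k = 0) :
    Homotopic (B.comp (r := 0) (by omega) k f) (B.comp (by omega) k g) := by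
  obtain ⟨h, e⟩ := h
  refine ⟨B.comp (by omega) k h, ?_⟩
  rw [B.d_comp (p' := 1) (q' := 0) _ (by omega) (by omega) _ (by omega) (by omega), hk,
    B.zero_comp, ← B.comp_sub, e]
  exact ((zero_add _).trans (one_smul ℤˣ _)).symm

lemma Homotopic.comp_right {f g : B.Hom Y Z 0} (h : Homotopic f g) {k : B.Hom X Y 0}
    (hk : B.d (q := 1) (by omega) k = 0) :
    Homotopic (B.comp (r := 0) (by omega) f k) (B.comp (by omega) g k) := by
  obtain ⟨h, e⟩ := h
  refine ⟨B.comp (by omega) h k, ?_⟩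
  rw [B.d_comp (p' := 0) (q' := 1) _ (by omega) (by omega) _ (by omega) (by omega), hk,
    B.comp_zero, smul_zero, ← B.sub_comp, e]
  exact (add_zero _).symm

lemma Homotopic.d_eq {f g : B.Hom X Y 0} (h : Homotopic f g) :
    B.d (q := 1) (by omega) f = B.d (by omega) g := by
  obtain ⟨h, e⟩ := h
  rw [← sub_eq_zero, ← B.d_sub, e, B.d_d]

lemma d_comp_eq_zero {f : B.Hom Y Z 0} {g : B.Hom X Y 0} (hf : B.d (q := 1) (by omega) f = 0)
    (hg : B.d (q := 1) (by omega) g = 0) :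
    B.d (q := 1) (by omega) (B.comp (r := 0) (by omega) f g) = 0 := by
  rw [B.d_comp (p' := 1) (q' := 1) _ (by omega) (by omega) _ (by omega) (by omega), hf, hg,
    B.zero_comp, B.comp_zero, smul_zero, add_zero]

lemma isHtpyInvertible_of_left_right {f : B.Hom X Y 0} {g g' : B.Hom Y X 0}
    (hf : B.d (q := 1) (by omega) f = 0) (hg : B.d (q := 1) (by omega) g = 0)
    (hg' : B.d (q := 1) (by omega) g' = 0)
    (hr : Homotopic (B.comp (by omega) f g) (B.one Y))
    (hl : Homotopic (B.comp (by omega) g' f) (B.one X)) : B.IsHtpyInvertible rfl f := by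
  have hgg' : Homotopic g g' := by
    have h₁ := hl.comp_right hg
    have h₂ := hr.comp_left hg'
    rw [B.one_comp, B.comp_assoc (qr := 0) (by omega) (by omega) (by omega) (by omega)] at h₁
    rw [B.comp_one] at h₂
    exact h₁.symm.trans h₂
  exact ⟨hf, g, hg, hr, (hgg'.comp_right hf).trans hl⟩

lemma IsHtpyInvertible.of_homotopic {f g : B.Hom X Y 0} (hg : B.IsHtpyInvertible rfl g)
    (h : Homotopic f g) : B.IsHtpyInvertible rfl f := by
  obtain ⟨dg, g', dg', hgg', hg'g⟩ := hg
  exact ⟨h.d_eq.trans dg, g', dg', (h.comp_right dg').trans hgg', (h.comp_left dg').trans hg'g⟩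

lemma isHtpyInvertible_of_comp {f : B.Hom X Y 0} {g : B.Hom Y X 0}
    (hf : B.d (q := 1) (by omega) f = 0) (hg : B.d (q := 1) (by omega) g = 0)
    (hfg : B.IsHtpyInvertible rfl (B.comp (r := 0) (by omega) f g))
    (hgf : B.IsHtpyInvertible rfl (B.comp (r := 0) (by omega) g f)) :
    B.IsHtpyInvertible rfl f := by
  obtain ⟨-, a, ha, hr, -⟩ := hfg
  obtain ⟨-, b, hb, -, hl⟩ := hgf
  refine isHtpyInvertible_of_left_right hf (d_comp_eq_zero hg ha) (d_comp_eq_zero hb hg) ?_ ?_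
  · rwa [← B.comp_assoc (pq := 0) (by omega) (by omega) (by omega) (by omega)]
  · rwa [B.comp_assoc (qr := 0) (by omega) (by omega) (by omega) (by omega)]

lemma pi_isHtpyInvertible_iff {κ : Type t} {A : κ → DGCat.{u, v}} {X Y : (pi A).Ob}
    {f : (pi A).Hom X Y 0} :
    (pi A).IsHtpyInvertible rfl f ↔ ∀ i, (A i).IsHtpyInvertible (p := 0) rfl (f i) := by
  constructor
  · rintro ⟨hf, g, hg, ⟨h, e⟩, ⟨h', e'⟩⟩ i
    exact ⟨congrFun hf i, g i, congrFun hg i, ⟨h i, congrFun e i⟩, ⟨h' i, congrFun e' i⟩⟩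
  · intro H
    choose hf g hg hr hl using H
    choose h e using hr
    choose h' e' using hl
    exact ⟨funext hf, g, funext hg, ⟨h, funext e⟩, ⟨h', funext e'⟩⟩

end Homotopy

end DGCat

instance Simplex.subsingleton_zero {V : Type t} {rel : V → V → Prop} {a b : V} :
    Subsingleton (Simplex rel 0 a b) where
  allEq s s' := Simplex.ext <| funext <| Fin.forall_fin_one.2 (s.first.trans s'.first.symm)

instance Simplex.subsingleton_one {V : Type t} {rel : V → V → Prop} {a b : V} :
    Subsingleton (Simplex rel 1 a b) where
  allEq s s' := Simplex.ext <| funext <| Fin.forall_fin_two.2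
    ⟨s.first.trans s'.first.symm, s.last.trans s'.last.symm⟩

namespace CoeffSystem

variable {V : Type t} {L : Type w} [Preorder L] {S : CoeffSystem.{u, v} V L}
  {rel : V → V → Prop} {E F G : ∀ a, S.Ob a} {m : ℤ}

/-- The Maurer-Cartan equation `D φ + φ · φ = 0` for a cochain of degree `1`. -/
def IsMaurerCartan (φ : S.Cochain rel E E 1) : Prop :=
  S.inner (m' := 2) (by omega) φ + S.delta (m' := 2) (by omega) φ +
    S.mul (m := 2) (by omega) φ φ = 0

/-- A cochain is reduced if its components at the one-entry multi-indices vanish; the structure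
cochains of the objects of `Δ_n(B)` are the reduced Maurer-Cartan cochains. -/
def Cochain.IsReduced (φ : S.Cochain rel E F m) : Prop :=
  ∀ (q : ℤ) (h : (0 : ℕ) + q = m) (a b : V) (s : Simplex rel 0 a b), φ 0 q h a b s = 0

/-- A cochain of degree `1` is invertible if its components of bidegree `(1, 0)` are invertible up
to homotopy. -/
def Cochain.IsInvertible (φ : S.Cochain rel E E 1) : Prop :=
  ∀ (a b : V) (s : Simplex rel 1 a b),
    (S.cat (S.region s)).IsHtpyInvertible (p := 0) rfl (X := S.obj (S.region_last s) (E b))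
      (Y := S.obj (S.region_first s) (E a)) (φ 1 0 (by omega) a b s)

lemma Cochain.IsReduced.ev_eq_zero {φ : S.Cochain rel E F m} (hφ : φ.IsReduced) {q : ℤ}
    (h : (0 : ℕ) + q = m) {a b : V} (s : Simplex rel 0 a b) {W : L} (hW : W ≤ S.region s) :
    φ.ev h s hW = 0 :=
  (congrArg (S.res hW) (hφ q h a b s)).trans (S.res_zero hW)

section LowDegrees

variable {φ : S.Cochain rel E E 1} {a b c : V} {W : L}

lemma IsMaurerCartan.ev_eq_zero (hφ : IsMaurerCartan φ) {k : ℕ} {q : ℤ} (h : k + q = 2)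
    (s : Simplex rel k a b) (hW : W ≤ S.region s) :
    (S.inner (m' := 2) (by omega) φ).ev h s hW + (S.delta (m' := 2) (by omega) φ).ev h s hW +
      (S.mul (m := 2) (by omega) φ φ).ev h s hW = 0 := by
  rw [← ev_add, ← ev_add, hφ, ev_zero]

lemma IsMaurerCartan.d_ev_one (hφ : IsMaurerCartan φ) (h₀ : φ.IsReduced) (s : Simplex rel 1 a b)
    (hW : W ≤ S.region s) :
    (S.cat W).d (q := 1) (by omega) (φ.ev (q := 0) (by omega) s hW) = 0 := by
  have h := hφ.ev_eq_zero (q := 1) (by omega) s hW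
  have delta_eq : (S.delta (m' := 2) (by omega) φ).ev (q := 1) (by omega) s hW = 0 := by
    rw [ev_delta_succ _ _ _ (q := 1) (by omega), Fin.sum_univ_zero]
  have mul_eq : (S.mul (m := 2) (by omega) φ φ).ev (q := 1) (by omega) s hW = 0 := by
    rw [ev_mul, asum_succ, asum_zero, h₀.ev_eq_zero, h₀.ev_eq_zero, DGCat.zero_comp,
      DGCat.comp_zero, smul_zero, smul_zero, add_zero]
  rw [ev_inner _ _ _ (q := 0) (by omega), delta_eq, mul_eq, add_zero, add_zero] at h
  exact (smul_eq_zero_iff_eq _).1 h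

/-- The Maurer-Cartan equation at `(i, j, k)` reads `φ_{ij} ∘ φ_{jk} - φ_{ik} = -d φ_{ijk}`. -/
lemma IsMaurerCartan.comp_homotopic (hφ : IsMaurerCartan φ) (h₀ : φ.IsReduced)
    (s : Simplex rel 2 a b) (hW : W ≤ S.region s) :
    DGCat.Homotopic (B := S.cat W)
      ((S.cat W).comp (by omega)
        (φ.ev (q := 0) (by omega) (s.front (p := 1) (r := 1) rfl) (hW.trans (S.region_front s _)))
        (φ.ev (q := 0) (by omega) (s.back (p := 1) (r := 1) rfl) (hW.trans (S.region_back s _))))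
      (φ.ev (by omega) (s.skip 0) (hW.trans (S.region_skip s 0))) := by
  have h := hφ.ev_eq_zero (q := 0) (by omega) s hW
  have delta_eq : (S.delta (m' := 2) (by omega) φ).ev (q := 0) (by omega) s hW =
      -φ.ev (by omega) (s.skip 0) (hW.trans (S.region_skip s 0)) := by
    rw [ev_delta_succ _ _ _ (q := 0) (by omega), Fin.sum_univ_one]
    exact (Units.neg_smul 1 _).trans (congrArg _ (one_smul ℤˣ _))
  have mul_eq : (S.mul (m := 2) (by omega) φ φ).ev (q := 0) (by omega) s hW =
      (S.cat W).comp (by omega)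
        (φ.ev (q := 0) (by omega) (s.front (p := 1) (r := 1) rfl) (hW.trans (S.region_front s _)))
        (φ.ev (q := 0) (by omega) (s.back (p := 1) (r := 1) rfl)
          (hW.trans (S.region_back s _))) := by
    rw [ev_mul, asum_succ, asum_succ', asum_zero, h₀.ev_eq_zero, h₀.ev_eq_zero, DGCat.zero_comp,
      DGCat.comp_zero, smul_zero, smul_zero, zero_add, zero_add]
    exact one_smul ℤˣ _
  rw [ev_inner _ _ _ (q := -1) (by omega), delta_eq, mul_eq, add_assoc] at h
  refine DGCat.Homotopic.symm ⟨φ.ev (q := -1) (by omega) s hW, Eq.trans ?_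
    ((eq_neg_of_add_eq_zero_left h).symm.trans (one_smul ℤˣ _))⟩
  abel

lemma le_region_one (s : Simplex rel 1 a b) (ha : W ≤ S.dom a) (hb : W ≤ S.dom b) :
    W ≤ S.region s :=
  S.le_inter _ <| Fin.forall_fin_two.2
    ⟨ha.trans_eq (congrArg S.dom s.first.symm), hb.trans_eq (congrArg S.dom s.last.symm)⟩

lemma IsMaurerCartan.comp_homotopic_of_eq (hφ : IsMaurerCartan φ) (h₀ : φ.IsReduced)
    (t : Simplex rel 2 a b) (ht : t.v 1 = c) (s : Simplex rel 1 a c) (s' : Simplex rel 1 c b)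
    (r : Simplex rel 1 a b) (ha : W ≤ S.dom a) (hb : W ≤ S.dom b) (hc : W ≤ S.dom c) :
    DGCat.Homotopic (B := S.cat W)
      ((S.cat W).comp (by omega) (φ.ev (q := 0) (by omega) s (le_region_one s ha hc))
        (φ.ev (q := 0) (by omega) s' (le_region_one s' hc hb)))
      (φ.ev (by omega) r (le_region_one r ha hb)) := by
  subst ht
  have hW : W ≤ S.region t := S.le_inter _ fun x => by
    fin_cases x
    exacts [ha.trans_eq (congrArg S.dom t.first.symm), hc,
      hb.trans_eq (congrArg S.dom t.last.symm)]
  obtain rfl : s = t.front (p := 1) (r := 1) rfl := Subsingleton.elim _ _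
  obtain rfl : s' = t.back (p := 1) (r := 1) rfl := Subsingleton.elim _ _
  obtain rfl : r = t.skip 0 := Subsingleton.elim _ _
  exact hφ.comp_homotopic h₀ t hW

lemma IsMaurerCartan.isHtpyInvertible_ev (hφ : IsMaurerCartan φ) (h₀ : φ.IsReduced)
    {s : Simplex rel 1 a b} (s' : Simplex rel 1 b a) {r : Simplex rel 1 a a}
    {r' : Simplex rel 1 b b} (t : Simplex rel 2 a a) (ht : t.v 1 = b) (t' : Simplex rel 2 b b)
    (ht' : t'.v 1 = a) (ha : W ≤ S.dom a) (hb : W ≤ S.dom b)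
    (hr : (S.cat W).IsHtpyInvertible rfl (φ.ev (q := 0) (by omega) r (le_region_one r ha ha)))
    (hr' : (S.cat W).IsHtpyInvertible rfl (φ.ev (q := 0) (by omega) r' (le_region_one r' hb hb))) :
    (S.cat W).IsHtpyInvertible rfl (φ.ev (q := 0) (by omega) s (le_region_one s ha hb)) :=
  DGCat.isHtpyInvertible_of_comp (hφ.d_ev_one h₀ _ _) (hφ.d_ev_one h₀ s' (le_region_one s' hb ha))
    (hr.of_homotopic (hφ.comp_homotopic_of_eq h₀ t ht s s' r ha ha hb))
    (hr'.of_homotopic (hφ.comp_homotopic_of_eq h₀ t' ht' s' s r' hb hb ha))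

end LowDegrees

end CoeffSystem

namespace CoeffSystem

variable {V : Type t} {L : Type w} [Preorder L]

/-- Morphisms `δ` of degree `1` and square zero on all restrictions of the objects of a system of
dg-categories, compatible with restriction, such that the differential is the graded commutator
with `δ`. Absorbing `δ` into the cochains turns the Maurer-Cartan equation `D φ + φ · φ = 0` into
the equation `δ a + a · a = 0` of a twisted complex. -/
structure InnerDifferential (S : CoeffSystem.{u, v} V L) where
  δ : ∀ {a : V} {W : L} (ha : W ≤ S.dom a) (E : S.Ob a),
    (S.cat W).Hom (S.obj ha E) (S.obj ha E) 1
  res_δ : ∀ {a : V} {W W' : L} (hW : W' ≤ W) (ha : W ≤ S.dom a) (E : S.Ob a),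
    S.res hW (δ ha E) = δ (hW.trans ha) E
  d_eq : ∀ {a b : V} {W : L} {ha : W ≤ S.dom a} {hb : W ≤ S.dom b} {E : S.Ob a} {F : S.Ob b}
    {p q : ℤ} (h : p + 1 = q) (f : (S.cat W).Hom (S.obj ha E) (S.obj hb F) p),
    (S.cat W).d h f = (S.cat W).comp (by omega) (δ hb F) f -
      p.negOnePow • (S.cat W).comp h f (δ ha E)
  δ_comp_δ : ∀ {a : V} {W : L} (ha : W ≤ S.dom a) (E : S.Ob a),
    (S.cat W).comp (r := 2) (by omega) (δ ha E) (δ ha E) = 0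

namespace InnerDifferential

variable {S : CoeffSystem.{u, v} V L} (D : S.InnerDifferential) {rel : V → V → Prop}
  {E F : ∀ a, S.Ob a} {a b c : V} {W : L} {m m' : ℤ}

/-- The morphism `δ` from `E_b` to `E_a` for `a = b`, as `CoeffSystem.idOn` for identities. -/
def δOn (E : ∀ a, S.Ob a) (hab : a = b) (ha : W ≤ S.dom a) (hb : W ≤ S.dom b) {q : ℤ}
    (hq : q = 1) : (S.cat W).Hom (S.obj hb (E b)) (S.obj ha (E a)) q := by
  cases hab
  exact hq ▸ D.δ ha (E a)

/-- The cochain of degree `1` with the component `δ` at each one-entry multi-index, and `0` at the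
longer ones. -/
def cochain (rel : V → V → Prop) (E : ∀ a, S.Ob a) : S.Cochain rel E E 1 := fun k q h _ _ s =>
  if hk : k = 0 then
    D.δOn E (s.first_eq_last hk) (S.region_first s) (S.region_last s) (by omega)
  else 0

lemma res_δOn (hab : a = b) {W' : L} (hW : W' ≤ W) (ha : W ≤ S.dom a) (hb : W ≤ S.dom b) {q : ℤ}
    (hq : q = 1) :
    S.res hW (D.δOn E hab ha hb hq) = D.δOn E hab (hW.trans ha) (hW.trans hb) hq := by
  subst hab hq
  exact D.res_δ _ _ _

lemma cochain_zero {q : ℤ} (h : (0 : ℕ) + q = 1) (s : Simplex rel 0 a b) :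
    D.cochain rel E 0 q h a b s =
      D.δOn E (s.first_eq_last rfl) (S.region_first s) (S.region_last s) (by omega) :=
  dif_pos rfl

lemma cochain_of_ne {k : ℕ} (hk : k ≠ 0) {q : ℤ} (h : k + q = 1) (s : Simplex rel k a b) :
    D.cochain rel E k q h a b s = 0 := dif_neg hk

lemma ev_cochain_zero {q : ℤ} (h : (0 : ℕ) + q = 1) (s : Simplex rel 0 a b)
    (hW : W ≤ S.region s) :
    (D.cochain rel E).ev h s hW = D.δOn E (s.first_eq_last rfl) (hW.trans (S.region_first s))
      (hW.trans (S.region_last s)) (by omega) := by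
  rw [Cochain.ev, cochain_zero, res_δOn]

lemma ev_cochain_of_ne {k : ℕ} (hk : k ≠ 0) {q : ℤ} (h : k + q = 1) (s : Simplex rel k a b)
    (hW : W ≤ S.region s) : (D.cochain rel E).ev h s hW = 0 := by
  rw [Cochain.ev, D.cochain_of_ne hk, S.res_zero]

lemma δOn_comp (φ : S.Cochain rel E F m) {k : ℕ} {q q' q₁ r : ℤ} (h : k + q = m) (h' : k + q' = m)
    (hac : a = c) (s : Simplex rel k c b) (s' : Simplex rel k a b) (hs : s.v = s'.v)
    (hW : W ≤ S.region s) (hW' : W ≤ S.region s') (ha : W ≤ S.dom a) (hc : W ≤ S.dom c)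
    (hq : q₁ = 1) (hr : q₁ + q = r) :
    (S.cat W).comp hr (D.δOn F hac ha hc hq) (φ.ev h s hW) =
      (S.cat W).comp (by omega) (D.δ ha (F a)) (φ.ev h' s' hW') := by
  subst hac hq
  obtain rfl : s = s' := Simplex.ext hs
  obtain rfl : q = q' := by omega
  rfl

lemma comp_δOn (φ : S.Cochain rel E F m) {k : ℕ} {q q' q₁ r : ℤ} (h : k + q = m) (h' : k + q' = m)
    (hcb : c = b) (s : Simplex rel k a c) (s' : Simplex rel k a b) (hs : s.v = s'.v)
    (hW : W ≤ S.region s) (hW' : W ≤ S.region s') (hc : W ≤ S.dom c) (hb : W ≤ S.dom b)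
    (hq : q₁ = 1) (hr : q + q₁ = r) :
    (S.cat W).comp hr (φ.ev h s hW) (D.δOn E hcb hc hb hq) =
      (S.cat W).comp (by omega) (φ.ev h' s' hW') (D.δ hb (E b)) := by
  subst hcb hq
  obtain rfl : s = s' := Simplex.ext hs
  obtain rfl : q = q' := by omega
  rfl

lemma δOn_comp_δOn (hac : a = c) (hcb : c = b) (ha : W ≤ S.dom a) (hb : W ≤ S.dom b)
    (hc : W ≤ S.dom c) {q q' r : ℤ} (hq : q = 1) (hq' : q' = 1) (hr : q + q' = r) :
    (S.cat W).comp hr (D.δOn E hac ha hc hq) (D.δOn E hcb hc hb hq') = 0 := by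
  subst hac hcb hq hq' hr
  exact D.δ_comp_δ _ _

lemma ev_cochain_mul (hm : 1 + m = m') (φ : S.Cochain rel E F m) {n : ℕ} {q q' : ℤ}
    (h : n + q = m') (h' : n + q' = m) (s : Simplex rel n a b) (hW : W ≤ S.region s) :
    (S.mul hm (D.cochain rel F) φ).ev h s hW = (n : ℤ).negOnePow • (S.cat W).comp (by omega)
      (D.δ (hW.trans (S.region_first s)) (F a)) (φ.ev h' s hW) := by
  rw [ev_mul, asum_first]
  · rw [ev_cochain_zero]
    refine congrArg₂ (· • ·) (by simp) (D.δOn_comp φ _ h' s.first.symm _ s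
      (funext fun x => congrArg s.v (Fin.ext (zero_add _))) _ hW _ _ _ _)
  · intro p r e hp
    rw [D.ev_cochain_of_ne hp, DGCat.zero_comp, smul_zero]

lemma ev_mul_cochain (hm : m + 1 = m') (φ : S.Cochain rel E F m) {n : ℕ} {q q' : ℤ}
    (h : n + q = m') (h' : n + q' = m) (s : Simplex rel n a b) (hW : W ≤ S.region s) :
    (S.mul hm φ (D.cochain rel E)).ev h s hW = (S.cat W).comp (by omega) (φ.ev h' s hW)
      (D.δ (hW.trans (S.region_last s)) (E b)) := by
  rw [ev_mul, asum_last]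
  · rw [ev_cochain_zero]
    refine Eq.trans (congrArg₂ (· • ·) (by simp) (D.comp_δOn φ _ h' s.last _ s rfl _ hW _ _ _ _))
      (one_smul ℤˣ _)
  · intro p r e hr
    rw [D.ev_cochain_of_ne hr, DGCat.comp_zero, smul_zero]

lemma inner_eq (hm : m + 1 = m') (φ : S.Cochain rel E F m) :
    S.inner hm φ = S.mul (show 1 + m = m' by omega) (D.cochain rel F) φ -
      m.negOnePow • S.mul hm φ (D.cochain rel E) := by
  refine cochain_ext fun k q hq a b s => ?_
  have hk : (k : ℤ) + (m - k) = m := by omega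
  rw [sub_eq_add_neg, ← Units.neg_smul, ev_add, ev_smul, D.ev_cochain_mul _ _ _ hk,
    D.ev_mul_cochain _ _ _ hk, ev_inner _ _ _ hk, D.d_eq, smul_sub, smul_smul, ← Int.negOnePow_add,
    add_sub_cancel, Units.neg_smul, sub_eq_add_neg]

lemma cochain_mul_cochain :
    S.mul (m := 2) (by omega) (D.cochain rel E) (D.cochain rel E) = 0 := by
  refine cochain_ext fun k q hq a b s => ?_
  rw [ev_mul, ev_zero, asum_first]
  · by_cases hk : k = 0
    · subst hk
      rw [ev_cochain_zero, ev_cochain_zero, δOn_comp_δOn, smul_zero]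
    · rw [D.ev_cochain_of_ne hk, DGCat.comp_zero, smul_zero]
  · intro p r e hp
    rw [D.ev_cochain_of_ne hp, DGCat.zero_comp, smul_zero]

lemma delta_cochain : S.delta (m' := 2) (by omega) (D.cochain rel E) = 0 := by
  refine cochain_ext fun k q hq a b s => ?_
  rcases k with _ | k
  · rw [ev_delta_zero, ev_zero]
  · rw [ev_delta_succ _ _ _ (show (k : ℤ) + q = 1 by push_cast at hq; omega), ev_zero]
    refine Finset.sum_eq_zero fun j _ => ?_
    rw [D.ev_cochain_of_ne (Fin.pos j).ne', smul_zero]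

lemma isMaurerCartan_iff (φ : S.Cochain rel E E 1) :
    IsMaurerCartan φ ↔ S.delta (m' := 2) (by omega) (φ + D.cochain rel E) +
      S.mul (m := 2) (by omega) (φ + D.cochain rel E) (φ + D.cochain rel E) = 0 := by
  rw [IsMaurerCartan, D.inner_eq, delta_add, add_mul', mul_add', mul_add', cochain_mul_cochain,
    delta_cochain, Int.negOnePow_one, Units.neg_smul, one_smul]
  refine Eq.congr_left ?_
  abel

lemma twist_d_eq (hm : m + 1 = m') (φ : S.Cochain rel E E 1) (ψ : S.Cochain rel F F 1)
    (θ : S.Cochain rel E F m) :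
    S.inner hm θ + S.delta hm θ + S.mul (show 1 + m = m' by omega) ψ θ -
        m.negOnePow • S.mul hm θ φ =
      S.delta hm θ + S.mul (show 1 + m = m' by omega) (ψ + D.cochain rel F) θ -
        m.negOnePow • S.mul hm θ (φ + D.cochain rel E) := by
  rw [D.inner_eq, add_mul', mul_add', smul_add]
  abel

end InnerDifferential

end CoeffSystem

namespace CoeffSystem

variable {V : Type t} {L : Type w} [Preorder L]

/-- A family of objects with an invertible reduced Maurer-Cartan cochain. For the constant systems
these are the objects of `Δ_n(B)`. -/
@[ext]
structure DescentDatum (S : CoeffSystem.{u, v} V L) (rel : V → V → Prop) where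
  E : ∀ a, S.Ob a
  φ : S.Cochain rel E E 1
  isReduced : φ.IsReduced
  isMaurerCartan : IsMaurerCartan φ
  isInvertible : φ.IsInvertible

/-- The dg-category of descent data, with all cochains as morphisms and the differential
`θ ↦ D θ + ψ · θ - (-1) ^ |θ| θ · φ`. -/
def descentCat (S : CoeffSystem.{u, v} V L) (rel : V → V → Prop) : DGCat :=
  (S.cochains rel).twist (Ob' := S.DescentDatum rel) DescentDatum.E DescentDatum.φ
    DescentDatum.isMaurerCartan

end CoeffSystem

/-- The multi-index with the given entries. -/
def Simplex.ofTuple {V : Type t} {k : ℕ} (α : Fin (k + 1) → V) :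
    Simplex anyRel k (α 0) (α (Fin.last k)) where
  v := α
  adm _ _ _ := trivial
  first := rfl
  last := rfl

lemma DGFunctor.IsIso.comp {A B C : DGCat} {F : DGFunctor A B} {G : DGFunctor B C} (hF : F.IsIso)
    (hG : G.IsIso) : (F.comp G).IsIso :=
  ⟨hG.1.comp hF.1, fun X Y p => (hG.2 _ _ p).comp (hF.2 X Y p)⟩

section Complexes

variable {X : TopCat.{u}} (R : X.Sheaf RingCat.{v}) {ι : Type t} (U : ι → Opens X)

/-- The complexes of sheaves of `R`-modules on the open sets of the family `U` and on their
intersections. -/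
def complexSystem : CoeffSystem ι (Opens X) where
  dom := U
  inter α := inter U α
  inter_le α x := fun _ hy => hy x
  le_inter α _ h := fun _ hy x => h x hy
  cat W := cpx.{u, v, w} R W
  Ob i := Cplx.{u, v, w} R (U i)
  obj h K := K.restrict h
  res {_ _ _ _} hW {ha hb K L q} f := (cpxRes hW).map (X := K.restrict ha) (Y := L.restrict hb) f
  res_add hW ha hb K L q f g := (cpxRes hW).map_add _ _
  res_one hW ha K := (cpxRes hW).map_one _
  res_comp := by intros; exact (cpxRes _).map_comp _ _ _
  res_d := by intros; exact (cpxRes _).map_d _ _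
  res_refl := by intros; rfl
  res_res := by intros; rfl

lemma cpx_d_eq {W : Opens X} {K L : Cplx.{u, v, w} R W} {p q : ℤ} (h : p + 1 = q)
    (f : GHom K.E L.E p) : (cpx.{u, v, w} R W).d (X := K) (Y := L) h f =
      GHom.comp (by omega) L.d f - p.negOnePow • GHom.comp h f K.d :=
  congrArg (· - p.negOnePow • GHom.comp h f K.d) (zero_add (GHom.comp (by omega) L.d f))

/-- The differentials of the complexes, which generate the differentials of all `Cpx(W)`. -/
def complexDifferential : (complexSystem.{u, v, w} R U).InnerDifferential where
  δ ha K := (K.restrict ha).d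
  res_δ _ _ _ := rfl
  d_eq h f := cpx_d_eq R h f
  δ_comp_δ ha K := (K.restrict ha).d_comp_d

end Complexes

section Connection

variable {X : TopCat.{u}} {R : X.Sheaf RingCat.{v}} {ι : Type t} {U : ι → Opens X}

namespace PreTwisted

variable (T : PreTwisted.{u, v, w} R U)

/-- The complexes `(E_i, a^{0,1}_i)` of a twisted complex. -/
def complexes (i : ι) : (complexSystem.{u, v, w} R U).Ob i := T.cplx i

/-- The cochain `a` of a twisted complex, as a cochain of the complexes `(E_i, a^{0,1}_i)`. -/
def cochain : (complexSystem.{u, v, w} R U).Cochain anyRel T.complexes T.complexes 1 := T.a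

/-- The cochain `∑_{k ≥ 1} a^{k,1-k}` of the complexes `(E_i, a^{0,1}_i)`. -/
def connection : (complexSystem.{u, v, w} R U).Cochain anyRel T.complexes T.complexes 1 :=
  T.cochain - (complexDifferential R U).cochain anyRel T.complexes

lemma connection_add_cochain :
    T.connection + (complexDifferential R U).cochain anyRel T.complexes = T.cochain :=
  sub_add_cancel _ _

lemma connection_of_ne {k : ℕ} (hk : k ≠ 0) {q : ℤ} (h : k + q = 1) {i j : ι}
    (s : Simplex anyRel k i j) : T.connection k q h i j s = T.cochain k q h i j s :=
  (congrArg (T.cochain k q h i j s - ·) ((complexDifferential R U).cochain_of_ne hk h s)).trans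
    (sub_zero _)

lemma cochain_zero {q : ℤ} (h : (0 : ℕ) + q = 1) {i j : ι} (s : Simplex anyRel 0 i j) :
    T.cochain 0 q h i j s = (complexDifferential R U).cochain anyRel T.complexes 0 q h i j s := by
  obtain rfl := s.first_eq_last rfl
  obtain rfl : q = 1 := by omega
  rw [(complexDifferential R U).cochain_zero h s]
  obtain rfl : s = Simplex.vertex anyRel i trivial := Subsingleton.elim _ _
  rfl

lemma isReduced_connection : T.connection.IsReduced := fun _ h _ _ s =>
  sub_eq_zero_of_eq (T.cochain_zero h s)

lemma isMaurerCartan_connection : CoeffSystem.IsMaurerCartan T.connection :=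
  ((complexDifferential R U).isMaurerCartan_iff _).2 <| by
    rw [connection_add_cochain]
    exact T.mc

lemma invertibleAt_iff {i j : ι} (s : Simplex anyRel 1 i j) :
    T.InvertibleAt s ↔ ((complexSystem R U).cat ((complexSystem R U).region s)).IsHtpyInvertible
      rfl (T.connection 1 0 (by omega) i j s) := by
  rw [connection_of_ne T one_ne_zero]
  rfl

lemma isInvertible_connection_iff :
    T.connection.IsInvertible ↔ ∀ (i j : ι) (s : Simplex anyRel 1 i j), T.InvertibleAt s :=
  forall_congr' fun _ => forall_congr' fun _ => forall_congr' fun s => (T.invertibleAt_iff s).symm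

lemma nondegenerate_iff :
    T.Nondegenerate ↔ ∀ (i j : ι) (s : Simplex anyRel 1 i j), T.InvertibleAt s := by
  refine ⟨fun H => T.isInvertible_connection_iff.1 fun i j s => ?_, fun H i s => H i i s⟩
  have loop (i : ι) {W : Opens X} (hW : W ≤ U i) : (cpx R W).IsHtpyInvertible rfl
      (T.connection.ev (q := 0) (by omega) (Simplex.ofTuple ![i, i])
        (CoeffSystem.le_region_one _ hW hW)) :=
    (cpxRes _).map_isHtpyInvertible rfl _ ((T.invertibleAt_iff _).1 (H i _))
  rw [← CoeffSystem.ev_self T.connection _ s le_rfl]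
  have hi := (complexSystem R U).region_first s
  have hj := (complexSystem R U).region_last s
  exact T.isMaurerCartan_connection.isHtpyInvertible_ev T.isReduced_connection
    (Simplex.ofTuple ![j, i]) (Simplex.ofTuple ![i, j, i]) rfl (Simplex.ofTuple ![j, i, j]) rfl
    hi hj (loop i hi) (loop j hj)

end PreTwisted

section Inverse

variable {K : ∀ i, (complexSystem.{u, v, w} R U).Ob i}
  {φ : (complexSystem R U).Cochain anyRel K K 1}

/-- The graded sheaves of a family of complexes, with the cochain `a` that consists of the
differentials and a Maurer-Cartan cochain. -/
def PreTwisted.ofMaurerCartan (φ : (complexSystem R U).Cochain anyRel K K 1)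
    (hφ : CoeffSystem.IsMaurerCartan φ) : PreTwisted.{u, v, w} R U where
  E i := Cplx.E (K i)
  a := φ + (complexDifferential R U).cochain anyRel K
  mc := ((complexDifferential R U).isMaurerCartan_iff φ).1 hφ

lemma PreTwisted.ofMaurerCartan_connection (T : PreTwisted.{u, v, w} R U) :
    ofMaurerCartan T.connection T.isMaurerCartan_connection = T := by
  rw [PreTwisted.mk.injEq]
  exact ⟨rfl, heq_of_eq T.connection_add_cochain⟩

lemma PreTwisted.complexes_ofMaurerCartan (hφ : CoeffSystem.IsMaurerCartan φ) (h₀ : φ.IsReduced) :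
    (ofMaurerCartan φ hφ).complexes = K := by
  funext i
  have hd : ((ofMaurerCartan φ hφ).cplx i).d = Cplx.d (K i) := by
    let s := Simplex.vertex anyRel i trivial
    have hi : U i ≤ (complexSystem R U).region s := (complexSystem R U).le_region_vertex trivial
    refine (CoeffSystem.ev_add φ _ (by omega) s hi).trans ?_
    rw [h₀.ev_eq_zero, zero_add, CoeffSystem.InnerDifferential.ev_cochain_zero]
    rfl
  refine (Cplx.mk.injEq ..).mpr ⟨rfl, heq_of_eq hd⟩

lemma PreTwisted.connection_heq (T : PreTwisted.{u, v, w} R U)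
    {K : ∀ i, (complexSystem.{u, v, w} R U).Ob i} (hK : T.complexes = K)
    (φ : (complexSystem R U).Cochain anyRel K K 1)
    (h : HEq T.cochain (φ + (complexDifferential R U).cochain anyRel K)) : HEq T.connection φ := by
  subst hK
  exact heq_of_eq (sub_eq_of_eq_add (eq_of_heq h))

lemma PreTwisted.connection_ofMaurerCartan (hφ : CoeffSystem.IsMaurerCartan φ)
    (h₀ : φ.IsReduced) : HEq (ofMaurerCartan φ hφ).connection φ :=
  connection_heq _ (complexes_ofMaurerCartan hφ h₀) φ HEq.rfl

end Inverse

section TwistedComplex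

lemma CoeffSystem.DescentDatum.isInvertible_of_heq {V : Type t} {L : Type w} [Preorder L]
    {S : CoeffSystem.{u, v} V L} {rel : V → V → Prop} (x : S.DescentDatum rel) {E : ∀ a, S.Ob a}
    {φ : S.Cochain rel E E 1} (hE : E = x.E) (hφ : HEq φ x.φ) : φ.IsInvertible := by
  subst hE
  exact eq_of_heq hφ ▸ x.isInvertible

/-- The descent datum `∑_{k ≥ 1} a^{k,1-k}` of the complexes `(E_i, a^{0,1}_i)` that belongs to a
twisted complex. -/
def TwistedComplex.descentDatum (T : TwistedComplex.{u, v, w} R U) :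
    (complexSystem.{u, v, w} R U).DescentDatum anyRel where
  E := T.complexes
  φ := T.connection
  isReduced := T.isReduced_connection
  isMaurerCartan := T.isMaurerCartan_connection
  isInvertible := T.isInvertible_connection_iff.2 (T.nondegenerate_iff.1 T.nondeg)

lemma TwistedComplex.descentDatum_injective :
    Function.Injective (descentDatum (R := R) (U := U)) := by
  intro T T' h
  have hT := congrArg (fun x => PreTwisted.ofMaurerCartan x.φ x.isMaurerCartan) h
  replace hT := (T.ofMaurerCartan_connection.symm.trans hT).trans T'.ofMaurerCartan_connection
  cases T
  cases T'
  exact (TwistedComplex.mk.injEq ..).mpr hT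

lemma TwistedComplex.descentDatum_surjective :
    Function.Surjective (descentDatum (R := R) (U := U)) := by
  intro x
  let T := PreTwisted.ofMaurerCartan x.φ x.isMaurerCartan
  have hE : T.complexes = x.E := PreTwisted.complexes_ofMaurerCartan x.isMaurerCartan x.isReduced
  have hφ : HEq T.connection x.φ :=
    PreTwisted.connection_ofMaurerCartan x.isMaurerCartan x.isReduced
  have hT := T.isInvertible_connection_iff.1 (x.isInvertible_of_heq hE hφ)
  exact ⟨⟨T, T.nondegenerate_iff.2 hT⟩, CoeffSystem.DescentDatum.ext hE hφ⟩

variable (R U)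

/-- The dg-functor that splits off the components `a^{0,1}_i` of twisted complexes. -/
def twToDescent :
    DGFunctor (Tw.{u, v, w} R U) ((complexSystem.{u, v, w} R U).descentCat anyRel) where
  obj := TwistedComplex.descentDatum
  map θ := θ
  map_add _ _ := rfl
  map_one _ := rfl
  map_comp _ _ _ := rfl
  map_d {T T' m m'} h (θ : (cechSystem R U).Cochain anyRel T.E T'.E m) := by
    have inner_eq : (cechSystem R U).inner h θ = 0 := by
      funext k q h i j s
      exact smul_zero (k : ℤ).negOnePow
    have twist_eq := (complexDifferential R U).twist_d_eq h T.connection T'.connection θ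
    rw [T.connection_add_cochain, T'.connection_add_cochain] at twist_eq
    have d_eq : (cechSystem R U).inner h θ + (cechSystem R U).delta h θ +
        (cechSystem R U).mul (by omega) T'.a θ - m.negOnePow • (cechSystem R U).mul h θ T.a =
          (cechSystem R U).delta h θ + (cechSystem R U).mul (by omega) T'.a θ -
            m.negOnePow • (cechSystem R U).mul h θ T.a := by
      rw [inner_eq, zero_add]
    exact d_eq.trans twist_eq.symm

lemma twToDescent_isIso : (twToDescent.{u, v, w} R U).IsIso :=
  ⟨⟨TwistedComplex.descentDatum_injective, TwistedComplex.descentDatum_surjective⟩,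
    fun _ _ _ => Function.bijective_id⟩

end TwistedComplex

end Connection

namespace DGCat

variable {κ : Type t} (A : κ → DGCat.{u, v}) {X X' Y Y' : (pi A).Ob} {p : ℤ}

/-- The component of a morphism in a product of dg-categories, as an additive map. -/
def piEval (X Y : (pi A).Ob) (p : ℤ) (i : κ) : (pi A).Hom X Y p →+ (A i).Hom (X i) (Y i) p :=
  AddMonoidHom.mk' (fun f => f i) fun _ _ => rfl

lemma pi_sum_apply {τ : Type*} (S : Finset τ) (f : τ → (pi A).Hom X Y p) (i : κ) :
    (∑ x ∈ S, f x) i = ∑ x ∈ S, (f x i : (A i).Hom (X i) (Y i) p) :=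
  map_sum (piEval A X Y p i) f S

lemma pi_asum_apply (n : ℕ) (f : ∀ a b : ℕ, a + b = n → (pi A).Hom X Y p) (i : κ) :
    asum n f i = asum n fun a b h => (f a b h i : (A i).Hom (X i) (Y i) p) :=
  map_asum (piEval A X Y p i) n f

lemma castHom_pi_apply (hX : X = X') (hY : Y = Y') (f : (pi A).Hom X Y p) (i : κ) :
    (pi A).castHom hX hY f i = (A i).castHom (congrFun hX i) (congrFun hY i) (f i) := by
  subst hX hY
  rfl

end DGCat

section Spread

variable {X : TopCat.{u}} {R : X.Sheaf RingCat.{v}} {ι : Type t} {U : ι → Opens X}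

/-- The multi-index `(0, …, k)`. -/
def Simplex.universal (k : ℕ) : Simplex (leRel k) k 0 (Fin.last k) where
  v x := x
  adm _ _ h := h
  first := rfl
  last := rfl

/-- The objects of `Cpx(N_n)` attached to a family `K` of complexes: the `i`-th one is, over
`U_{α_0 … α_n}`, the restriction of `K_{α_i}`. -/
def cplxVertices (K : ∀ i, (complexSystem.{u, v, w} R U).Ob i) (n : ℕ) :
    ∀ i, (constSystem (nerveCat.{u, v, w} R U n) n).Ob i :=
  fun i α => Cplx.restrict (K (α i)) fun _ hx => hx i

/-- The cochains of `Δ_n(Cpx(N_n))` between the objects attached to two families of complexes. -/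
abbrev NerveCochain (K L : ∀ i, (complexSystem.{u, v, w} R U).Ob i) (n : ℕ) (m : ℤ) :=
  (constSystem (nerveCat.{u, v, w} R U n) n).Cochain (leRel n) (cplxVertices K n)
    (cplxVertices L n) m

variable {K L M : ∀ i, (complexSystem.{u, v, w} R U).Ob i} {m m' : ℤ}

/-- The cochain of `Δ_n(Cpx(N_n))` with the components `c_{α_{i_0} … α_{i_k}}`, restricted to
`U_{α_0 … α_n}`, as an additive function of the Čech cochain `c`. -/
def spreadHom (K L : ∀ i, (complexSystem.{u, v, w} R U).Ob i) (n : ℕ) (m : ℤ) :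
    (complexSystem.{u, v, w} R U).Cochain anyRel K L m →+ NerveCochain K L n m :=
  AddMonoidHom.mk' (fun c k q h i j s α => c.ev h (s.relabel α) (W := inter U α)
    fun _ hx l => hx (s.v l)) fun c c' => by
      funext k q h i j s α
      exact CoeffSystem.ev_add c c' h (s.relabel α) _

lemma spreadHom_mul {m₁ m₂ : ℤ} (hm : m₁ + m₂ = m)
    (c : (complexSystem R U).Cochain anyRel L M m₁) (c' : (complexSystem R U).Cochain anyRel K L m₂)
    (n : ℕ) : spreadHom K M n m ((complexSystem R U).mul hm c c') =
      (constSystem (nerveCat R U n) n).mul hm (spreadHom L M n m₁ c) (spreadHom K L n m₂ c') := by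
  funext k q h i j s α
  refine (CoeffSystem.ev_mul hm c c' h (s.relabel α) _).trans ?_
  refine Eq.trans ?_ (DGCat.pi_asum_apply (fun α : Fin (n + 1) → ι => cpx.{u, v, w} R (inter U α))
    (X := cplxVertices K n j) (Y := cplxVertices M n i) (p := q) _ _ α).symm
  rfl

lemma spreadHom_delta (hm : m + 1 = m') (c : (complexSystem R U).Cochain anyRel K L m) (n : ℕ) :
    spreadHom K L n m' ((complexSystem R U).delta hm c) =
      (constSystem (nerveCat R U n) n).delta hm (spreadHom K L n m c) := by
  funext k q h i j s α
  rcases k with _ | k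
  · exact CoeffSystem.ev_delta_zero hm c h (s.relabel α) _
  · refine (CoeffSystem.ev_delta_succ hm c h (by push_cast at h; omega) (s.relabel α) _).trans ?_
    refine Eq.trans ?_ (DGCat.pi_sum_apply
      (fun α : Fin (n + 1) → ι => cpx.{u, v, w} R (inter U α)) (X := cplxVertices K n j)
      (Y := cplxVertices L n i) (p := q) _ _ α).symm
    exact Finset.sum_congr rfl fun x _ => rfl

lemma spreadHom_inner (hm : m + 1 = m') (c : (complexSystem R U).Cochain anyRel K L m) (n : ℕ) :
    spreadHom K L n m' ((complexSystem R U).inner hm c) =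
      (constSystem (nerveCat R U n) n).inner hm (spreadHom K L n m c) := by
  funext k q h i j s α
  exact CoeffSystem.ev_inner hm c h (by omega) (s.relabel α) _

lemma spreadHom_one (K : ∀ i, (complexSystem.{u, v, w} R U).Ob i) (n : ℕ) :
    spreadHom K K n 0 ((complexSystem R U).oneCochain K) =
      (constSystem (nerveCat R U n) n).oneCochain (rel := leRel n) (cplxVertices K n) := by
  funext k q h i j s α
  by_cases hk : k = 0
  · subst hk
    obtain rfl := s.first_eq_last rfl
    obtain rfl : q = 0 := by omega
    exact CoeffSystem.ev_one_zero (S := complexSystem R U) (E := K) h (s.relabel α) _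
  · have one_eq_zero : (constSystem (nerveCat R U n) n).oneCochain (cplxVertices K n) k q h i j s =
        0 := dif_neg hk
    exact (CoeffSystem.ev_one_of_ne (S := complexSystem R U) (E := K) hk h (s.relabel α) _).trans
      (congrFun one_eq_zero α).symm

lemma spreadHom_inner_add_delta (hm : m + 1 = m')
    (c : (complexSystem R U).Cochain anyRel K L m) (n : ℕ) :
    spreadHom K L n m' ((complexSystem R U).inner hm c + (complexSystem R U).delta hm c) =
      (constSystem (nerveCat R U n) n).inner hm (spreadHom K L n m c) +
        (constSystem (nerveCat R U n) n).delta hm (spreadHom K L n m c) := by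
  rw [map_add, spreadHom_inner, spreadHom_delta]

variable (R U) in
/-- The dg-functor from the Čech cochains of families of complexes to the cochains of
`Δ_n(Cpx(N_n))`. -/
def spreadFunctor (n : ℕ) : DGFunctor ((complexSystem.{u, v, w} R U).cochains anyRel)
    (simplexCochains (nerveCat.{u, v, w} R U n) n) where
  obj K := cplxVertices K n
  map {K L m} c := spreadHom K L n m c
  map_add {K L m} c c' := map_add (spreadHom K L n m) c c'
  map_one K := spreadHom_one K n
  map_comp h c c' := spreadHom_mul h c c' n
  map_d h c := spreadHom_inner_add_delta h c n

/-- Compatibility of a family of simplicial cochains with the monotone maps `[n] → [n']`. -/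
def IsCompatible (η : ∀ n, NerveCochain K L n m) : Prop :=
  ∀ (n n' : ℕ) (σ : Fin (n + 1) →o Fin (n' + 1)) (k : ℕ) (q : ℤ) (h : k + q = m)
    (i j : Fin (n + 1)) (s : Simplex (leRel n) k i j),
    (nerveMap R U σ).map (η n k q h i j s) = η n' k q h (σ i) (σ j) (s.mapOrder σ)

lemma isCompatible_spreadHom (c : (complexSystem R U).Cochain anyRel K L m) :
    IsCompatible fun n => spreadHom K L n m c :=
  fun _ _ _ _ _ _ _ _ _ => rfl

/-- The Čech cochain given by the components of a family at the multi-indices `(0, …, k)`. -/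
def collapse (η : ∀ n, NerveCochain K L n m) : (complexSystem.{u, v, w} R U).Cochain anyRel K L m :=
  fun k q h a b s => by
    obtain ⟨v, adm, rfl, rfl⟩ := s
    exact η k k q h 0 (Fin.last k) (Simplex.universal k) v

-- Every multi-index `(i_0, …, i_k)` of `[n]` is the image of `(0, …, k)` under a monotone map.
lemma spreadHom_collapse {η : ∀ n, NerveCochain K L n m} (hη : IsCompatible η) (n : ℕ) :
    spreadHom K L n m (collapse η) = η n := by
  funext k q h i j s α
  obtain ⟨v, adm, rfl, rfl⟩ := s
  exact congrFun (hη k n ⟨v, adm⟩ k q h 0 (Fin.last k) (Simplex.universal k)) α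

lemma collapse_spreadHom (c : (complexSystem R U).Cochain anyRel K L m) :
    collapse (fun n => spreadHom K L n m c) = c := by
  funext k q h a b s
  obtain ⟨v, adm, rfl, rfl⟩ := s
  rfl

lemma spreadHom_injective {c c' : (complexSystem R U).Cochain anyRel K L m}
    (h : ∀ n, spreadHom K L n m c = spreadHom K L n m c') : c = c' := by
  rw [← collapse_spreadHom c, ← collapse_spreadHom c', funext h]

lemma isReduced_spreadHom {c : (complexSystem R U).Cochain anyRel K L m} (hc : c.IsReduced)
    (n : ℕ) : (spreadHom K L n m c).IsReduced := by
  intro q h i j s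
  funext α
  exact hc.ev_eq_zero h (s.relabel α) _

lemma isReduced_collapse {η : ∀ n, NerveCochain K L n m} (hη : ∀ n, (η n).IsReduced) :
    (collapse η).IsReduced := by
  rintro q h a b ⟨v, adm, rfl, rfl⟩
  exact congrFun (hη 0 q h 0 (Fin.last 0) (Simplex.universal 0)) v

lemma isMaurerCartan_spreadHom {φ : (complexSystem R U).Cochain anyRel K K 1}
    (hφ : CoeffSystem.IsMaurerCartan φ) (n : ℕ) :
    CoeffSystem.IsMaurerCartan (spreadHom K K n 1 φ) :=
  (spreadFunctor R U n).map_mc (X := K) φ hφ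

lemma isMaurerCartan_of_spreadHom {φ : (complexSystem R U).Cochain anyRel K K 1}
    (hφ : ∀ n, CoeffSystem.IsMaurerCartan (spreadHom K K n 1 φ)) :
    CoeffSystem.IsMaurerCartan φ := by
  refine spreadHom_injective fun n => ?_
  rw [map_add, map_zero, spreadHom_inner_add_delta, spreadHom_mul]
  exact hφ n

lemma isInvertible_spreadHom {φ : (complexSystem R U).Cochain anyRel K K 1}
    (hφ : φ.IsInvertible) (n : ℕ) : (spreadHom K K n 1 φ).IsInvertible := fun i j s =>
  DGCat.pi_isHtpyInvertible_iff.2 fun α => (cpxRes _).map_isHtpyInvertible rfl _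
    (hφ (α i) (α j) (s.relabel α))

lemma isInvertible_collapse {φ : ∀ n, NerveCochain K K n 1} (hφ : ∀ n, (φ n).IsInvertible) :
    (collapse φ).IsInvertible := by
  rintro a b ⟨v, adm, rfl, rfl⟩
  exact DGCat.pi_isHtpyInvertible_iff.1 (hφ 1 0 1 (Simplex.universal 1)) v

end Spread

section SimplexObj

variable {B : DGCat.{u, v}} {n : ℕ} {x x' y y' : SimplexObj B n}

lemma castHom_simplexCat_apply (hx : x = x') (hy : y = y') {m : ℤ}
    (θ : (constSystem B n).Cochain (leRel n) x.E y.E m) (k : ℕ) (q : ℤ) (h : k + q = m)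
    (i j : Fin (n + 1)) (s : Simplex (leRel n) k i j) :
    (show (constSystem B n).Cochain (leRel n) x'.E y'.E m from
      (simplexCat B n).castHom hx hy θ) k q h i j s =
      B.castHom (congrArg (fun z : SimplexObj B n => z.E j) hx)
        (congrArg (fun z : SimplexObj B n => z.E i) hy) (θ k q h i j s) := by
  subst hx hy
  rfl

lemma SimplexObj.castHom_φ (hx : x = x') (k : ℕ) (q : ℤ) (h : k + q = 1) (i j : Fin (n + 1))
    (s : Simplex (leRel n) k i j) :
    B.castHom (congrArg (fun z : SimplexObj B n => z.E j) hx)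
      (congrArg (fun z : SimplexObj B n => z.E i) hx) (x.φ k q h i j s) = x'.φ k q h i j s := by
  subst hx
  rfl

lemma SimplexObj.ext_heq (hE : x.E = x'.E) (hφ : HEq x.φ x'.φ) : x = x' := by
  obtain ⟨E, φ, _, _, _⟩ := x
  obtain ⟨E', φ', _, _, _⟩ := x'
  exact (SimplexObj.mk.injEq ..).mpr ⟨hE, hφ⟩

lemma SimplexObj.exists_eq_mk (x : SimplexObj B n) (E : ∀ i, (constSystem B n).Ob i)
    (hE : x.E = E) : ∃ φ h₀ hmc hinv, x = ⟨E, φ, h₀, hmc, hinv⟩ := by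
  subst hE
  exact ⟨x.φ, x.φ_zero, x.mc, x.inv, rfl⟩

end SimplexObj

namespace Tot

variable {B : CosimplicialObject DGCat.{u, v}}

lemma simplexMap_simplexObj (x : (Tot B).Ob) {n n' : SimplexCategory} (σ : n ⟶ n') :
    (simplexMap (B.map σ) n.len).obj (simplexObj x n) =
      (simplexPull (B.obj n') σ.toOrderHom).obj (simplexObj x n') :=
  congrFun x.2 ⟨n, n', σ⟩

lemma map_vertex (x : (Tot B).Ob) {n n' : SimplexCategory} (σ : n ⟶ n') (i : Fin (n.len + 1)) :
    DGFunctor.obj (B.map σ) (vertex x n i) = vertex x n' (σ.toOrderHom i) :=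
  congrArg (fun z : SimplexObj (B.obj n') n.len => z.E i) (simplexMap_simplexObj x σ)

lemma mem_eqHom_iff {x y : (Tot B).Ob} {m : ℤ} (η : (totSource B).Hom x.1 y.1 m) :
    η ∈ DGCat.eqHom (totLeft B) (totRight B) x y m ↔
      ∀ (n n' : SimplexCategory) (σ : n ⟶ n') (k : ℕ) (q : ℤ) (h : k + q = m)
        (i j : Fin (n.len + 1)) (s : Simplex (leRel n.len) k i j),
        (B.obj n').castHom (map_vertex x σ j) (map_vertex y σ i)
          (DGFunctor.map (B.map σ)
            ((show (constSystem (B.obj n) n.len).Cochain (leRel n.len) _ _ m from η n) k q h i j s))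
          = (show (constSystem (B.obj n') n'.len).Cochain (leRel n'.len) _ _ m from η n') k q h
            (σ.toOrderHom i) (σ.toOrderHom j) (s.mapOrder σ.toOrderHom) := by
  have left_apply (n n' : SimplexCategory) (σ : n ⟶ n') (k : ℕ) (q : ℤ) (h : k + q = m)
      (i j : Fin (n.len + 1)) (s : Simplex (leRel n.len) k i j) :
      (show (constSystem (B.obj n') n.len).Cochain (leRel n.len)
          (fun i => vertex x n' (σ.toOrderHom i)) (fun i => vertex y n' (σ.toOrderHom i)) m from
        (totTarget B).castHom x.2 y.2 ((totLeft B).map (X := x.1) (Y := y.1) η) ⟨n, n', σ⟩)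
          k q h i j s =
        (B.obj n').castHom (map_vertex x σ j) (map_vertex y σ i)
          (DGFunctor.map (B.map σ)
            ((show (constSystem (B.obj n) n.len).Cochain (leRel n.len) _ _ m from η n)
              k q h i j s)) := by
    refine (congrFun (congrFun (congrFun (congrFun (congrFun (congrFun
      (DGCat.castHom_pi_apply _ x.2 y.2 _ ⟨n, n', σ⟩) k) q) h) i) j) s).trans ?_
    exact castHom_simplexCat_apply _ _ _ k q h i j s
  constructor
  · intro H n n' σ k q h i j s
    exact (left_apply n n' σ k q h i j s).symm.trans (congrFun (congrFun (congrFun (congrFun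
      (congrFun (congrFun (congrFun H ⟨n, n', σ⟩) k) q) h) i) j) s)
  · intro H
    funext σ k q h i j s
    exact (left_apply _ _ _ k q h i j s).trans (H _ _ _ k q h i j s)

end Tot

lemma DGFunctor.map_twist_d {A : DGCat.{u, v}} {B : DGCat.{w, t}} (F : DGFunctor A B) {X Y : A.Ob}
    (α : A.Hom X X 1) (β : A.Hom Y Y 1) {p q : ℤ} (h : p + 1 = q) (f : A.Hom X Y p) :
    F.map (A.d h f + A.comp (by omega) β f - p.negOnePow • A.comp h f α) =
      B.d h (F.map f) + B.comp (by omega) (F.map β) (F.map f) -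
        p.negOnePow • B.comp h (F.map f) (F.map α) := by
  rw [F.map_sub, F.map_add, F.map_smul, F.map_d, F.map_comp, F.map_comp]

section Comparison

variable {X : TopCat.{u}} {R : X.Sheaf RingCat.{v}} {ι : Type t} {U : ι → Opens X}

namespace CoeffSystem.DescentDatum

/-- The object of `Δ_n(Cpx(N_n))` attached to a descent datum of complexes. -/
def simplexObj (x : (complexSystem.{u, v, w} R U).DescentDatum anyRel) (n : ℕ) :
    SimplexObj (nerveCat.{u, v, w} R U n) n where
  E := cplxVertices x.E n
  φ := spreadHom x.E x.E n 1 x.φ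
  φ_zero := isReduced_spreadHom x.isReduced n
  mc := isMaurerCartan_spreadHom x.isMaurerCartan n
  inv := isInvertible_spreadHom x.isInvertible n

/-- The object of the totalization attached to a descent datum of complexes. -/
def totObj (x : (complexSystem.{u, v, w} R U).DescentDatum anyRel) :
    (Tot (cpxNerve.{u, v, w} R U)).Ob :=
  ⟨fun n => x.simplexObj n.len, funext fun σ => SimplexObj.ext_heq rfl <| heq_of_eq <| by
    funext k q h i j s
    exact isCompatible_spreadHom x.φ _ _ σ.2.2.toOrderHom k q h i j s⟩

lemma mem_eqHom_iff_isCompatible {x y : (complexSystem.{u, v, w} R U).DescentDatum anyRel} {m : ℤ}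
    (η : ∀ n : SimplexCategory, NerveCochain x.E y.E n.len m) :
    η ∈ DGCat.eqHom (totLeft (cpxNerve R U)) (totRight (cpxNerve R U)) x.totObj y.totObj m ↔
      IsCompatible fun n => η (SimplexCategory.mk n) :=
  (Tot.mem_eqHom_iff (B := cpxNerve R U) (x := x.totObj) (y := y.totObj) η).trans
    ⟨fun H n n' σ => H (SimplexCategory.mk n) (SimplexCategory.mk n') (SimplexCategory.mkHom σ),
      fun H n n' σ => H n.len n'.len σ.toOrderHom⟩

end CoeffSystem.DescentDatum

variable (R U) in
/-- The dg-functor from the descent data of complexes to the totalization. -/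
def descentToTot : DGFunctor ((complexSystem.{u, v, w} R U).descentCat anyRel)
    (Tot (cpxNerve.{u, v, w} R U)) where
  obj x := CoeffSystem.DescentDatum.totObj x
  map {x y _} θ := ⟨fun n => (spreadFunctor R U n.len).map
      (X := CoeffSystem.DescentDatum.E x) (Y := CoeffSystem.DescentDatum.E y) θ,
    (CoeffSystem.DescentDatum.mem_eqHom_iff_isCompatible _).2 (isCompatible_spreadHom _)⟩
  map_add _ _ := Subtype.ext <| funext fun n => (spreadFunctor R U n.len).map_add _ _
  map_one _ := Subtype.ext <| funext fun n => (spreadFunctor R U n.len).map_one _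
  map_comp h _ _ := Subtype.ext <| funext fun n => (spreadFunctor R U n.len).map_comp h _ _
  map_d {x y _ _} h θ := Subtype.ext <| funext fun n =>
    (spreadFunctor R U n.len).map_twist_d (X := CoeffSystem.DescentDatum.E x)
      (Y := CoeffSystem.DescentDatum.E y) (CoeffSystem.DescentDatum.φ x)
      (CoeffSystem.DescentDatum.φ y) h θ

lemma descentToTot_map_bijective (x y : (complexSystem.{u, v, w} R U).DescentDatum anyRel)
    (m : ℤ) : Function.Bijective fun θ : ((complexSystem.{u, v, w} R U).descentCat anyRel).Hom x y m
      => (descentToTot R U).map θ := by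
  constructor
  · intro θ θ' h
    exact spreadHom_injective (K := x.E) (L := y.E) fun n =>
      congrFun (congrArg Subtype.val h) (SimplexCategory.mk n)
  · intro η
    have hη := (CoeffSystem.DescentDatum.mem_eqHom_iff_isCompatible (x := x) (y := y) η.1).1 η.2
    exact ⟨collapse (K := x.E) (L := y.E) _, Subtype.ext <| funext fun n =>
      spreadHom_collapse hη n.len⟩

lemma le_inter_const (i : ι) {n : ℕ} : U i ≤ inter U fun _ : Fin (n + 1) => i := fun _ hx _ => hx

lemma cplxVertices_injective {K L : ∀ i, (complexSystem.{u, v, w} R U).Ob i}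
    (h : cplxVertices K 0 = cplxVertices L 0) : K = L := by
  funext i
  exact congrArg (fun z => Cplx.restrict z (le_inter_const i))
    (congrFun (congrFun h 0) fun _ => i)

lemma descentToTot_obj_injective : Function.Injective (descentToTot.{u, v, w} R U).obj := by
  intro (x : CoeffSystem.DescentDatum _ _) (y : CoeffSystem.DescentDatum _ _) h
  have hx (n : ℕ) : x.simplexObj n = y.simplexObj n :=
    congrFun (congrArg Subtype.val h) (SimplexCategory.mk n)
  have hE : x.E = y.E := cplxVertices_injective (congrArg SimplexObj.E (hx 0))
  obtain ⟨E, φ, _, _, _⟩ := x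
  obtain ⟨E', φ', _, _, _⟩ := y
  obtain rfl : E = E' := hE
  obtain rfl : φ = φ' :=
    spreadHom_injective fun n => eq_of_heq ((SimplexObj.mk.injEq ..).mp (hx n)).2
  rfl

lemma descentToTot_obj_surjective : Function.Surjective (descentToTot.{u, v, w} R U).obj := by
  intro x
  let K (i : ι) : (complexSystem.{u, v, w} R U).Ob i :=
    Cplx.restrict (Tot.vertex x (SimplexCategory.mk 0) 0 fun _ => i) (le_inter_const i)
  have hE (n : SimplexCategory) : (Tot.simplexObj x n).E = cplxVertices K n.len := by
    funext i α
    exact (congrFun (Tot.map_vertex x (SimplexCategory.const (SimplexCategory.mk 0) n i) 0) α).symm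
  choose φ h₀ hmc hinv hx using fun n => (Tot.simplexObj x n).exists_eq_mk _ (hE n)
  have hφ : IsCompatible fun n => φ (SimplexCategory.mk n) := by
    intro n n' σ k q h i j s
    have map_eq := Tot.simplexMap_simplexObj x (SimplexCategory.mkHom σ)
    rw [hx, hx] at map_eq
    exact SimplexObj.castHom_φ map_eq k q h i j s
  have spread_eq := spreadHom_collapse hφ
  refine ⟨⟨K, collapse fun n => φ (SimplexCategory.mk n), isReduced_collapse fun n => h₀ _,
    isMaurerCartan_of_spreadHom fun n => (spread_eq n).symm ▸ hmc (SimplexCategory.mk n),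
    isInvertible_collapse fun n => hinv (SimplexCategory.mk n)⟩, Subtype.ext <| funext fun n => ?_⟩
  refine Eq.trans ?_ (hx n).symm
  exact SimplexObj.ext_heq rfl (heq_of_eq (spread_eq n.len))

variable (R U)

lemma descentToTot_isIso : (descentToTot.{u, v, w} R U).IsIso :=
  ⟨⟨descentToTot_obj_injective, descentToTot_obj_surjective⟩, descentToTot_map_bijective⟩

/-- The comparison dg-functor from twisted complexes to the totalization. -/
def comparison : DGFunctor (Tw.{u, v, w} R U) (Tot (cpxNerve.{u, v, w} R U)) :=
  (twToDescent R U).comp (descentToTot R U)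

lemma comparison_isIso : (comparison.{u, v, w} R U).IsIso :=
  (twToDescent_isIso R U).comp (descentToTot_isIso R U)

end Comparison

section Normalized

variable {X : TopCat.{u}} {R : X.Sheaf RingCat.{v}} {ι : Type t} {U : ι → Opens X}

lemma Simplex.exists_castSucc_eq_succ {n k : ℕ} {i j : Fin (n + 1)} (s : Simplex (leRel n) k i j)
    (h : ¬ Function.Injective s.v) : ∃ l : Fin k, s.v l.castSucc = s.v l.succ := by
  by_contra! hne
  refine h (Fin.strictMono_iff_lt_succ.2 fun l => ?_).injective
  exact lt_of_le_of_ne (s.adm _ _ l.castSucc_lt_succ.le) (hne l)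

lemma exists_eq_comp_predAbove {κ : Type*} {n : ℕ} (v : Fin (n + 2) → κ) (l : Fin (n + 1))
    (hl : v l.castSucc = v l.succ) : ∃ α : Fin (n + 1) → κ, v = α ∘ l.predAbove := by
  refine ⟨v ∘ l.succ.succAbove, funext fun x => ?_⟩
  obtain rfl | hx := eq_or_ne x l.succ
  · simp [hl]
  · exact congrArg v (Fin.succ_succAbove_predAbove hx).symm

namespace TwistedComplex

lemma simplexObj_comparison_φ (T : TwistedComplex.{u, v, w} R U) (n : SimplexCategory) {k : ℕ}
    (hk : k ≠ 0) (q : ℤ) (h : k + q = 1) {i j : Fin (n.len + 1)}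
    (s : Simplex (leRel n.len) k i j) :
    (Tot.simplexObj ((comparison R U).obj T) n).φ k q h i j s =
      spread (T := T.toPreTwisted) (T' := T.toPreTwisted) T.a n.len k q h s := by
  funext α
  exact congrArg (GHom.restrict _) (T.toPreTwisted.connection_of_ne hk h (s.relabel α))

lemma isNormalized_simplexObj {T : TwistedComplex.{u, v, w} R U}
    (hT : T.toPreTwisted.IsNormalized) (n : SimplexCategory) :
    (Tot.simplexObj ((comparison R U).obj T) n).IsNormalized := by
  refine ⟨fun i s => (T.simplexObj_comparison_φ n one_ne_zero 0 (by omega) s).trans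
      (funext fun α => ?_), fun k q h i j s hk hs =>
    (T.simplexObj_comparison_φ n (by omega) q h s).trans (funext fun α => ?_)⟩
  · exact (congrArg (GHom.restrict _) (hT.1 (α i) (s.relabel α))).trans (GHom.restrict_one _ _)
  · obtain ⟨l, hl⟩ := s.exists_castSucc_eq_succ hs
    exact congrArg (GHom.restrict _) (hT.2 k q h (α i) (α j) (s.relabel α) hk ⟨l, congrArg α hl⟩)

lemma isNormalized_of_simplexObj {T : TwistedComplex.{u, v, w} R U}
    (hT : ∀ n, (Tot.simplexObj ((comparison R U).obj T) n).IsNormalized) :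
    T.toPreTwisted.IsNormalized := by
  constructor
  · intro i s
    let r : Simplex (leRel 0) 1 0 0 := ⟨fun _ => 0, fun _ _ _ => le_rfl, rfl, rfl⟩
    obtain rfl : r.relabel (fun _ => i) = s := by
      refine Simplex.ext (funext fun l => ?_)
      fin_cases l
      exacts [s.first.symm, s.last.symm]
    have spread_eq_one :=
      (T.simplexObj_comparison_φ (SimplexCategory.mk 0) one_ne_zero 0 (by omega) r).symm.trans
        ((hT (SimplexCategory.mk 0)).1 0 r)
    have hle : inter U (fun _ : Fin 2 => i) ≤ inter U fun _ : Fin 1 => i := fun _ hx _ => hx 0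
    exact (congrArg (GHom.restrict hle) (congrFun spread_eq_one fun _ => i)).trans
      (GHom.restrict_one _ _)
  · rintro k q h i j ⟨v, adm, rfl, rfl⟩ hk ⟨l, hl⟩
    obtain ⟨n, rfl⟩ : ∃ n, k = n + 1 := ⟨k - 1, by omega⟩
    obtain ⟨α, rfl⟩ := exists_eq_comp_predAbove v l hl
    let r : Simplex (leRel n) (n + 1) (l.predAbove 0) (l.predAbove (Fin.last (n + 1))) :=
      ⟨l.predAbove, fun _ _ h => Fin.predAbove_right_monotone l h, rfl, rfl⟩
    have not_injective : ¬ Function.Injective r.v := fun hr =>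
      l.castSucc_lt_succ.ne (hr (by simp [r]))
    have spread_eq_zero :=
      (T.simplexObj_comparison_φ (SimplexCategory.mk n) n.succ_ne_zero q h r).symm.trans
        ((hT (SimplexCategory.mk n)).2 (n + 1) q h _ _ r hk not_injective)
    have hle : inter U (α ∘ l.predAbove) ≤ inter U α := fun x hx y => by
      obtain ⟨z, rfl⟩ := Fin.predAbove_surjective l y
      exact hx z
    exact congrArg (GHom.restrict hle) (congrFun spread_eq_zero α)

lemma isNormalized_iff (T : TwistedComplex.{u, v, w} R U) : T.toPreTwisted.IsNormalized ↔
    ∀ n, (Tot.simplexObj ((comparison R U).obj T) n).IsNormalized :=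
  ⟨isNormalized_simplexObj, isNormalized_of_simplexObj⟩

end TwistedComplex

end Normalized

end TwTot

theorem proposition9_general {X : TopCat.{u}} (R : X.Sheaf RingCat.{v}) {ι : Type t}
    (U : ι → Opens X) :
    (∃ F : TwTot.DGFunctor (TwTot.Tw.{u, v, w} R U) (TwTot.Tot (TwTot.cpxNerve.{u, v, w} R U)),
      F.IsIso ∧
      (∃ hE : ∀ (T : TwTot.TwistedComplex.{u, v, w} R U) (n : SimplexCategory)
          (i : Fin (n.len + 1)),
          TwTot.Tot.vertex (F.obj T) n i = T.toPreTwisted.vertices n.len i,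
        (∀ (T : TwTot.TwistedComplex.{u, v, w} R U) (n : SimplexCategory) (k : ℕ) (q : ℤ)
          (h : k + q = 1) (i j : Fin (n.len + 1))
          (s : TwTot.Simplex (TwTot.leRel n.len) k i j), 1 ≤ k →
          TwTot.DGCat.castHom _ (hE T n j) (hE T n i) (TwTot.Tot.phi (F.obj T) n k q h s) =
            TwTot.spread (T := T.toPreTwisted) (T' := T.toPreTwisted) T.a n.len k q h s) ∧
        (∀ (T T' : TwTot.TwistedComplex.{u, v, w} R U) (m : ℤ)
          (θ : (TwTot.Tw.{u, v, w} R U).Hom T T' m) (n : SimplexCategory) (k : ℕ) (q : ℤ)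
          (h : k + q = m) (i j : Fin (n.len + 1))
          (s : TwTot.Simplex (TwTot.leRel n.len) k i j),
          TwTot.DGCat.castHom _ (hE T n j) (hE T' n i) (TwTot.Tot.theta (F.map θ) n k q h s) =
            TwTot.spread (T := T.toPreTwisted) (T' := T'.toPreTwisted) θ n.len k q h s)) ∧
      (∀ T : TwTot.TwistedComplex.{u, v, w} R U,
        T.toPreTwisted.IsNormalized ↔
          ∀ n : SimplexCategory, (TwTot.Tot.simplexObj (F.obj T) n).IsNormalized)) ∧
    (∀ T : TwTot.PreTwisted.{u, v, w} R U,
      T.Nondegenerate ↔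
        ∀ (i j : ι) (s : TwTot.Simplex TwTot.anyRel 1 i j), T.InvertibleAt s) := by
  refine ⟨⟨TwTot.comparison R U, TwTot.comparison_isIso R U, ⟨fun T n i => rfl, ?phi, ?theta⟩,
    TwTot.TwistedComplex.isNormalized_iff⟩, TwTot.PreTwisted.nondegenerate_iff⟩
  case phi =>
    intro T n k q h i j s hk
    exact T.simplexObj_comparison_φ n (Nat.one_le_iff_ne_zero.1 hk) q h s
  case theta =>
    intros
    rfl

theorem proposition9 {X : TopCat.{u}} (R : X.Sheaf RingCat.{v}) {ι : Type t} (U : ι → Opens X)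
    (hcov : ⨆ i, U i = ⊤) (hfin : LocallyFinite fun i => (U i : Set X)) :
    (∃ F : TwTot.DGFunctor (TwTot.Tw.{u, v, w} R U) (TwTot.Tot (TwTot.cpxNerve.{u, v, w} R U)),
      F.IsIso ∧
      (∃ hE : ∀ (T : TwTot.TwistedComplex.{u, v, w} R U) (n : SimplexCategory)
          (i : Fin (n.len + 1)),
          TwTot.Tot.vertex (F.obj T) n i = T.toPreTwisted.vertices n.len i,
        (∀ (T : TwTot.TwistedComplex.{u, v, w} R U) (n : SimplexCategory) (k : ℕ) (q : ℤ)
          (h : k + q = 1) (i j : Fin (n.len + 1))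
          (s : TwTot.Simplex (TwTot.leRel n.len) k i j), 1 ≤ k →
          TwTot.DGCat.castHom _ (hE T n j) (hE T n i) (TwTot.Tot.phi (F.obj T) n k q h s) =
            TwTot.spread (T := T.toPreTwisted) (T' := T.toPreTwisted) T.a n.len k q h s) ∧
        (∀ (T T' : TwTot.TwistedComplex.{u, v, w} R U) (m : ℤ)
          (θ : (TwTot.Tw.{u, v, w} R U).Hom T T' m) (n : SimplexCategory) (k : ℕ) (q : ℤ)
          (h : k + q = m) (i j : Fin (n.len + 1))
          (s : TwTot.Simplex (TwTot.leRel n.len) k i j),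
          TwTot.DGCat.castHom _ (hE T n j) (hE T' n i) (TwTot.Tot.theta (F.map θ) n k q h s) =
            TwTot.spread (T := T.toPreTwisted) (T' := T'.toPreTwisted) θ n.len k q h s)) ∧
      (∀ T : TwTot.TwistedComplex.{u, v, w} R U,
        T.toPreTwisted.IsNormalized ↔
          ∀ n : SimplexCategory, (TwTot.Tot.simplexObj (F.obj T) n).IsNormalized)) ∧
    (∀ T : TwTot.PreTwisted.{u, v, w} R U,
      T.Nondegenerate ↔
        ∀ (i j : ι) (s : TwTot.Simplex TwTot.anyRel 1 i j), T.InvertibleAt s) :=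
  proposition9_general R U
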